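/- Let $X$ be a countably infinite set of variables. A literal is a variable or a negated variable, a clause is a finite set of literals, and a CNF is a finite set $F$ of clauses, none of which contains a literal together with its negation. Write $\mathsf{var}(F)$ for the set of variables occurring in $F$ and $\mathsf{size}(F)=\sum_{c\in F}|c|$. The incidence graph $\mathsf{inc}(F)$ is the bipartite graph on $\mathsf{var}(F)\cup F$ in which a variable is adjacent to the clauses in which it occurs (negated or not). For $D\subseteq \mathsf{var}(F)\cup F$, deleting $D$ from $F$ gives the CNF $\{\,c\setminus\{l\in c : \mathsf{var}(l)\in D\} : c\in F\setminus D\,\}$ (as clauses form a set, clauses that become equal are identified). Let $\mathcal F$ be the class of CNFs whose incidence graphs are forests. The $\mathcal F$-deletion distance $\mathrm{dist}_{\mathcal F}(F)$ is the least size of a set $D\subseteq\mathsf{var}(F)\cup F$ whose deletion from $F$ gives a CNF in $\mathcal F$. The feedback vertex set number $\mathrm{fvs}(G)$ of a graph $G$ is the least number of vertices whose removal leaves a forest. An OBDD on a finite set $S$ of variables is a finite labelled directed acyclic graph with exactly one source, with at most one sink labelled $0$ and at most one sink labelled $1$ and no other sinks, in which each non-sink vertex is labelled with a variable of $S$ and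 has exactly two outgoing edges, labelled $0$ and $1$, and such that for some total order on $S$ the label strictly increases along every edge between non-sink vertices. It computes the Boolean function that maps an assignment to the label of the sink reached from the source along the edges chosen by the assignment. CNFs have fixed-parameter tractable time computable OBDDs parameterized by $\mathcal F$-deletion distance: there are an algorithm, a computable function $f\colon\mathbb N\to\mathbb N$ and a polynomial $p$ such that, given any CNF $F$ (without its deletion distance), the algorithm returns, in time at most $f(\mathrm{dist}_{\mathcal F}(F))\cdot p(\mathsf{size}(F))$, an OBDD on $\mathsf{var}(F)$ that computes the same Boolean function as $F$. Moreover, $\mathrm{dist}_{\mathcal F}(F)\le \mathrm{fvs}(\mathsf{inc}(F))$ for every CNF $F$, and the same fixed-parameter tractability holds parameterized by the feedback vertex set number $\mathrm{fvs}(\mathsf{inc}(F))$ of the incidence graph. Here an algorithm is a program of the language WHILE: it works on binary trees whose leaves are $\mathsf{nil}$ or variable names (atoms); it has registers, assignments, sequencing, conditionals and while loops; its expressions build and take apart trees and test trees for equality. Every step is charged the number of vertices of the trees that it reads, copies or compares, each variable name counting as one vertex. The input lists the clauses of $F$, each as a list of literals, in any order and without repetitions; the output names the source of the OBDD and lists its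 vertices, each with its name, its label and the names of the heads of its outgoing edges. -/

import Mathlib

namespace CNFtoOBDD

/-! ### Formulas in conjunctive normal form -/

/-- Variables are drawn from a fixed countably infinite set. -/
abbrev Var : Type := ℕ

/-- A literal: `(x, true)` is the variable `x` and `(x, false)` is its negation. -/
abbrev Literal : Type := Var × Bool

/-- A clause is a finite set of literals. -/
abbrev Clause : Type := Finset Literal

/-- The set of variables of a clause. -/
def Clause.vars (c : Clause) : Finset Var := c.image Prod.fst

/-- A CNF is a finite set of non-tautological clauses. -/
@[ext] structure CNF where
  clauses : Finset Clause
  nonTaut : ∀ c ∈ clauses, ∀ x : Var, ¬ ((x, true) ∈ c ∧ (x, false) ∈ c)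

namespace CNF

/-- The variables occurring in a CNF. -/
def vars (F : CNF) : Finset Var := F.clauses.biUnion Clause.vars

/-- The size of a CNF: the sum of the sizes of its clauses. -/
def size (F : CNF) : ℕ := ∑ c ∈ F.clauses, c.card

/-- An assignment satisfies a CNF if it satisfies some literal of each clause. -/
def Sat (F : CNF) (a : Var → Bool) : Prop :=
  ∀ c ∈ F.clauses, ∃ l ∈ c, a l.1 = l.2

/-- The incidence graph of a CNF: its vertices are the variables and the clauses of `F`, and a
variable is adjacent to the clauses in which it occurs. -/
def inc (F : CNF) : SimpleGraph ({x // x ∈ F.vars} ⊕ {c // c ∈ F.clauses}) where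
  Adj
    | .inl x, .inr c => x.1 ∈ Clause.vars c.1
    | .inr c, .inl x => x.1 ∈ Clause.vars c.1
    | _, _ => False
  symm := ⟨by
    rintro (x | c) (y | d) h
    · exact h
    · exact h
    · exact h
    · exact h⟩
  loopless := ⟨by
    rintro (x | c) h
    · exact h
    · exact h⟩

/-- The CNF obtained from `F` by deleting the variables in `V` and the clauses in `C`. -/
def delete (F : CNF) (V : Finset Var) (C : Finset Clause) : CNF where
  clauses := (F.clauses \ C).image fun c => c.filter fun l => l.1 ∉ V
  nonTaut := by
    intro d hd x hx
    obtain ⟨c, hc, rfl⟩ := Finset.mem_image.mp hd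
    exact F.nonTaut c (Finset.mem_sdiff.mp hc).1 x
      ⟨(Finset.mem_filter.mp hx.1).1, (Finset.mem_filter.mp hx.2).1⟩

/-- The variables `V` and clauses `C` of `F` form a deletion set of `F` with respect to some
member of the class `K`. -/
def IsDeletionSet (K : Set CNF) (F : CNF) (V : Finset Var) (C : Finset Clause) : Prop :=
  V ⊆ F.vars ∧ C ⊆ F.clauses ∧ F.delete V C ∈ K

/-- The `K`-deletion distance of `F`: the least number of variables and clauses of `F` whose
deletion yields a member of `K`. -/
noncomputable def deletionDistance (K : Set CNF) (F : CNF) : ℕ :=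
  sInf {k | ∃ V C, IsDeletionSet K F V C ∧ V.card + C.card = k}

/-- The class of CNFs whose incidence graphs are forests. -/
def forests : Set CNF := {F | F.inc.IsAcyclic}

/-- Every CNF has a deletion set to the class of forests, so that the minimum that defines the
deletion distance is over a non-empty set. -/
theorem exists_isDeletionSet_forests (F : CNF) : ∃ V C, IsDeletionSet forests F V C := by
  refine ⟨∅, F.clauses, by simp, subset_rfl, ?_⟩
  have h0 : (F.delete ∅ F.clauses).clauses = ∅ := by simp [delete]
  have hv : IsEmpty ({x // x ∈ (F.delete ∅ F.clauses).vars} ⊕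
      {c // c ∈ (F.delete ∅ F.clauses).clauses}) := by
    constructor
    rintro (⟨x, hx⟩ | ⟨c, hc⟩)
    · simp [vars, h0] at hx
    · simp [h0] at hc
  intro v
  exact (hv.false v).elim

/-- The feedback vertex set number of a graph: the least size of a finite set of vertices whose
removal leaves a forest. -/
noncomputable def fvsNumber {W : Type} (G : SimpleGraph W) : ℕ :=
  sInf {k | ∃ D : Finset W, (G.induce ((D : Set W)ᶜ)).IsAcyclic ∧ D.card = k}

end CNF

/-! ### Ordered binary decision diagrams -/

/-- The label of a vertex of a binary decision diagram with its outgoing edges: a sink carries a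
truth value; any other vertex carries a variable and has exactly one outgoing edge labelled `0`
(to `lo`) and one labelled `1` (to `hi`). -/
inductive Node (W : Type) where
  | sink (b : Bool)
  | branch (x : Var) (lo hi : W)

/-- `u` is the head of an outgoing edge of a vertex with this label. -/
def Node.Succ {W : Type} (v : Node W) (u : W) : Prop :=
  match v with
  | .sink _ => False
  | .branch _ lo hi => u = lo ∨ u = hi

/-- A binary decision diagram: a finite labelled acyclic directed graph with exactly one source
and with at most one sink for each truth value. -/
structure BDD where
  n : ℕ
  node : Fin n → Node (Fin n)
  acyclic : ∀ v, ¬ Relation.TransGen (fun v u => (node v).Succ u) v v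
  sink_unique : ∀ u v b, node u = .sink b → node v = .sink b → u = v
  source : Fin n
  source_unique : ∀ v, (∀ u, ¬ (node u).Succ v) ↔ v = source

namespace BDD

/-- `B.Value a v b`: following the edges activated by the assignment `a`, one gets from `v` to a
sink labelled `b`. -/
inductive Value (B : BDD) (a : Var → Bool) : Fin B.n → Bool → Prop
  | sink {v b} : B.node v = .sink b → Value B a v b
  | branch {v x lo hi b} : B.node v = .branch x lo hi →
      Value B a (if a x then hi else lo) b → Value B a v b

/-- `B` is an ordered binary decision diagram on the variables `S`: all its variables are in `S`,
and there is an ordering `σ` of `S` in which, along every edge between two non-sink vertices, the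
variable strictly increases. -/
def IsOBDD (B : BDD) (S : Finset Var) : Prop :=
  (∀ v x lo hi, B.node v = .branch x lo hi → x ∈ S) ∧
  ∃ σ : List Var, σ.Nodup ∧ σ.toFinset = S ∧
    ∀ u v x lo hi y lo' hi', B.node u = .branch x lo hi → B.node v = .branch y lo' hi' →
      (B.node u).Succ v → σ.idxOf x < σ.idxOf y

/-- `B` computes the same Boolean function as `F`: the sink that is reached from the source is
labelled `1` exactly for the satisfying assignments. -/
def Computes (B : BDD) (F : CNF) : Prop :=
  ∀ a : Var → Bool, ∃ b, B.Value a B.source b ∧ (b = true ↔ F.Sat a)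

end BDD

/-! ### Algorithms and their running time

Algorithms are programs of the textbook language WHILE, whose data are binary trees (as in Lisp).
Atoms stand for the variable names of formulas; a program can copy them and test them for equality,
but it has no constants for them and no arithmetic on them. An evaluation is charged the full size
of all the data that it reads, copies or compares (there is no free sharing of subtrees), so that
running times are polynomially related to those of Turing machines. -/

/-- Binary trees with leaves `nil` and atoms. -/
inductive Data where
  | nil
  | atom (x : Var)
  | cons (d e : Data)
  deriving DecidableEq

namespace Data

/-- The number of vertices of a tree. -/
def size : Data → ℕ
  | nil => 1
  | atom _ => 1
  | cons d e => 1 + d.size + e.size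

/-- The left subtree; `nil` for a leaf. -/
def hd : Data → Data
  | cons d _ => d
  | _ => nil

/-- The right subtree; `nil` for a leaf. -/
def tl : Data → Data
  | cons _ e => e
  | _ => nil

/-- Truth values as trees. -/
def ofBool : Bool → Data
  | false => nil
  | true => cons nil nil

/-- Lists of trees as trees. -/
def ofList : List Data → Data
  | [] => nil
  | d :: l => cons d (ofList l)

end Data

/-- A store: the values of the registers of a program. -/
abbrev Store : Type := ℕ → Data

/-- Expressions. -/
inductive Expr where
  | reg (i : ℕ)
  | nil
  | cons (e e' : Expr)
  | hd (e : Expr)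
  | tl (e : Expr)
  | eq (e e' : Expr)

namespace Expr

/-- The value of an expression. -/
def val (s : Store) : Expr → Data
  | reg i => s i
  | nil => .nil
  | cons e e' => .cons (e.val s) (e'.val s)
  | hd e => (e.val s).hd
  | tl e => (e.val s).tl
  | eq e e' => Data.ofBool (decide (e.val s = e'.val s))

/-- The time to evaluate an expression; it bounds the size of the value from above. -/
def time (s : Store) : Expr → ℕ
  | reg i => (s i).size
  | nil => 1
  | cons e e' => e.time s + e'.time s + 1
  | hd e => e.time s + 1
  | tl e => e.time s + 1
  | eq e e' => e.time s + e'.time s + 1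

end Expr

/-- Programs. A test succeeds if the value of the expression is not `nil`. -/
inductive Program where
  | assign (i : ℕ) (e : Expr)
  | seq (P Q : Program)
  | cond (e : Expr) (P Q : Program)
  | loop (e : Expr) (P : Program)

/-- `P.Runs s s' t`: started with store `s`, the program `P` halts with store `s'` after time
`t`. -/
inductive Program.Runs : Program → Store → Store → ℕ → Prop
  | assign {i e s} : Runs (.assign i e) s (Function.update s i (e.val s)) (e.time s + 1)
  | seq {P Q s s' s'' t t'} : Runs P s s' t → Runs Q s' s'' t' →
      Runs (.seq P Q) s s'' (t + t' + 1)
  | condTrue {e P Q s s' t} : e.val s ≠ .nil → Runs P s s' t →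
      Runs (.cond e P Q) s s' (e.time s + t + 1)
  | condFalse {e P Q s s' t} : e.val s = .nil → Runs Q s s' t →
      Runs (.cond e P Q) s s' (e.time s + t + 1)
  | loopStop {e P s} : e.val s = .nil → Runs (.loop e P) s s (e.time s + 1)
  | loopStep {e P s s' s'' t t'} : e.val s ≠ .nil → Runs P s s' t → Runs (.loop e P) s' s'' t' →
      Runs (.loop e P) s s'' (e.time s + t + t' + 1)

/-- Programs are deterministic. -/
theorem Program.Runs.deterministic {P : Program} {s s₁ s₂ : Store} {t₁ t₂ : ℕ}
    (h₁ : P.Runs s s₁ t₁) (h₂ : P.Runs s s₂ t₂) : s₁ = s₂ ∧ t₁ = t₂ := by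
  induction h₁ generalizing s₂ t₂ with
  | assign => cases h₂; exact ⟨rfl, rfl⟩
  | seq _ _ ih ih' =>
    cases h₂ with
    | seq a b =>
      obtain ⟨rfl, rfl⟩ := ih a
      obtain ⟨rfl, rfl⟩ := ih' b
      exact ⟨rfl, rfl⟩
  | condTrue h _ ih =>
    cases h₂ with
    | condTrue _ a => obtain ⟨rfl, rfl⟩ := ih a; exact ⟨rfl, rfl⟩
    | condFalse h' _ => exact absurd h' h
  | condFalse h _ ih =>
    cases h₂ with
    | condTrue h' _ => exact absurd h h'
    | condFalse _ a => obtain ⟨rfl, rfl⟩ := ih a; exact ⟨rfl, rfl⟩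
  | loopStop h =>
    cases h₂ with
    | loopStop _ => exact ⟨rfl, rfl⟩
    | loopStep h' _ _ => exact absurd h h'
  | loopStep h _ _ ih ih' =>
    cases h₂ with
    | loopStop h' => exact absurd h' h
    | loopStep _ a b =>
      obtain ⟨rfl, rfl⟩ := ih a
      obtain ⟨rfl, rfl⟩ := ih' b
      exact ⟨rfl, rfl⟩

/-- The initial store: the input is in register `0`, and all other registers hold `nil`. -/
def Store.init (d : Data) : Store := fun i => if i = 0 then d else .nil

/-! ### Inputs, outputs, and fixed-parameter tractability -/

/-- A literal as a tree. -/
def Literal.toData (l : Literal) : Data := .cons (.atom l.1) (Data.ofBool l.2)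

/-- A list of lists of literals as a tree. -/
def clauseListData (L : List (List Literal)) : Data :=
  Data.ofList (L.map fun c => Data.ofList (c.map Literal.toData))

/-- `d` represents the CNF `F`: it lists the clauses of `F`, each as a list of its literals, in any
order and without repetitions. -/
def CNF.IsRepresentedBy (F : CNF) (d : Data) : Prop :=
  ∃ L : List (List Literal), (∀ c ∈ L, c.Nodup) ∧ (L.map List.toFinset).Nodup ∧
    (L.map List.toFinset).toFinset = F.clauses ∧ d = clauseListData L

/-- The label and the outgoing edges of a vertex as a tree, where vertices are given by names. -/
def Node.toData {W : Type} (name : W → Data) : Node W → Data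
  | .sink b => .cons .nil (Data.ofBool b)
  | .branch x lo hi => .cons (.atom x) (.cons (name lo) (name hi))

/-- `d` represents the diagram `B`: the vertices of `B` have pairwise distinct names, and `d`
consists of the name of the source and the list of all vertices, each given by its name, its label
and its outgoing edges. -/
def BDD.IsRepresentedBy (B : BDD) (d : Data) : Prop :=
  ∃ name : Fin B.n → Data, Function.Injective name ∧
    d = .cons (name B.source)
      (Data.ofList ((List.finRange B.n).map fun v =>
        .cons (name v) ((B.node v).toData name)))

/-- CNFs have fixed-parameter tractable time computable OBDDs with respect to the parameter `κ`:
there are an algorithm, a computable function `f` and a polynomial `p` such that, given any CNF `F`,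
the algorithm returns an OBDD on the variables of `F` that computes the same function as `F`, in time
at most `f (κ F) * p (size F)`. The value of the parameter is not part of the input. -/
def FPTTimeComputableOBDDs (κ : CNF → ℕ) : Prop :=
  ∃ (P : Program) (f : ℕ → ℕ) (p : Polynomial ℕ), Computable f ∧
    ∀ (F : CNF) (d : Data), F.IsRepresentedBy d →
      ∃ (s : Store) (t : ℕ), P.Runs (Store.init d) s t ∧ t ≤ f (κ F) * p.eval F.size ∧
        ∃ B : BDD, B.IsRepresentedBy (s 0) ∧ B.IsOBDD F.vars ∧ B.Computes F

end CNFtoOBDD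

/-!
The algorithm repeats a standard construction of OBDDs: read the variables in a fixed order, and
take as states the sets of residual clauses. The states are computed by a closure under the two
successor operations, so the running time is polynomial in their number, and all depends on finding,
in polynomial time and without knowledge of the deletion distance `k`, an order of the variables for
which the number of states is at most `2 ^ O(k ^ 2)` times a polynomial (`TimeBdd.diagram`,
`IsClosedFrom.exists_bdd`).

**Clauses that become equal.** A deletion set may make clauses equal and so destroy cycles of the
incidence graph that it does not hit. Two clauses that share two variables and differ in a literal
are in conflict: a deletion set contains one of the two clauses, one of the two variables, or the
variable of the literal, since otherwise the clauses remain distinct and form a cycle. As long as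
there is a conflict, all of these vertices are deleted; at most `5 * k` vertices are deleted in this
way (`IsNormalList.length_separate_le`). If there is no conflict, distinct clauses on a cycle cannot
become equal, and a deletion set gives a feedback vertex set of the incidence graph, in which the
clauses that have become equal are identified (`IsNormalList.isForest`).

**Approximation of feedback vertex sets.** The core of a graph is what is left when vertices of
degree at most one are stripped. In round `j = 0, 1, 2, …` the vertices whose degree is among the
`j` largest in the core are deleted, or any one vertex if there are none. Let `X` be a feedback
vertex set of size `k`. From round `4 * k` on, the core loses a vertex of `X` in each round: if `X`
avoids all vertices that are deleted in the round, the others have degree two, since a graph of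
minimum degree two that becomes a forest without `X` cannot have many vertices of larger degree than
those in `X`, and then the next core cannot contain all the vertices of `X`
(`deg_eq_two_of_disjoint`, `card_inter_lt`). Thus the core is empty after `5 * k` rounds, in which
at most `25 * k ^ 2` vertices have been deleted (`length_fvs_le`). Since the parameter may enter the
running time through any computable function, nothing better is needed.

**Orders for forests.** A forest is stripped vertex by vertex, and the lists of variables that hang
on the vertices are concatenated, the shorter one of two lists first. While the shorter list is
read, one more bit is needed, for the vertex on which both lists hang; but the concatenation is at
least twice as long as the shorter list, so that at each point of the order the state of the clauses
is determined by logarithmically many bits (`Width.append`, `strip_spec`). The deleted variables,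
which are read first, and the deleted clauses contribute one bit each, so the number of states is at
most `2 ^ O(k ^ 2)` times a polynomial (`isNarrow_order`, `IsNarrow.sz_reach_le`).

**Running times.** `Poly f` says that WHILE programs compute `f` in polynomial time. This predicate
is closed under composition, case distinction and iteration over lists with a bound for the size of
the intermediate results, so that the running times of all parts follow from the shape of their
definitions. Only the closure under successors needs the bound for the number of states.

That the deletion distance is at most the feedback vertex set number is plain: a feedback vertex set
of the incidence graph is a deletion set (`CNF.deletionDistance_le_fvsNumber`).
-/

namespace CNFtoOBDD

/-! ### Polynomially bounded functions -/

/-- `u` is bounded by a polynomial in `B`. -/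
def PolyBdd {α : Type*} (B u : α → ℕ) : Prop := ∃ k, ∀ x, u x ≤ (B x + 2) ^ k

namespace PolyBdd

variable {α β : Type*} {B B' u v : α → ℕ}

theorem mono (hv : PolyBdd B v) (h : ∀ x, u x ≤ v x) : PolyBdd B u := by
  obtain ⟨k, hk⟩ := hv
  exact ⟨k, fun x => (h x).trans (hk x)⟩

theorem self : PolyBdd B B := ⟨1, fun x => by simp⟩

theorem const (n : ℕ) : PolyBdd B fun _ => n :=
  ⟨n, fun x => (Nat.lt_two_pow_self).le.trans (Nat.pow_le_pow_left (by omega) n)⟩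

theorem mul (hu : PolyBdd B u) (hv : PolyBdd B v) : PolyBdd B fun x => u x * v x := by
  obtain ⟨k, hk⟩ := hu
  obtain ⟨l, hl⟩ := hv
  exact ⟨k + l, fun x => by rw [pow_add]; exact Nat.mul_le_mul (hk x) (hl x)⟩

theorem add (hu : PolyBdd B u) (hv : PolyBdd B v) : PolyBdd B fun x => u x + v x := by
  obtain ⟨k, hk⟩ := hu
  obtain ⟨l, hl⟩ := hv
  refine ⟨k + l + 1, fun x => ?_⟩
  have h1 : (B x + 2) ^ k ≤ (B x + 2) ^ (k + l) := Nat.pow_le_pow_right (by omega) (by omega)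
  have h2 : (B x + 2) ^ l ≤ (B x + 2) ^ (k + l) := Nat.pow_le_pow_right (by omega) (by omega)
  calc u x + v x ≤ (B x + 2) ^ (k + l) * 2 := by have := hk x; have := hl x; omega
    _ ≤ (B x + 2) ^ (k + l) * (B x + 2) := Nat.mul_le_mul_left _ (by omega)
    _ = _ := (pow_succ _ _).symm

theorem pow (hu : PolyBdd B u) (n : ℕ) : PolyBdd B fun x => u x ^ n := by
  obtain ⟨k, hk⟩ := hu
  exact ⟨k * n, fun x => by rw [pow_mul]; exact Nat.pow_le_pow_left (hk x) n⟩

theorem trans (h : PolyBdd B' u) (hB : PolyBdd B B') : PolyBdd B u := by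
  obtain ⟨k, hk⟩ := h
  exact ((hB.add (const 2)).pow k).mono hk

theorem comp {B u : β → ℕ} (h : PolyBdd B u) (g : α → β) :
    PolyBdd (fun x => B (g x)) fun x => u (g x) := by
  obtain ⟨k, hk⟩ := h
  exact ⟨k, fun x => hk _⟩

end PolyBdd

/-! ### Functions that programs compute -/

/-- A type whose elements are represented by trees. -/
class Enc (α : Type*) where
  enc : α → Data
  enc_injective : Function.Injective enc

open Enc (enc)

/-- The size of the tree that represents an element. -/
def sz {α : Type*} [Enc α] (x : α) : ℕ := (enc x).size

theorem Data.size_pos (d : Data) : 0 < d.size := by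
  cases d <;> simp only [Data.size] <;> omega

theorem sz_pos {α : Type*} [Enc α] (x : α) : 0 < sz x := Data.size_pos _

theorem Data.size_hd_le (d : Data) : d.hd.size ≤ d.size := by
  cases d
  · rfl
  · rfl
  · simp only [Data.size, Data.hd]; omega

theorem Data.size_tl_le (d : Data) : d.tl.size ≤ d.size := by
  cases d <;> simp [Data.size, Data.tl]

theorem Expr.size_val_le_time (s : Store) (e : Expr) : (e.val s).size ≤ e.time s := by
  induction e with
  | reg i => exact le_rfl
  | nil => exact le_rfl
  | cons e e' h h' => simp only [Expr.val, Expr.time, Data.size]; omega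
  | hd e h => exact (Data.size_hd_le _).trans (h.trans (Nat.le_succ _))
  | tl e h => exact (Data.size_tl_le _).trans (h.trans (Nat.le_succ _))
  | eq e e' h h' =>
    have h1 := Data.size_pos (e.val s)
    have h2 := Data.size_pos (e'.val s)
    simp only [Expr.val, Expr.time]
    cases decide (e.val s = e'.val s) <;> simp only [Data.ofBool, Data.size] <;> omega

/-- `f` is computed by programs in time polynomial in `B`, and its values have size polynomial in
`B`. There is one program for each register `r`; it takes its argument from the register `r`, leaves
its result there, and changes no smaller register. The contents of the larger registers are
arbitrary. -/
def TimeBdd {α β : Type*} [Enc α] [Enc β] (B : α → ℕ) (f : α → β) : Prop :=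
  ∃ (C : ℕ → Program) (T : α → ℕ), PolyBdd B T ∧ ∀ x, sz (f x) ≤ T x ∧
    ∀ (r : ℕ) (s : Store), s r = enc x → ∃ s' t, (C r).Runs s s' t ∧ t ≤ T x ∧
      s' r = enc (f x) ∧ ∀ i < r, s' i = s i

/-- `f` is computable in time polynomial in the size of the argument. -/
@[fun_prop]
def Poly {α β : Type*} [Enc α] [Enc β] (f : α → β) : Prop := TimeBdd sz f

section Combinators

variable {α β γ δ : Type*} [Enc α] [Enc β] [Enc γ] [Enc δ] {B : α → ℕ}

theorem TimeBdd.polyBdd_sz {f : α → β} (h : TimeBdd B f) : PolyBdd B fun x => sz (f x) := by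
  obtain ⟨_, T, hT, hC⟩ := h
  exact hT.mono fun x => (hC x).1

theorem Poly.timeBdd {f : α → β} (h : Poly f) (hB : PolyBdd B sz) : TimeBdd B f := by
  obtain ⟨C, T, hT, hC⟩ := h
  exact ⟨C, T, hT.trans hB, hC⟩

/-- A function whose value is always the value of a fixed expression is computable. -/
theorem TimeBdd.of_expr {f : α → β} (e : ℕ → Expr) (T : α → ℕ) (hT : PolyBdd B T)
    (he : ∀ r s x, s r = enc x → (e r).val s = enc (f x) ∧ (e r).time s ≤ T x) :
    TimeBdd B f := by
  refine ⟨fun r => .assign r (e r), fun x => T x + 1, hT.add (.const 1), fun x => ⟨?_, ?_⟩⟩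
  · have h := he 0 (fun _ => enc x) x rfl
    have h' := Expr.size_val_le_time (fun _ => enc x) (e 0)
    rw [h.1] at h'
    exact (h'.trans h.2).trans (Nat.le_succ _)
  · intro r s hs
    obtain ⟨h1, h2⟩ := he r s x hs
    refine ⟨_, _, .assign, Nat.succ_le_succ h2, by simp [h1], fun i hi => ?_⟩
    simp [Function.update_of_ne hi.ne]

theorem TimeBdd.comp {g : β → γ} {f : α → β} (hg : Poly g) (hf : TimeBdd B f) :
    TimeBdd B fun x => g (f x) := by
  have hsz := hf.polyBdd_sz
  obtain ⟨C, T, hT, hC⟩ := hf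
  obtain ⟨C', T', hT', hC'⟩ := hg
  refine ⟨fun r => .seq (C r) (C' r), fun x => T x + T' (f x) + 1,
    (hT.add ((hT'.comp f).trans hsz)).add (.const 1), fun x => ⟨?_, ?_⟩⟩
  · exact (hC' (f x)).1.trans (by show _ ≤ _ + _ + _; omega)
  · intro r s hs
    obtain ⟨s1, t1, h1, ht1, hv1, hf1⟩ := (hC x).2 r s hs
    obtain ⟨s2, t2, h2, ht2, hv2, hf2⟩ := (hC' (f x)).2 r s1 hv1
    exact ⟨s2, _, .seq h1 h2, by show _ ≤ _ + _ + _; omega, hv2,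
      fun i hi => (hf2 i hi).trans (hf1 i hi)⟩

@[fun_prop]
theorem Poly.comp {g : β → γ} {f : α → β} (hg : Poly g) (hf : Poly f) :
    Poly fun x => g (f x) := TimeBdd.comp hg hf

@[fun_prop]
theorem Poly.id' : Poly fun x : α => x :=
  TimeBdd.of_expr .reg _ .self fun r s x hs => ⟨hs, by simp [Expr.time, hs, sz]⟩

instance : Enc Data := ⟨id, fun _ _ h => h⟩

instance : Enc Unit := ⟨fun _ => .nil, fun _ _ _ => rfl⟩

instance : Enc Bool := ⟨Data.ofBool, by rintro (_ | _) (_ | _) <;> simp [Data.ofBool]⟩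

/-- Variables are represented by atoms. This instance is for `Var` only, so it is not to be used
for numbers. -/
instance instEncVar : Enc Var := ⟨.atom, fun _ _ h => by injection h⟩

instance instEncProd : Enc (α × β) :=
  ⟨fun p => .cons (enc p.1) (enc p.2), by
    rintro ⟨a, b⟩ ⟨a', b'⟩ h
    injection h with h1 h2
    exact Prod.ext (Enc.enc_injective h1) (Enc.enc_injective h2)⟩

instance instEncSum : Enc (α ⊕ β) :=
  ⟨Sum.elim (fun a => .cons .nil (enc a)) (fun b => .cons (.cons .nil .nil) (enc b)), by
    rintro (a | a) (b | b) h
    · injection h with h1 h2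
      rw [Enc.enc_injective h2]
    · injection h with h1 h2
      cases h1
    · injection h with h1 h2
      cases h1
    · injection h with h1 h2
      rw [Enc.enc_injective h2]⟩

instance instEncList : Enc (List α) :=
  ⟨fun l => Data.ofList (l.map enc), by
    intro l l' h
    induction l generalizing l' with
    | nil => cases l' <;> simp_all [Data.ofList]
    | cons a l ih =>
      cases l' with
      | nil => simp [Data.ofList] at h
      | cons b l' =>
        simp only [List.map_cons, Data.ofList, Data.cons.injEq] at h
        rw [Enc.enc_injective h.1, ih h.2]⟩

theorem enc_nil : enc ([] : List α) = .nil := rfl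
theorem enc_cons (a : α) (l : List α) : enc (a :: l) = .cons (enc a) (enc l) := rfl
theorem enc_prod (p : α × β) : enc p = .cons (enc p.1) (enc p.2) := rfl

@[simp] theorem sz_prod (p : α × β) : sz p = 1 + sz p.1 + sz p.2 := rfl
@[simp] theorem sz_nil : sz ([] : List α) = 1 := rfl
@[simp] theorem sz_cons (a : α) (l : List α) : sz (a :: l) = 1 + sz a + sz l := rfl

theorem TimeBdd.pair {f : α → β} {g : α → γ} (hB : PolyBdd B sz) (hf : TimeBdd B f)
    (hg : TimeBdd B g) : TimeBdd B fun x => (f x, g x) := by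
  obtain ⟨C, T, hT, hC⟩ := hf
  obtain ⟨C', T', hT', hC'⟩ := hg
  refine ⟨fun r => .seq (.seq (.assign (r + 1) (.reg r)) (C (r + 1)))
    (.seq (.seq (.assign (r + 2) (.reg r)) (C' (r + 2)))
      (.assign r (.cons (.reg (r + 1)) (.reg (r + 2))))),
    fun x => 2 * sz x + 2 * T x + 2 * T' x + 8,
    ((((PolyBdd.const 2).mul hB).add ((PolyBdd.const 2).mul hT)).add
      ((PolyBdd.const 2).mul hT')).add (.const 8), fun x => ⟨?_, ?_⟩⟩
  · have := (hC x).1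
    have := (hC' x).1
    simp only [sz_prod]
    omega
  · intro r s hs
    obtain ⟨s1, t1, h1, ht1, hv1, hf1⟩ := (hC x).2 (r + 1)
      (Function.update s (r + 1) (s r)) (by simp [hs])
    have hr : s1 r = enc x := by rw [hf1 r (by omega)]; simp [hs]
    obtain ⟨s2, t2, h2, ht2, hv2, hf2⟩ := (hC' x).2 (r + 2)
      (Function.update s1 (r + 2) (s1 r)) (by simp [hr])
    have hv1' : s2 (r + 1) = enc (f x) := by rw [hf2 (r + 1) (by omega)]; simp [hv1]
    refine ⟨_, _, .seq (.seq .assign h1) (.seq (.seq .assign h2) .assign), ?_, ?_, ?_⟩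
    · have h1 := (hC x).1
      have h2 := (hC' x).1
      simp only [Expr.time, hs, hr, hv1', hv2]
      simp only [sz] at *
      omega
    · simp [Expr.val, hv1', hv2, enc_prod]
    · intro i hi
      rw [Function.update_of_ne (by omega), hf2 i (by omega), Function.update_of_ne (by omega),
        hf1 i (by omega), Function.update_of_ne (by omega)]

@[fun_prop]
theorem Poly.pair {f : α → β} {g : α → γ} (hf : Poly f) (hg : Poly g) :
    Poly fun x => (f x, g x) := TimeBdd.pair .self hf hg

@[fun_prop]
theorem Poly.fst : Poly fun p : α × β => p.1 :=
  TimeBdd.of_expr (fun r => .hd (.reg r)) _ (PolyBdd.self.add (.const 1)) fun r s x hs => by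
    simp [Expr.val, Expr.time, hs, sz, enc_prod, Data.hd]

@[fun_prop]
theorem Poly.snd : Poly fun p : α × β => p.2 :=
  TimeBdd.of_expr (fun r => .tl (.reg r)) _ (PolyBdd.self.add (.const 1)) fun r s x hs => by
    simp [Expr.val, Expr.time, hs, sz, enc_prod, Data.tl]

/-- A computable function may be regarded as one between other types with the same
representations. -/
theorem Poly.of_enc_eq {f : α → β} {g : γ → δ} (hf : Poly f)
    (h : ∀ y, ∃ x, enc x = enc y ∧ enc (f x) = enc (g y)) : Poly g := by
  obtain ⟨C, T, ⟨k, hk⟩, hC⟩ := hf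
  choose p hp using h
  refine ⟨C, fun y => T (p y), ⟨k, fun y => ?_⟩, fun y => ⟨?_, ?_⟩⟩
  · have := hk (p y)
    rwa [show sz (p y) = sz y by simp [sz, (hp y).1]] at this
  · have := (hC (p y)).1
    rwa [show sz (f (p y)) = sz (g y) by simp [sz, (hp y).2]] at this
  · rw [← (hp y).1, ← (hp y).2]
    exact (hC (p y)).2

@[fun_prop]
theorem Poly.encode {f : α → β} (hf : Poly f) : Poly fun x => enc (f x) :=
  hf.of_enc_eq fun x => ⟨x, rfl, rfl⟩

@[fun_prop]
theorem Poly.cons {f : α → β} {g : α → List β} (hf : Poly f) (hg : Poly g) :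
    Poly fun x => f x :: g x :=
  ((Poly.id' (α := β × List β)).of_enc_eq (g := fun p : β × List β => p.1 :: p.2)
    (fun p => ⟨p, rfl, rfl⟩)).comp (hf.pair hg)

/-- The trees in which no atom occurs. -/
def Data.AtomFree : Data → Prop
  | .nil => True
  | .atom _ => False
  | .cons d e => d.AtomFree ∧ e.AtomFree

theorem Data.AtomFree.exists_expr {d : Data} (hd : d.AtomFree) :
    ∃ (e : Expr) (n : ℕ), ∀ s, e.val s = d ∧ e.time s ≤ n := by
  induction d with
  | nil => exact ⟨.nil, 1, fun s => ⟨rfl, le_rfl⟩⟩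
  | atom x => exact hd.elim
  | cons d e hd' he' =>
    obtain ⟨a, n, ha⟩ := hd' hd.1
    obtain ⟨b, m, hb⟩ := he' hd.2
    refine ⟨.cons a b, n + m + 1, fun s => ?_⟩
    have := ha s
    have := hb s
    simp only [Expr.val, Expr.time]
    exact ⟨by simp [*], by omega⟩

theorem Poly.const_of_atomFree (b : β) (hb : (enc b).AtomFree) : Poly fun _ : α => b := by
  obtain ⟨e, n, he⟩ := hb.exists_expr
  exact TimeBdd.of_expr (fun _ => e) _ (.const n) fun r s x _ => he s

@[fun_prop]
theorem Poly.nil : Poly fun _ : α => ([] : List β) := .const_of_atomFree _ trivial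

@[fun_prop]
theorem Poly.true : Poly fun _ : α => Bool.true := .const_of_atomFree _ ⟨trivial, trivial⟩

@[fun_prop]
theorem Poly.false : Poly fun _ : α => Bool.false := .const_of_atomFree _ trivial

instance instEncSubtype {p : α → Prop} : Enc {x // p x} :=
  ⟨fun x => enc x.1, fun _ _ h => Subtype.ext (Enc.enc_injective h)⟩

theorem Poly.subtypeVal {p : α → Prop} : Poly fun x : {x // p x} => x.1 :=
  (Poly.id' (α := α)).of_enc_eq fun x => ⟨x.1, rfl, rfl⟩

/-- Definition by cases on a computable truth value. The function for each case is defined on the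
arguments that belong to the case only. -/
theorem Poly.dite {c : α → Bool} {f : {x // c x = Bool.true} → β}
    {g : {x // c x = Bool.false} → β} {h : α → β} (hc : Poly c) (hf : Poly f) (hg : Poly g)
    (hfh : ∀ x, h x.1 = f x) (hgh : ∀ x, h x.1 = g x) : Poly h := by
  obtain ⟨C0, T0, hT0, hC0⟩ := hc
  obtain ⟨C, T, ⟨k, hT⟩, hC⟩ := hf
  obtain ⟨C', T', ⟨k', hT'⟩, hC'⟩ := hg
  refine ⟨fun r => .seq (.seq (.assign (r + 1) (.reg r)) (C0 (r + 1)))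
    (.cond (.reg (r + 1)) (C r) (C' r)),
    fun x => sz x + 2 * T0 x + (sz x + 2) ^ k + (sz x + 2) ^ k' + 8,
    (((PolyBdd.self.add ((PolyBdd.const 2).mul hT0)).add ⟨k, fun _ => le_rfl⟩).add
      ⟨k', fun _ => le_rfl⟩).add (.const 8), fun x => ⟨?_, ?_⟩⟩
  · cases hx : c x with
    | true =>
      have h1 := (hC ⟨x, hx⟩).1.trans (hT _)
      rw [← hfh] at h1
      change _ ≤ (sz x + 2) ^ _ at h1
      exact h1.trans (by dsimp only; omega)
    | false =>
      have h1 := (hC' ⟨x, hx⟩).1.trans (hT' _)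
      rw [← hgh] at h1
      change _ ≤ (sz x + 2) ^ _ at h1
      exact h1.trans (by dsimp only; omega)
  · intro r s hs
    obtain ⟨s1, t1, h1, ht1, hv1, hf1⟩ := (hC0 x).2 (r + 1)
      (Function.update s (r + 1) (s r)) (by simp [hs])
    have hr : s1 r = enc x := by rw [hf1 r (by omega)]; simp [hs]
    have hfr : ∀ i < r, s1 i = s i := fun i hi => by
      rw [hf1 i (by omega), Function.update_of_ne (by omega)]
    have hsz := (hC0 x).1
    cases hcx : c x with
    | true =>
      obtain ⟨s2, t2, h2, ht2, hv2, hf2⟩ := (hC ⟨x, hcx⟩).2 r s1 hr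
      have ht2' := ht2.trans (hT _)
      refine ⟨_, _, .seq (.seq .assign h1) (.condTrue ?_ h2), ?_, by rw [hv2, ← hfh],
        fun i hi => (hf2 i hi).trans (hfr i hi)⟩
      · simp only [Expr.val, hv1, hcx]; exact fun h => by cases h
      · simp only [Expr.time, hs, hv1]
        simp only [sz] at *
        change t2 ≤ ((enc x).size + 2) ^ k at ht2'
        omega
    | false =>
      obtain ⟨s2, t2, h2, ht2, hv2, hf2⟩ := (hC' ⟨x, hcx⟩).2 r s1 hr
      have ht2' := ht2.trans (hT' _)
      refine ⟨_, _, .seq (.seq .assign h1) (.condFalse ?_ h2), ?_, by rw [hv2, ← hgh],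
        fun i hi => (hf2 i hi).trans (hfr i hi)⟩
      · simp only [Expr.val, hv1, hcx]; rfl
      · simp only [Expr.time, hs, hv1]
        simp only [sz] at *
        change t2 ≤ ((enc x).size + 2) ^ k' at ht2'
        omega

@[fun_prop]
theorem Poly.cond {c : α → Bool} {f g : α → β} (hc : Poly c) (hf : Poly f) (hg : Poly g) :
    Poly fun x => _root_.cond (c x) (f x) (g x) :=
  hc.dite (hf.comp .subtypeVal) (hg.comp .subtypeVal) (fun x => by rw [x.2]; rfl)
    (fun x => by rw [x.2]; rfl)

@[fun_prop]
theorem Poly.eq [DecidableEq β] {f g : α → β} (hf : Poly f) (hg : Poly g) :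
    Poly fun x => decide (f x = g x) := by
  have : Poly fun p : β × β => decide (p.1 = p.2) :=
    TimeBdd.of_expr (fun r => .eq (.hd (.reg r)) (.tl (.reg r))) _
      (((PolyBdd.const 2).mul PolyBdd.self).add (.const 3)) fun r s x hs => by
        refine ⟨?_, ?_⟩
        · simp only [Expr.val, hs, enc_prod, Data.hd, Data.tl, Enc.enc_injective.eq_iff]
          rfl
        · simp only [Expr.time, hs, sz]
          omega
  exact this.comp (hf.pair hg)

@[fun_prop]
theorem Poly.not {f : α → Bool} (hf : Poly f) : Poly fun x => !f x :=
  (hf.cond .false .true).of_enc_eq fun x => ⟨x, rfl, by cases f x <;> rfl⟩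

@[fun_prop]
theorem Poly.and {f g : α → Bool} (hf : Poly f) (hg : Poly g) : Poly fun x => f x && g x :=
  (hf.cond hg .false).of_enc_eq fun x => ⟨x, rfl, by cases f x <;> rfl⟩

/-- Definition by cases on a list. -/
def listCase {α β : Type*} (l : List α) (b : β) (f : α → List α → β) : β :=
  match l with
  | [] => b
  | a :: l => f a l

@[simp] theorem listCase_nil {α β : Type*} (b : β) (f : α → List α → β) : listCase [] b f = b := rfl
@[simp] theorem listCase_cons {α β : Type*} (a : α) (l : List α) (b : β) (f : α → List α → β) :
    listCase (a :: l) b f = f a l := rfl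

@[fun_prop]
theorem Poly.isEmpty {l : α → List β} (hl : Poly l) : Poly fun x => (l x).isEmpty :=
  (hl.encode.eq (.encode (.nil (β := β)))).of_enc_eq fun x => ⟨x, rfl, by
    cases l x <;> simp [enc_nil, enc_cons]⟩

@[fun_prop]
theorem Poly.listCase {l : α → List β} {f : α → γ} {g : α → β → List β → γ} (hl : Poly l)
    (hf : Poly f) (hg : Poly fun p : α × β × List β => g p.1 p.2.1 p.2.2) :
    Poly fun x => listCase (l x) (f x) (g x) := by
  have hne : ∀ x : {x // (l x).isEmpty = Bool.false}, l x.1 ≠ [] := fun x => by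
    simpa using x.2
  have h : Poly fun x : {x // (l x).isEmpty = Bool.false} =>
      (x.1, (l x.1).head (hne x), (l x.1).tail) := by
    refine subtypeVal.pair (Poly.of_enc_eq (hl.comp subtypeVal) fun x => ⟨x, rfl, ?_⟩)
    conv_lhs => rw [← List.cons_head_tail (hne x)]
    rfl
  refine hl.isEmpty.dite (hf.comp .subtypeVal) (hg.comp h) (fun x => ?_) (fun x => ?_)
  · rw [List.isEmpty_iff.mp x.2]; rfl
  · conv_lhs => rw [← List.cons_head_tail (hne x)]
    rfl

@[fun_prop]
theorem Poly.inl {f : α → β} (hf : Poly f) : Poly fun x => (Sum.inl (f x) : β ⊕ γ) :=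
  ((Poly.encode .nil (β := List Unit)).pair hf).of_enc_eq fun x => ⟨x, rfl, rfl⟩

@[fun_prop]
theorem Poly.inr {f : α → γ} (hf : Poly f) : Poly fun x => (Sum.inr (f x) : β ⊕ γ) :=
  ((Poly.encode .true).pair hf).of_enc_eq fun x => ⟨x, rfl, rfl⟩

@[fun_prop]
theorem Poly.sumElim {s : α → β ⊕ γ} {f : α → β → δ} {g : α → γ → δ} (hs : Poly s)
    (hf : Poly fun p : α × β => f p.1 p.2) (hg : Poly fun p : α × γ => g p.1 p.2) :
    Poly fun x => Sum.elim (f x) (g x) (s x) := by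
  have hhd : Poly Data.hd := TimeBdd.of_expr (fun r => .hd (.reg r)) _
    (PolyBdd.self.add (.const 1)) fun r s x hs => by simp [Expr.val, Expr.time, hs, sz]; rfl
  have htl : Poly Data.tl := TimeBdd.of_expr (fun r => .tl (.reg r)) _
    (PolyBdd.self.add (.const 1)) fun r s x hs => by simp [Expr.val, Expr.time, hs, sz]; rfl
  have hc : Poly fun x => (s x).isRight := Poly.of_enc_eq (hhd.comp hs.encode)
    fun x => ⟨x, rfl, by cases s x <;> rfl⟩
  have hr' : ∀ (a : β ⊕ γ) (h : a.isRight = Bool.true), (enc a).tl = enc (a.getRight h) := by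
    rintro (a | a) h
    · cases h
    · rfl
  have hl'' : ∀ (a : β ⊕ γ) (h : a.isLeft = Bool.true), (enc a).tl = enc (a.getLeft h) := by
    rintro (a | a) h
    · rfl
    · cases h
  have h1 : Poly fun x : {x // (s x).isRight = Bool.true} =>
      (x.1, (s x.1).getRight x.2) := by
    refine subtypeVal.pair (Poly.of_enc_eq (htl.comp (hs.encode.comp subtypeVal))
      fun x => ⟨x, rfl, hr' _ _⟩)
  have hl' : ∀ x : {x // (s x).isRight = Bool.false}, (s x.1).isLeft = Bool.true := fun x => by
    simpa using x.2
  have h2 : Poly fun x : {x // (s x).isRight = Bool.false} =>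
      (x.1, (s x.1).getLeft (hl' x)) := by
    refine subtypeVal.pair (Poly.of_enc_eq (htl.comp (hs.encode.comp subtypeVal))
      fun x => ⟨x, rfl, hl'' _ _⟩)
  refine hc.dite (hg.comp h1) (hf.comp h2) (fun x => ?_) (fun x => ?_)
  · conv_lhs => rw [← Sum.inr_getRight (s x.1) x.2]
    rfl
  · conv_lhs => rw [← Sum.inl_getLeft (s x.1) (hl' x)]
    rfl

theorem sz_append (l l' : List α) : sz (l ++ l') + 1 = sz l + sz l' := by
  induction l with
  | nil => simp; omega
  | cons a l ih => simp only [List.cons_append, sz_cons]; omega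

theorem sz_lt_of_mem {a : α} {l : List α} (h : a ∈ l) : sz a < sz l := by
  induction l with
  | nil => cases h
  | cons b l ih =>
    rcases List.mem_cons.mp h with rfl | h
    · simp; omega
    · have := ih h
      simp; omega

theorem length_lt_sz (l : List α) : l.length < sz l := by
  induction l with
  | nil => simp
  | cons b l ih => simp; omega

theorem sz_le_of_sublist {l l' : List α} (h : l.Sublist l') : sz l ≤ sz l' := by
  induction h with
  | slnil => rfl
  | cons a _ ih => simp; omega
  | cons_cons a _ ih => simp; omega

theorem sz_map_le {α : Type*} {f : α → β} {n : ℕ} {l : List α} (h : ∀ a ∈ l, sz (f a) ≤ n) :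
    sz (l.map f) ≤ 1 + l.length * (n + 1) := by
  induction l with
  | nil => simp
  | cons a l ih =>
    have h1 := h a (by simp)
    have h2 := ih fun b hb => h b (by simp [hb])
    simp only [List.map_cons, sz_cons, List.length_cons, add_mul]
    omega

/-- A left fold is computable in time polynomial in `B` if all its intermediate values have size
polynomial in `B`. -/
theorem TimeBdd.foldl {l : α → List β} {init : α → γ} {step : α → γ → β → γ} {M : α → ℕ}
    (hB : PolyBdd B sz) (hl : TimeBdd B l) (hi : TimeBdd B init)
    (hs : Poly fun p : α × γ × β => step p.1 p.2.1 p.2.2) (hM : PolyBdd B M)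
    (hsz : ∀ x l₁, l₁ <+: l x → sz (l₁.foldl (step x) (init x)) ≤ M x) :
    TimeBdd B fun x => (l x).foldl (step x) (init x) := by
  have hlsz := hl.polyBdd_sz
  obtain ⟨C1, T1, hT1, hC1⟩ := hl
  obtain ⟨C2, T2, hT2, hC2⟩ := hi
  obtain ⟨C3, T3, ⟨k, hk⟩, hC3⟩ := hs
  -- The registers `r + 1`, `r + 2` and `r + 3` hold the rest of the list, the intermediate value,
  -- and the argument of `step`.
  let body : ℕ → Program := fun r =>
    .seq (.seq (.assign (r + 3) (.cons (.reg r) (.cons (.reg (r + 2)) (.hd (.reg (r + 1))))))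
      (C3 (r + 3))) (.seq (.assign (r + 2) (.reg (r + 3))) (.assign (r + 1) (.tl (.reg (r + 1)))))
  let U : α → ℕ := fun x =>
    4 * sz (l x) + sz x + 2 * M x + (sz x + M x + sz (l x) + 4) ^ k + 20
  have hU : PolyBdd B U :=
    (((((PolyBdd.const 4).mul hlsz).add hB).add ((PolyBdd.const 2).mul hM)).add
      ((((hB.add hM).add hlsz).add (.const 4)).pow k)).add (.const 20)
  have hloop : ∀ (x : α) (r : ℕ) (l₂ l₁ : List β), l x = l₁ ++ l₂ → ∀ s : Store, s r = enc x →
      s (r + 1) = enc l₂ → s (r + 2) = enc (l₁.foldl (step x) (init x)) →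
      ∃ s' t, (Program.loop (.reg (r + 1)) (body r)).Runs s s' t ∧ t ≤ (l₂.length + 1) * U x ∧
        s' (r + 2) = enc ((l x).foldl (step x) (init x)) ∧ ∀ i ≤ r, s' i = s i := by
    intro x r l₂
    induction l₂ with
    | nil =>
      intro l₁ h s h0 h1 h2
      refine ⟨s, _, .loopStop (by simp [Expr.val, h1, enc_nil]), ?_, ?_, fun _ _ => rfl⟩
      · simp [Expr.time, h1, enc_nil, Data.size, U]
      · rw [h2, h, List.append_nil]
    | cons b l₂ ih =>
      intro l₁ h s h0 h1 h2
      have hp : l₁ <+: l x := ⟨_, h.symm⟩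
      have hp' : l₁ ++ [b] <+: l x := ⟨l₂, by simp [h]⟩
      have hM1 := hsz x _ hp
      have hM2 := hsz x _ hp'
      set a := l₁.foldl (step x) (init x) with ha
      have ha' : (l₁ ++ [b]).foldl (step x) (init x) = step x a b := by simp [ha]
      rw [ha'] at hM2
      obtain ⟨s1, t1, hr1, ht1, hv1, hf1⟩ := (hC3 (x, a, b)).2 (r + 3)
        (Function.update s (r + 3) (.cons (s r) (.cons (s (r + 2)) (s (r + 1)).hd)))
        (by simp [h0, h1, h2, enc_prod, enc_cons, Data.hd])
      have hk' := hk (x, a, b)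
      let s2 := Function.update s1 (r + 2) (s1 (r + 3))
      let s3 := Function.update s2 (r + 1) (s2 (r + 1)).tl
      have e1 : s2 (r + 1) = enc (b :: l₂) := by
        simp only [s2]
        rw [Function.update_of_ne (by omega), hf1 _ (by omega),
          Function.update_of_ne (by omega), h1]
      have hfr : ∀ i ≤ r, s3 i = s i := fun i hi => by
        simp only [s3, s2]
        rw [Function.update_of_ne (by omega), Function.update_of_ne (by omega),
          hf1 _ (by omega), Function.update_of_ne (by omega)]
      obtain ⟨s4, t4, hr4, ht4, hv4, hf4⟩ := ih (l₁ ++ [b]) (by simp [h]) s3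
        (by rw [hfr r le_rfl, h0]) (by simp [s3, e1, enc_cons, Data.tl])
        (by simp only [s3, s2]; rw [Function.update_of_ne (by omega), ha']; simpa using hv1)
      refine ⟨s4, _, .loopStep (by simp [Expr.val, h1, enc_cons])
        (.seq (.seq .assign hr1) (.seq .assign .assign)) hr4, ?_, hv4,
        fun i hi => (hf4 i hi).trans (hfr i hi)⟩
      have hsb : sz (l₁ ++ b :: l₂) + 1 = sz l₁ + sz (b :: l₂) := sz_append _ _
      rw [← h] at hsb
      have hpos := sz_pos l₁
      have hT3 : T3 (x, a, b) ≤ (sz x + M x + sz (l x) + 4) ^ k := hk'.trans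
        (Nat.pow_le_pow_left (by simp only [sz_prod, sz_cons] at hsb ⊢; omega) k)
      have z0 : (s r).size = sz x := by rw [h0]; rfl
      have z1 : (s (r + 1)).size = sz (b :: l₂) := by rw [h1]; rfl
      have z2 : (s (r + 2)).size = sz a := by rw [h2]; rfl
      have z3 : (s1 (r + 3)).size = sz (step x a b) := by rw [hv1]; rfl
      have z4 : (Function.update s1 (r + 2) (s1 (r + 3)) (r + 1)).size = sz (b :: l₂) :=
        congrArg Data.size e1
      simp only [Expr.time, z0, z1, z2, Expr.val, z3, z4]
      rw [List.length_cons, add_mul _ 1, one_mul]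
      have : U x = 4 * sz (l x) + sz x + 2 * M x + (sz x + M x + sz (l x) + 4) ^ k + 20 := rfl
      omega
  refine ⟨fun r => .seq (.seq (.seq (.assign (r + 1) (.reg r)) (C1 (r + 1)))
    (.seq (.assign (r + 2) (.reg r)) (C2 (r + 2))))
    (.seq (.loop (.reg (r + 1)) (body r)) (.assign r (.reg (r + 2)))),
    fun x => 2 * sz x + T1 x + T2 x + (sz (l x) + 1) * U x + M x + 20,
    (((((((PolyBdd.const 2).mul hB).add hT1).add hT2).add
      ((hlsz.add (.const 1)).mul hU)).add hM).add (.const 20)), fun x => ⟨?_, ?_⟩⟩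
  · have := hsz x _ List.prefix_rfl
    dsimp only
    omega
  · intro r s hs
    obtain ⟨s1, t1, h1, ht1, hv1, hf1⟩ := (hC1 x).2 (r + 1)
      (Function.update s (r + 1) (s r)) (by simp [hs])
    have hr : s1 r = enc x := by rw [hf1 r (by omega)]; simp [hs]
    obtain ⟨s2, t2, h2, ht2, hv2, hf2⟩ := (hC2 x).2 (r + 2)
      (Function.update s1 (r + 2) (s1 r)) (by simp [hr])
    have hf12 : ∀ i ≤ r, s2 i = s i := fun i hi => by
      rw [hf2 i (by omega), Function.update_of_ne (by omega), hf1 i (by omega),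
        Function.update_of_ne (by omega)]
    obtain ⟨s3, t3, h3, ht3, hv3, hf3⟩ := hloop x r (l x) [] rfl s2 ((hf12 r le_rfl).trans hs)
      (by rw [hf2 _ (by omega), Function.update_of_ne (by omega), hv1]) hv2
    refine ⟨_, _, .seq (.seq (.seq .assign h1) (.seq .assign h2)) (.seq h3 .assign), ?_, ?_, ?_⟩
    · have e1 : ((l x).length + 1) * U x ≤ (sz (l x) + 1) * U x :=
        Nat.mul_le_mul_right _ (by have := length_lt_sz (l x); omega)
      have e2 := hsz x _ List.prefix_rfl
      have z0 : (s r).size = sz x := by rw [hs]; rfl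
      have z1 : (s1 r).size = sz x := by rw [hr]; rfl
      have z3 : (s3 (r + 2)).size = sz ((l x).foldl (step x) (init x)) := by rw [hv3]; rfl
      simp only [Expr.time, z0, z1, z3]
      omega
    · simp [Expr.val, hv3]
    · intro i hi
      rw [Function.update_of_ne (by omega), hf3 i hi.le, hf12 i hi.le]

/-- A left fold is computable in polynomial time if each step increases the size by an amount
that is polynomial in the size of the argument. -/
theorem Poly.foldl {l : α → List β} {init : α → γ} {step : α → γ → β → γ} {M : α → ℕ}
    (hl : Poly l) (hi : Poly init) (hs : Poly fun p : α × γ × β => step p.1 p.2.1 p.2.2)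
    (hM : PolyBdd sz M)
    (hsz : ∀ x, ∀ b ∈ l x, ∀ c, sz (step x c b) ≤ sz c + M x) :
    Poly fun x => (l x).foldl (step x) (init x) := by
  refine TimeBdd.foldl (M := fun x => sz (init x) + sz (l x) * M x) .self hl hi hs
    (hi.polyBdd_sz.add (hl.polyBdd_sz.mul hM)) fun x l₁ h₁ => ?_
  have h2 : sz (l₁.foldl (step x) (init x)) ≤ sz (init x) + l₁.length * M x := by
    have hmem : ∀ b ∈ l₁, b ∈ l x := fun b hb => h₁.subset hb
    clear h₁
    induction l₁ using List.reverseRecOn with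
    | nil => simp
    | append_singleton l₁ b ih =>
      have h1 := ih fun b hb => hmem b (by simp [hb])
      have h2 := hsz x b (hmem b (by simp)) (l₁.foldl (step x) (init x))
      simp only [List.foldl_append, List.foldl_cons, List.foldl_nil, List.length_append,
        List.length_singleton, add_mul]
      omega
  exact h2.trans (Nat.add_le_add_left (Nat.mul_le_mul_right _
    (h₁.length_le.trans (length_lt_sz _).le)) _)

@[fun_prop]
theorem Poly.reverse {l : α → List β} (hl : Poly l) : Poly fun x => (l x).reverse := by
  have h : Poly fun x => (l x).foldl (fun c b => b :: c) [] :=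
    Poly.foldl (M := fun x => 1 + sz (l x)) hl .nil (by fun_prop)
      ((PolyBdd.const 1).add hl.polyBdd_sz) fun x b hb c => by
        have := sz_lt_of_mem hb
        simp; omega
  simpa using h

theorem Poly.foldr {l : α → List β} {init : α → γ} {step : α → β → γ → γ} {M : α → ℕ}
    (hl : Poly l) (hi : Poly init) (hs : Poly fun p : α × β × γ => step p.1 p.2.1 p.2.2)
    (hM : PolyBdd sz M)
    (hsz : ∀ x, ∀ b ∈ l x, ∀ c, sz (step x b c) ≤ sz c + M x) :
    Poly fun x => (l x).foldr (step x) (init x) := by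
  have h := Poly.foldl (step := fun x c b => step x b c) hl.reverse hi
    (Poly.comp (g := fun p : α × β × γ => step p.1 p.2.1 p.2.2)
      (f := fun p : α × γ × β => (p.1, p.2.2, p.2.1)) hs (by fun_prop)) hM fun x b hb c =>
      hsz x b (by simpa using hb) c
  simpa using h

@[fun_prop]
theorem Poly.map {l : α → List β} {g : α → β → γ} (hl : Poly l)
    (hg : Poly fun p : α × β => g p.1 p.2) : Poly fun x => (l x).map (g x) := by
  obtain ⟨k, hk⟩ := hg.polyBdd_sz
  have h : Poly fun x => (l x).foldr (fun b c => g x b :: c) [] :=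
    Poly.foldr (M := fun x => 1 + (sz x + sz (l x) + 3) ^ k) hl .nil
      (.cons (Poly.comp (f := fun p : α × β × List γ => (p.1, p.2.1)) hg (by fun_prop))
        (by fun_prop))
      ((PolyBdd.const 1).add (((PolyBdd.self.add hl.polyBdd_sz).add (.const 3)).pow k))
      fun x b hb c => by
        have h1 := sz_lt_of_mem hb
        have h2 : sz (g x b) ≤ (sz x + sz (l x) + 3) ^ k := (hk (x, b)).trans
          (Nat.pow_le_pow_left (by simp only [sz_prod]; omega) k)
        simp; omega
  simpa only [← List.map_eq_foldr] using h

@[fun_prop]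
theorem Poly.append {l l' : α → List β} (hl : Poly l) (hl' : Poly l') :
    Poly fun x => l x ++ l' x := by
  have h : Poly fun x => (l x).foldr (fun b c => b :: c) (l' x) :=
    Poly.foldr (M := fun x => 1 + sz (l x)) hl hl' (by fun_prop)
      ((PolyBdd.const 1).add hl.polyBdd_sz) fun x b hb c => by
        have := sz_lt_of_mem hb
        simp; omega
  simpa using h

@[fun_prop]
theorem Poly.flatten {l : α → List (List β)} (hl : Poly l) : Poly fun x => (l x).flatten := by
  have h : Poly fun x => (l x).foldr (fun b c => b ++ c) [] :=
    Poly.foldr (M := fun x => sz (l x)) hl .nil (by fun_prop) hl.polyBdd_sz fun x b hb c => by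
        have := sz_lt_of_mem hb
        have := sz_append b c
        omega
  have e : ∀ x, (l x).foldr (fun b c => b ++ c) [] = (l x).flatten := fun x => by
    induction l x with
    | nil => rfl
    | cons b l ih => simp [ih]
  simpa only [e] using h

@[fun_prop]
theorem Poly.flatMap {l : α → List β} {g : α → β → List γ} (hl : Poly l)
    (hg : Poly fun p : α × β => g p.1 p.2) : Poly fun x => (l x).flatMap (g x) :=
  (hl.map hg).flatten

@[fun_prop]
theorem Poly.filter {l : α → List β} {g : α → β → Bool} (hl : Poly l)
    (hg : Poly fun p : α × β => g p.1 p.2) : Poly fun x => (l x).filter (g x) := by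
  have h : Poly fun x => (l x).foldr (fun b c => bif g x b then b :: c else c) [] :=
    Poly.foldr (M := fun x => 1 + sz (l x)) hl .nil
      (.cond (Poly.comp (f := fun p : α × β × List β => (p.1, p.2.1)) hg (by fun_prop))
        (by fun_prop) (by fun_prop))
      ((PolyBdd.const 1).add hl.polyBdd_sz) fun x b hb c => by
        have := sz_lt_of_mem hb
        cases g x b <;> simp; omega
  have e : ∀ x, (l x).foldr (fun b c => bif g x b then b :: c else c) [] =
      (l x).filter (g x) := fun x => by
    induction l x with
    | nil => rfl
    | cons b l ih => cases hb : g x b <;> simp [hb, ih]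
  simpa only [e] using h

@[fun_prop]
theorem Poly.any {l : α → List β} {g : α → β → Bool} (hl : Poly l)
    (hg : Poly fun p : α × β => g p.1 p.2) : Poly fun x => (l x).any (g x) := by
  have e : ∀ x, (l x).any (g x) = !((l x).filter (g x)).isEmpty := fun x => by
    induction l x with
    | nil => rfl
    | cons b l ih => cases hb : g x b <;> simp [hb, ih]
  simpa only [e] using (hl.filter hg).isEmpty.not

/-- Membership in a list as a truth value. -/
def isMem {β : Type*} [DecidableEq β] (a : β) (l : List β) : Bool := l.any fun b => decide (a = b)

@[simp] theorem isMem_eq_true {β : Type*} [DecidableEq β] {a : β} {l : List β} :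
    isMem a l = Bool.true ↔ a ∈ l := by simp [isMem]

@[simp] theorem isMem_eq_false {β : Type*} [DecidableEq β] {a : β} {l : List β} :
    isMem a l = Bool.false ↔ a ∉ l := by rw [← isMem_eq_true, Bool.not_eq_true]

@[fun_prop]
theorem Poly.isMem [DecidableEq β] {l : α → List β} {f : α → β} (hf : Poly f) (hl : Poly l) :
    Poly fun x => isMem (f x) (l x) := by
  unfold CNFtoOBDD.isMem
  fun_prop

@[fun_prop]
theorem Poly.dedup [DecidableEq β] {l : α → List β} (hl : Poly l) : Poly fun x => (l x).dedup := by
  have h : Poly fun x => (l x).foldr (fun b c => bif CNFtoOBDD.isMem b c then c else b :: c) [] :=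
    Poly.foldr (M := fun x => 1 + sz (l x)) hl .nil (by fun_prop)
      ((PolyBdd.const 1).add hl.polyBdd_sz) fun x b hb c => by
        have := sz_lt_of_mem hb
        cases CNFtoOBDD.isMem b c <;> simp; omega
  have e : ∀ x, (l x).foldr (fun b c => bif CNFtoOBDD.isMem b c then c else b :: c) [] =
      (l x).dedup := fun x => by
    induction l x with
    | nil => rfl
    | cons b l ih =>
      rw [List.foldr_cons, ih]
      by_cases hb : b ∈ l.dedup
      · rw [List.dedup_cons_of_mem (List.mem_dedup.mp hb), isMem_eq_true.mpr hb, cond_true]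
      · rw [List.dedup_cons_of_notMem (fun h => hb (List.mem_dedup.mpr h)), isMem_eq_false.mpr hb,
          cond_false]
  simpa only [e] using h

@[fun_prop]
theorem Poly.take_one {l : α → List β} (hl : Poly l) : Poly fun x => (l x).take 1 := by
  have h : Poly fun x => CNFtoOBDD.listCase (l x) [] fun b _ => [b] :=
    hl.listCase .nil (by fun_prop)
  have e : ∀ x, CNFtoOBDD.listCase (l x) [] (fun b _ => [b]) = (l x).take 1 := fun x => by
    cases l x <;> rfl
  simpa only [e] using h

@[fun_prop]
theorem Poly.tail {l : α → List β} (hl : Poly l) : Poly fun x => (l x).tail := by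
  have h : Poly fun x => CNFtoOBDD.listCase (l x) [] fun _ t => t :=
    hl.listCase .nil (by fun_prop)
  have e : ∀ x, CNFtoOBDD.listCase (l x) [] (fun _ t => t) = (l x).tail := fun x => by
    cases l x <;> rfl
  simpa only [e] using h

/-- Comparison of the lengths of two lists. -/
def lengthLE {α β : Type*} (l : List α) (l' : List β) : Bool :=
  (l'.foldl (fun c _ => c.tail) l).isEmpty

theorem lengthLE_iff {α β : Type*} {l : List α} {l' : List β} :
    lengthLE l l' = Bool.true ↔ l.length ≤ l'.length := by
  have h : ∀ l : List α, l'.foldl (fun c _ => c.tail) l = l.drop l'.length := by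
    induction l' with
    | nil => simp
    | cons a l' ih => intro l; cases l <;> simp [ih]
  simp [lengthLE, h]

@[fun_prop]
theorem Poly.lengthLE {l : α → List β} {l' : α → List γ} (hl : Poly l) (hl' : Poly l') :
    Poly fun x => lengthLE (l x) (l' x) :=
  Poly.isEmpty (Poly.foldl (M := fun _ => 0) hl' hl (by fun_prop) (.const 0) fun x b _ c => by
    cases c <;> simp)

end Combinators

/-! ### The vertices of the reduced incidence graph -/

/-- A clause as a list of literals. -/
abbrev Cl : Type := List Literal

/-- The vertices of the incidence graph of a list of clauses. -/
abbrev Vtx : Type := Var ⊕ Cl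

/-- The variables that occur in a list of clauses. -/
def varList (L : List Cl) : List Var := (L.flatten.map Prod.fst).dedup

/-- The literals of each clause are listed in an order that is common to all clauses, so that
clauses with the same literals become equal. -/
def normalize (L : List Cl) : List Cl :=
  L.map fun c => L.flatten.dedup.filter fun l => isMem l c

/-- The clause without its literals over the variables in `V`. -/
def restrict (V : List Var) (c : Cl) : Cl := c.filter fun l => !isMem l.1 V

/-- Adjacency in the incidence graph. -/
def adj (u v : Vtx) : Bool :=
  Sum.elim (fun x => Sum.elim (fun _ => false) (fun c => isMem x (c.map Prod.fst)) v)
    (fun c => Sum.elim (fun x => isMem x (c.map Prod.fst)) (fun _ => false) v) u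

@[fun_prop]
theorem Poly.varList {α : Type*} [Enc α] {L : α → List Cl} (hL : Poly L) :
    Poly fun x => varList (L x) := by
  unfold CNFtoOBDD.varList
  fun_prop

@[fun_prop]
theorem Poly.normalize {α : Type*} [Enc α] {L : α → List Cl} (hL : Poly L) :
    Poly fun x => normalize (L x) := by
  unfold CNFtoOBDD.normalize
  fun_prop

@[fun_prop]
theorem Poly.restrict {α : Type*} [Enc α] {V : α → List Var} {c : α → Cl} (hV : Poly V)
    (hc : Poly c) : Poly fun x => restrict (V x) (c x) := by
  unfold CNFtoOBDD.restrict
  fun_prop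

@[fun_prop]
theorem Poly.adj {α : Type*} [Enc α] {u v : α → Vtx} (hu : Poly u) (hv : Poly v) :
    Poly fun x => adj (u x) (v x) := by
  unfold CNFtoOBDD.adj
  refine hu.sumElim (f := fun _ _ => _) (g := fun _ _ => _) ?_ ?_
  · exact Poly.sumElim (f := fun _ _ => _) (g := fun _ _ => _) (by fun_prop) (by fun_prop)
      (by fun_prop)
  · exact Poly.sumElim (f := fun _ _ => _) (g := fun _ _ => _) (by fun_prop) (by fun_prop)
      (by fun_prop)

/-! ### Separating equal parts of clauses -/

/-- The tuples of two clauses and three literals. -/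
def tuples (L : List Cl) : List (Cl × Cl × Literal × Literal × Literal) :=
  L.flatMap fun c => L.flatMap fun d => L.flatten.flatMap fun x => L.flatten.flatMap fun y =>
    L.flatten.map fun z => (c, d, x, y, z)

/-- With the variables in `V` and the clauses in `C` deleted, the clauses `c` and `d` have the
variables of `x` and `y` in common, and differ in the literal `z`. -/
def IsConflict (V : List Var) (C : List Cl) (p : Cl × Cl × Literal × Literal × Literal) : Bool :=
  !isMem p.1 C && !isMem p.2.1 C && isMem p.2.2.1 p.1 &&
  isMem p.2.2.2.1 p.1 && isMem p.2.2.2.2 p.1 && !isMem p.2.2.2.2 p.2.1 &&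
  isMem p.2.2.1.1 (p.2.1.map Prod.fst) && isMem p.2.2.2.1.1 (p.2.1.map Prod.fst) &&
  !decide (p.2.2.1.1 = p.2.2.2.1.1) && !isMem p.2.2.1.1 V && !isMem p.2.2.2.1.1 V &&
  !isMem p.2.2.2.2.1 V

/-- Delete a pair of clauses in conflict, together with two common variables and the variable of a
literal in which the clauses differ. -/
def separateStep (L : List Cl) (D : List Var × List Cl) : List Var × List Cl :=
  listCase ((tuples L).filter (IsConflict D.1 D.2)) D fun p _ =>
    (p.2.2.1.1 :: p.2.2.2.1.1 :: p.2.2.2.2.1 :: D.1, p.1 :: p.2.1 :: D.2)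

/-- Variables and clauses after whose deletion any two clauses are equal or have at most one
variable in common. -/
def separate (L : List Cl) : List Var × List Cl :=
  (varList L).foldl (fun D _ => separateStep L D) ([], [])

@[fun_prop]
theorem Poly.tuples {α : Type*} [Enc α] {L : α → List Cl} (hL : Poly L) :
    Poly fun x => tuples (L x) := by
  unfold CNFtoOBDD.tuples
  fun_prop

@[fun_prop]
theorem Poly.isConflict {α : Type*} [Enc α] {V : α → List Var} {C : α → List Cl}
    {p : α → Cl × Cl × Literal × Literal × Literal} (hV : Poly V)
    (hC : Poly C) (hp : Poly p) : Poly fun x => IsConflict (V x) (C x) (p x) := by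
  unfold CNFtoOBDD.IsConflict
  fun_prop

@[fun_prop]
theorem Poly.separateStep {α : Type*} [Enc α] {L : α → List Cl} {D : α → List Var × List Cl}
    (hL : Poly L) (hD : Poly D) : Poly fun x => separateStep (L x) (D x) := by
  unfold CNFtoOBDD.separateStep
  fun_prop

theorem sz_separateStep (L : List Cl) (D : List Var × List Cl) :
    sz (separateStep L D) ≤ sz D + sz (tuples L) := by
  unfold separateStep
  cases h : (tuples L).filter (IsConflict D.1 D.2) with
  | nil => simp
  | cons p l =>
    have h1 : p ∈ (tuples L).filter (IsConflict D.1 D.2) := by simp [h]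
    have h2 := sz_lt_of_mem (List.mem_of_mem_filter h1)
    obtain ⟨c, d, ⟨x, bx⟩, ⟨y, yb⟩, ⟨z, bz⟩⟩ := p
    have : ∀ x : Var, sz x = 1 := fun _ => rfl
    simp only [listCase_cons, sz_prod, sz_cons] at *
    have := sz_pos bx
    have := sz_pos yb
    have := sz_pos bz
    omega

@[fun_prop]
theorem Poly.separate {α : Type*} [Enc α] {L : α → List Cl} (hL : Poly L) :
    Poly fun x => separate (L x) := by
  unfold CNFtoOBDD.separate
  exact Poly.foldl (M := fun x => sz (CNFtoOBDD.tuples (L x))) (by fun_prop) (by fun_prop)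
    (by fun_prop) (TimeBdd.polyBdd_sz (f := fun x => CNFtoOBDD.tuples (L x)) (Poly.tuples hL))
    fun x _ _ c => sz_separateStep _ _

/-! ### Stripping leaves -/

/-- The variables of a vertex. -/
def pre : Vtx → List Var := Sum.elim (fun x => [x]) fun _ => []

/-- The concatenation of two lists with the shorter one first. -/
def merge (l l' : List Var) : List Var := bif lengthLE l l' then l ++ l' else l' ++ l

/-- The neighbours of `v` in `R`. -/
def nbrs (R : List Vtx) (v : Vtx) : List Vtx := R.filter (adj v)

/-- Strip a vertex that has at most one neighbour; its list of variables is merged with that of its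
neighbour, or, if it has no neighbour, appended to the output. -/
def stripStep (E : List (Vtx × List Var) × List Var) : List (Vtx × List Var) × List Var :=
  listCase (E.1.filter fun e => lengthLE (nbrs (E.1.map Prod.fst) e.1) [()]) E fun e _ =>
    ((E.1.filter fun f => !decide (f.1 = e.1)).map fun f =>
        bif adj e.1 f.1 then (f.1, merge f.2 (pre e.1 ++ e.2)) else f,
      bif (nbrs (E.1.map Prod.fst) e.1).isEmpty then E.2 ++ (pre e.1 ++ e.2) else E.2)

/-- Strip vertices with at most one neighbour as long as possible. -/
def strip (R : List Vtx) : List (Vtx × List Var) × List Var :=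
  R.foldl (fun E _ => stripStep E) (R.map fun v => (v, []), [])

/-- The vertices that are left after stripping leaves and isolated vertices. -/
def core (R : List Vtx) : List Vtx := (strip R).1.map Prod.fst

/-! ### A feedback vertex set -/

/-- The vertices whose degree is exceeded or attained by at most as many vertices as `j` is long,
or any one vertex if there are none of these. -/
def select (j : List Unit) (K : List Vtx) : List Vtx :=
  listCase (K.filter fun v => lengthLE (K.filter fun u => lengthLE (nbrs K v) (nbrs K u)) j)
    (K.take 1) fun v l => v :: l

/-- One round of the search for a feedback vertex set. -/
def fvsStep (G : List Vtx) (T : List Vtx × List Unit) : List Vtx × List Unit :=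
  (T.1 ++ select T.2 (core (G.filter fun v => !isMem v T.1)), () :: T.2)

/-- A feedback vertex set. -/
def fvs (G : List Vtx) : List Vtx := (G.foldl (fun T _ => fvsStep G T) ([], [])).1

/-- The vertices of the incidence graph after the deletion of `D`. -/
def vertices (L : List Cl) (D : List Var × List Cl) : List Vtx :=
  ((varList L).filter fun x => !isMem x D.1).map .inl ++
    (((L.filter fun c => !isMem c D.2).map (restrict D.1)).dedup).map .inr

/-- The list of variables obtained by stripping the forest. -/
def forestOrder (L : List Cl) : List Var :=
  let G := vertices L (separate L)
  (strip (G.filter fun v => !isMem v (fvs G))).2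

/-- The variable order of the diagram. -/
def order (L : List Cl) : List Var :=
  ((varList L).filter fun x => !isMem x (forestOrder L)) ++ forestOrder L

@[fun_prop]
theorem Poly.pre {α : Type*} [Enc α] {v : α → Vtx} (hv : Poly v) : Poly fun x => pre (v x) := by
  unfold CNFtoOBDD.pre
  exact hv.sumElim (f := fun _ x => [x]) (g := fun _ _ => []) (by fun_prop) (by fun_prop)

@[fun_prop]
theorem Poly.merge {α : Type*} [Enc α] {l l' : α → List Var} (hl : Poly l) (hl' : Poly l') :
    Poly fun x => merge (l x) (l' x) := by
  unfold CNFtoOBDD.merge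
  fun_prop

@[fun_prop]
theorem Poly.nbrs {α : Type*} [Enc α] {R : α → List Vtx} {v : α → Vtx} (hR : Poly R)
    (hv : Poly v) : Poly fun x => nbrs (R x) (v x) := by
  unfold CNFtoOBDD.nbrs
  fun_prop

@[fun_prop]
theorem Poly.stripStep {α : Type*} [Enc α] {E : α → List (Vtx × List Var) × List Var}
    (hE : Poly E) : Poly fun x => stripStep (E x) := by
  unfold CNFtoOBDD.stripStep
  fun_prop

theorem sz_merge (l l' : List Var) : sz (merge l l') + 1 = sz l + sz l' := by
  unfold merge
  have h1 := sz_append l l'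
  have h2 := sz_append l' l
  cases lengthLE l l' <;> simp only [cond_true, cond_false] <;> omega

theorem sz_update_le (a : Vtx) (b : List Var) (E : List (Vtx × List Var)) :
    sz (E.map fun f => bif adj a f.1 then (f.1, merge f.2 b) else f) ≤
      sz E + (nbrs (E.map Prod.fst) a).length * (sz b - 1) := by
  induction E with
  | nil => simp
  | cons f E ih =>
    unfold nbrs at *
    have h := sz_merge f.2 b
    have hb := sz_pos b
    cases hf : adj a f.1 with
    | true =>
      simp only [List.map_cons, hf, cond_true, sz_cons, sz_prod, List.filter_cons_of_pos,
        List.length_cons, add_mul, one_mul]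
      omega
    | false =>
      simp only [List.map_cons, hf, cond_false, sz_cons, Bool.false_eq_true, not_false_eq_true,
        List.filter_cons_of_neg]
      omega

theorem sz_filter_ne (e : Vtx × List Var) (E : List (Vtx × List Var)) (he : e ∈ E) :
    sz (E.filter fun f => !decide (f.1 = e.1)) + sz e + 1 ≤ sz E := by
  induction E with
  | nil => cases he
  | cons f E ih =>
    rcases List.mem_cons.mp he with rfl | he
    · have := sz_le_of_sublist (List.filter_sublist (p := fun f => !decide (f.1 = e.1)) (l := E))
      simp only [decide_true, Bool.not_true, Bool.false_eq_true, not_false_eq_true,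
        List.filter_cons_of_neg, sz_cons]
      omega
    · have := ih he
      rw [List.filter_cons]
      split <;> simp only [sz_cons] <;> omega

theorem nbrs_length_mono {R R' : List Vtx} (h : R.Sublist R') (v : Vtx) :
    (nbrs R v).length ≤ (nbrs R' v).length := (h.filter _).length_le

theorem sz_stripStep (E : List (Vtx × List Var) × List Var) : sz (stripStep E) ≤ sz E := by
  unfold stripStep
  cases h : E.1.filter fun e => lengthLE (nbrs (E.1.map Prod.fst) e.1) [()] with
  | nil => simp
  | cons e l =>
    have he : e ∈ E.1.filter fun e => lengthLE (nbrs (E.1.map Prod.fst) e.1) [()] := by simp [h]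
    obtain ⟨heE, hle⟩ := List.mem_filter.mp he
    rw [lengthLE_iff] at hle
    have h1 := sz_filter_ne e E.1 heE
    have h2 := sz_update_le e.1 (pre e.1 ++ e.2) (E.1.filter fun f => !decide (f.1 = e.1))
    have h3 := nbrs_length_mono ((List.filter_sublist (p := fun f => !decide (f.1 = e.1))
      (l := E.1)).map Prod.fst) e.1
    have h4 := sz_append (pre e.1) e.2
    have h5 : sz (pre e.1) ≤ sz e.1 + 1 := by
      obtain ⟨x | c, _⟩ := e
      · exact (by decide : 3 ≤ 4)
      · have := sz_pos (Sum.inr c : Vtx)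
        simp [pre]
    have h6 := sz_append E.2 (pre e.1 ++ e.2)
    simp only [listCase_cons, sz_prod] at *
    simp only [List.length_singleton] at hle
    cases hn : nbrs (E.1.map Prod.fst) e.1 with
    | nil =>
      rw [hn] at h3
      simp only [List.length_nil, nonpos_iff_eq_zero] at h3
      simp only [List.isEmpty_nil, cond_true]
      rw [h3] at h2
      omega
    | cons v l' =>
      simp only [List.isEmpty_cons, cond_false]
      have := Nat.mul_le_mul_right (sz (pre e.1 ++ e.2) - 1) (h3.trans hle)
      omega

@[fun_prop]
theorem Poly.strip {α : Type*} [Enc α] {R : α → List Vtx} (hR : Poly R) :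
    Poly fun x => strip (R x) := by
  unfold CNFtoOBDD.strip
  exact Poly.foldl (M := fun x => 0) (by fun_prop) (by fun_prop)
    (by fun_prop) (.const 0) fun x _ _ c => sz_stripStep _

@[fun_prop]
theorem Poly.core {α : Type*} [Enc α] {R : α → List Vtx} (hR : Poly R) :
    Poly fun x => core (R x) := by
  unfold CNFtoOBDD.core
  fun_prop

@[fun_prop]
theorem Poly.select {α : Type*} [Enc α] {j : α → List Unit} {K : α → List Vtx} (hj : Poly j)
    (hK : Poly K) : Poly fun x => select (j x) (K x) := by
  unfold CNFtoOBDD.select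
  fun_prop

@[fun_prop]
theorem Poly.fvsStep {α : Type*} [Enc α] {G : α → List Vtx} {T : α → List Vtx × List Unit}
    (hG : Poly G) (hT : Poly T) : Poly fun x => fvsStep (G x) (T x) := by
  unfold CNFtoOBDD.fvsStep
  fun_prop

theorem stripStep_sublist (E : List (Vtx × List Var) × List Var) :
    ((stripStep E).1.map Prod.fst).Sublist (E.1.map Prod.fst) := by
  unfold stripStep
  cases h : E.1.filter fun e => lengthLE (nbrs (E.1.map Prod.fst) e.1) [()] with
  | nil => simp
  | cons e l =>
    simp only [listCase_cons, List.map_map]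
    have : (Prod.fst ∘ fun f : Vtx × List Var =>
        bif adj e.1 f.1 then (f.1, merge f.2 (pre e.1 ++ e.2)) else f) = Prod.fst := by
      funext f
      simp only [Function.comp]
      cases adj e.1 f.1 <;> rfl
    rw [this]
    exact List.filter_sublist.map _

theorem core_sublist (R : List Vtx) : (core R).Sublist R := by
  have h : ∀ (l : List Vtx) (E : List (Vtx × List Var) × List Var),
      ((l.foldl (fun E _ => stripStep E) E).1.map Prod.fst).Sublist (E.1.map Prod.fst) := by
    intro l
    induction l with
    | nil => exact fun E => List.Sublist.refl _
    | cons a l ih => exact fun E => (ih _).trans (stripStep_sublist E)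
  have := h R (R.map fun v => (v, []), [])
  simpa [core, strip, Function.comp_def] using this

theorem select_sublist (j : List Unit) (K : List Vtx) : (select j K).Sublist K := by
  have h : (K.filter fun v => lengthLE (K.filter fun u => lengthLE (nbrs K v) (nbrs K u)) j).Sublist
      K := List.filter_sublist
  unfold select
  cases hs : K.filter fun v => lengthLE (K.filter fun u => lengthLE (nbrs K v) (nbrs K u)) j with
  | nil => exact List.take_sublist 1 K
  | cons v l => rw [hs] at h; exact h

@[fun_prop]
theorem Poly.fvs {α : Type*} [Enc α] {G : α → List Vtx} (hG : Poly G) :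
    Poly fun x => fvs (G x) := by
  unfold CNFtoOBDD.fvs
  refine Poly.fst.comp (Poly.foldl (M := fun x => sz (G x) + 2) hG (by fun_prop)
    (by fun_prop) (hG.polyBdd_sz.add (.const 2)) fun x _ _ T => ?_)
  have h1 := sz_le_of_sublist ((select_sublist T.2 _).trans
    ((core_sublist ((G x).filter fun v => !CNFtoOBDD.isMem v T.1)).trans List.filter_sublist))
  have h2 := sz_append T.1 (CNFtoOBDD.select T.2
    (CNFtoOBDD.core ((G x).filter fun v => !CNFtoOBDD.isMem v T.1)))
  have h3 : sz () = 1 := rfl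
  simp only [CNFtoOBDD.fvsStep, sz_prod, sz_cons]
  omega

@[fun_prop]
theorem Poly.vertices {α : Type*} [Enc α] {L : α → List Cl} {D : α → List Var × List Cl}
    (hL : Poly L) (hD : Poly D) : Poly fun x => vertices (L x) (D x) := by
  unfold CNFtoOBDD.vertices
  fun_prop

@[fun_prop]
theorem Poly.forestOrder {α : Type*} [Enc α] {L : α → List Cl} (hL : Poly L) :
    Poly fun x => forestOrder (L x) := by
  unfold CNFtoOBDD.forestOrder
  fun_prop

@[fun_prop]
theorem Poly.order {α : Type*} [Enc α] {L : α → List Cl} (hL : Poly L) :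
    Poly fun x => order (L x) := by
  unfold CNFtoOBDD.order
  fun_prop

/-! ### Diagrams of residual formulas -/

/-- The vertices of the diagram: the variables that are still to be read, and the residual clauses.
A formula that contains the empty clause is represented by `([], [[]])`. -/
abbrev State : Type := List Var × List Cl

/-- Replace a formula that contains the empty clause by `([], [[]])`. -/
def collapse (S : State) : State := bif isMem [] S.2 then ([], [[]]) else S

/-- The residual clauses after `x` has been given the value `b`. -/
def assign (x : Var) (b : Bool) (R : List Cl) : List Cl :=
  (R.filter fun c => !isMem (x, b) c).map fun c => c.filter fun l => !decide (l.1 = x)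

/-- The successor of a state when its first variable `x` has the value `b`. -/
def child (x : Var) (b : Bool) (V : List Var) (R : List Cl) : State := collapse (V, assign x b R)

/-- The successors of a state. -/
def children (S : State) : List State :=
  listCase S.1 [] fun x V => [child x false V S.2, child x true V S.2]

/-- The label and the outgoing edges of a state. -/
def State.node (S : State) : Node State :=
  listCase S.1 (.sink S.2.isEmpty) fun x V => .branch x (child x false V S.2) (child x true V S.2)

/-- The states that are reachable by reading at most as many variables as `l` is long. -/
def reach (S : State) (l : List Var) : List State :=
  l.foldl (fun A _ => (A ++ A.flatMap children).dedup) [S]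

/-- The state from which the diagram is built. -/
def start (L : List Cl) : State := collapse (order (normalize L), normalize L)

/-- The states of the diagram. -/
def states (L : List Cl) : List State := reach (start L) (order (normalize L))

instance instEncNode {α : Type} [Enc α] : Enc (Node α) :=
  ⟨Node.toData enc, by
    rintro (b | ⟨x, l, h⟩) (b' | ⟨x', l', h'⟩) he
    · simp only [Node.toData, Data.cons.injEq, true_and] at he
      rw [Enc.enc_injective (α := Bool) he]
    · simp [Node.toData] at he
    · simp [Node.toData] at he
    · simp only [Node.toData, Data.cons.injEq, Data.atom.injEq] at he
      rw [he.1, Enc.enc_injective he.2.1, Enc.enc_injective he.2.2]⟩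

/-- The diagram. -/
def diagram (L : List Cl) : State × List (State × Node State) :=
  (start L, (states L).map fun S => (S, S.node))

@[fun_prop]
theorem Poly.sink {α β : Type} [Enc α] [Enc β] {b : α → Bool} (hb : Poly b) :
    Poly fun x => (Node.sink (b x) : Node β) :=
  ((Poly.nil (β := Unit)).pair hb).of_enc_eq fun x => ⟨x, rfl, rfl⟩

@[fun_prop]
theorem Poly.branch {α β : Type} [Enc α] [Enc β] {x : α → Var} {l h : α → β} (hx : Poly x)
    (hl : Poly l) (hh : Poly h) : Poly fun a => Node.branch (x a) (l a) (h a) :=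
  (hx.pair (hl.pair hh)).of_enc_eq fun x => ⟨x, rfl, rfl⟩

@[fun_prop]
theorem Poly.collapse {α : Type*} [Enc α] {S : α → State} (hS : Poly S) :
    Poly fun x => collapse (S x) := by
  unfold CNFtoOBDD.collapse
  fun_prop

@[fun_prop]
theorem Poly.assign {α : Type*} [Enc α] {x : α → Var} {b : α → Bool} {R : α → List Cl}
    (hx : Poly x) (hb : Poly b) (hR : Poly R) : Poly fun a => assign (x a) (b a) (R a) := by
  unfold CNFtoOBDD.assign
  fun_prop

@[fun_prop]
theorem Poly.child {α : Type*} [Enc α] {x : α → Var} {b : α → Bool} {V : α → List Var}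
    {R : α → List Cl} (hx : Poly x) (hb : Poly b) (hV : Poly V) (hR : Poly R) :
    Poly fun a => child (x a) (b a) (V a) (R a) := by
  unfold CNFtoOBDD.child
  fun_prop

@[fun_prop]
theorem Poly.children {α : Type*} [Enc α] {S : α → State} (hS : Poly S) :
    Poly fun x => children (S x) := by
  unfold CNFtoOBDD.children
  fun_prop

@[fun_prop]
theorem Poly.node {α : Type} [Enc α] {S : α → State} (hS : Poly S) :
    Poly fun x => (S x).node := by
  unfold CNFtoOBDD.State.node
  fun_prop

@[fun_prop]
theorem Poly.start {α : Type*} [Enc α] {L : α → List Cl} (hL : Poly L) :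
    Poly fun x => start (L x) := by
  unfold CNFtoOBDD.start
  fun_prop

/-- The diagram is computed in time polynomial in `B` if the sets of states are of size
polynomial in `B`. -/
theorem TimeBdd.diagram {α : Type} [Enc α] {L : α → List Cl} {B M : α → ℕ} (hL : Poly L)
    (hB : PolyBdd B sz) (hM : PolyBdd B M)
    (h : ∀ x l, l <+: order (normalize (L x)) → sz (reach (start (L x)) l) ≤ M x) :
    TimeBdd B fun x => diagram (L x) := by
  have h1 : TimeBdd B fun x => states (L x) :=
    TimeBdd.foldl (M := M) (l := fun x => order (normalize (L x))) (init := fun x => [start (L x)])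
      (step := fun _ (A : List State) (_ : Var) => (A ++ A.flatMap CNFtoOBDD.children).dedup) hB
      (Poly.timeBdd (by fun_prop) hB) (Poly.timeBdd (by fun_prop) hB) (by fun_prop) hM h
  have h2 : Poly fun p : State × List State => (p.1, p.2.map fun S => (S, S.node)) := by fun_prop
  exact TimeBdd.comp (f := fun x => (start (L x), states (L x))) h2
    (TimeBdd.pair hB (Poly.timeBdd (by fun_prop) hB) h1)

/-! ### Correctness of the diagram -/

/-- A list of clauses is satisfied by an assignment. -/
def SatList (R : List Cl) (a : Var → Bool) : Prop := ∀ c ∈ R, ∃ l ∈ c, a l.1 = l.2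

/-- No literal of the clause over a variable in `P` is satisfied. -/
def Unsat (P : List Var) (c : Cl) (a : Var → Bool) : Prop := ∀ l ∈ c, l.1 ∈ P → a l.1 ≠ l.2

open Classical in
/-- The residual clauses after the variables in `P` have been read. -/
noncomputable def residual (N : List Cl) (P : List Var) (a : Var → Bool) : List Cl :=
  (N.filter fun c => decide (Unsat P c a)).map (restrict P)

theorem mem_restrict {P : List Var} {c : Cl} {l : Literal} :
    l ∈ restrict P c ↔ l ∈ c ∧ l.1 ∉ P := by simp [restrict]

theorem residual_congr {N : List Cl} {P : List Var} {a a' : Var → Bool}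
    (h : ∀ c ∈ N, (Unsat P c a ↔ Unsat P c a')) : residual N P a = residual N P a' := by
  unfold residual
  congr 1
  exact List.filter_congr fun c hc => by simp [h c hc]

theorem Unsat.congr {P : List Var} {c : Cl} {a a' : Var → Bool} (h : ∀ x ∈ P, a x = a' x) :
    Unsat P c a ↔ Unsat P c a' :=
  forall₃_congr fun l _ hl => by rw [h l.1 hl]

theorem assign_residual {N : List Cl} {P : List Var} {x : Var} (hx : x ∉ P) (a : Var → Bool) :
    assign x (a x) (residual N P a) = residual N (P ++ [x]) a := by
  unfold assign residual
  rw [List.filter_map, List.filter_filter, List.map_map]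
  have h1 : ∀ c : Cl, (Unsat (P ++ [x]) c a ↔ (x, a x) ∉ restrict P c ∧ Unsat P c a) := by
    intro c
    rw [mem_restrict]
    constructor
    · intro h
      exact ⟨fun h' => h _ h'.1 (by simp) rfl, fun l hl hP => h l hl (by simp [hP])⟩
    · rintro ⟨h, h'⟩ l hl hP
      rcases List.mem_append.mp hP with hP | hP
      · exact h' l hl hP
      · rw [List.mem_singleton] at hP
        intro he
        refine h ⟨?_, hx⟩
        rw [← hP, he]
        exact hl
  have h2 : (fun c : Cl => c.filter fun l => !decide (l.1 = x)) ∘ restrict P =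
      restrict (P ++ [x]) := by
    funext c
    simp only [Function.comp, restrict, List.filter_filter]
    refine List.filter_congr fun l _ => ?_
    rw [Bool.eq_iff_iff]
    simp [and_comm]
  rw [h2]
  congr 1
  refine List.filter_congr fun c _ => ?_
  rw [Bool.eq_iff_iff]
  simp [h1]

theorem residual_nil (N : List Cl) (a : Var → Bool) : residual N [] a = N := by
  have : restrict [] = id := by funext c; simp [restrict]
  simp [residual, Unsat, this]

theorem satList_assign {x : Var} {a : Var → Bool} {R : List Cl} :
    SatList (assign x (a x) R) a ↔ SatList R a := by
  constructor
  · intro h c hc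
    by_cases hx : (x, a x) ∈ c
    · exact ⟨_, hx, rfl⟩
    · obtain ⟨l, hl, h'⟩ := h _ (List.mem_map.mpr
        ⟨c, List.mem_filter.mpr ⟨hc, by simpa using hx⟩, rfl⟩)
      exact ⟨l, (List.mem_filter.mp hl).1, h'⟩
  · intro h d hd
    obtain ⟨c, hc, rfl⟩ := List.mem_map.mp hd
    obtain ⟨hc, hx⟩ := List.mem_filter.mp hc
    obtain ⟨l, hl, h'⟩ := h c hc
    refine ⟨l, List.mem_filter.mpr ⟨hl, ?_⟩, h'⟩
    by_contra he
    have he : l.1 = x := by simpa using he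
    have : l ∉ c := by
      rw [show l = (x, a x) by rw [← he, h']]
      simpa using hx
    exact this hl

theorem satList_collapse {S : State} {a : Var → Bool} :
    SatList (collapse S).2 a ↔ SatList S.2 a := by
  unfold collapse
  cases h : isMem [] S.2 with
  | false => rfl
  | true =>
    rw [isMem_eq_true] at h
    constructor
    · intro h'
      obtain ⟨l, hl, _⟩ := h' [] (by simp)
      cases hl
    · intro h'
      obtain ⟨l, hl, _⟩ := h' [] h
      cases hl

/-- The states that arise from `N` with the variable order `σ`. -/
def State.Arises (N : List Cl) (σ : List Var) (S : State) : Prop :=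
  S = ([], [[]]) ∨ ∃ P Q a, σ = P ++ Q ∧ S = (Q, residual N P a) ∧ [] ∉ residual N P a

theorem arises_collapse {N : List Cl} {σ P Q : List Var} {a : Var → Bool} (h : σ = P ++ Q) :
    State.Arises N σ (collapse (Q, residual N P a)) := by
  unfold collapse
  cases h' : isMem [] (residual N P a) with
  | true => exact .inl rfl
  | false => exact .inr ⟨P, Q, a, h, rfl, by simpa using h'⟩

theorem State.Arises.children {N : List Cl} {σ : List Var} (hσ : σ.Nodup) {S S' : State}
    (hS : S.Arises N σ) (h : S' ∈ children S) : S'.Arises N σ := by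
  obtain rfl | ⟨P, Q, a, rfl, rfl, ha⟩ := hS
  · simp [CNFtoOBDD.children] at h
  · cases Q with
    | nil => simp [CNFtoOBDD.children] at h
    | cons x Q =>
      have hx : x ∉ P := fun hx => (List.nodup_append.mp hσ).2.2 _ hx _ (by simp) rfl
      have key : ∀ b, (child x b Q (residual N P a)).Arises N (P ++ x :: Q) := by
        intro b
        have h1 : residual N P a = residual N P (Function.update a x b) :=
          residual_congr fun c _ => Unsat.congr fun y hy => by
            rw [Function.update_of_ne]
            rintro rfl
            exact hx hy
        have h2 := assign_residual (N := N) hx (Function.update a x b)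
        rw [Function.update_self] at h2
        unfold child
        rw [h1, h2]
        exact arises_collapse (by simp)
      simp only [CNFtoOBDD.children, listCase_cons, List.mem_cons, List.not_mem_nil,
        or_false] at h
      rcases h with rfl | rfl <;> exact key _

theorem length_child_le (x : Var) (b : Bool) (V : List Var) (R : List Cl) :
    (child x b V R).1.length ≤ V.length := by
  unfold child collapse
  cases isMem [] (V, assign x b R).2 <;> simp

theorem length_lt_of_mem_children {S S' : State} (h : S' ∈ children S) :
    S'.1.length < S.1.length := by
  obtain ⟨_ | ⟨x, V⟩, R⟩ := S
  · simp [children] at h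
  · have := length_child_le x false V R
    have := length_child_le x true V R
    simp only [children, listCase_cons, List.mem_cons, List.not_mem_nil, or_false] at h
    simp only [List.length_cons]
    rcases h with rfl | rfl <;> omega

/-- `A` consists of the states that are reachable from `S`. -/
structure IsClosedFrom (S : State) (A : List State) : Prop where
  nodup : A.Nodup
  start_mem : S ∈ A
  closed : ∀ S₁ ∈ A, ∀ S₂ ∈ children S₁, S₂ ∈ A
  length_le : ∀ S₁ ∈ A, S₁.1.length ≤ S.1.length
  parent : ∀ S₁ ∈ A, S₁ = S ∨ ∃ S₂ ∈ A, S₁ ∈ children S₂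

theorem reach_append (S : State) (l : List Var) (x : Var) :
    reach S (l ++ [x]) = (reach S l ++ (reach S l).flatMap children).dedup := by
  simp [reach]

theorem mem_reach_append {S S' : State} {l : List Var} {x : Var} :
    S' ∈ reach S (l ++ [x]) ↔ S' ∈ reach S l ∨ ∃ S₁ ∈ reach S l, S' ∈ children S₁ := by
  simp [reach_append]

theorem reach_induction {S : State} {p : State → Prop} (h0 : p S)
    (h : ∀ S₁ S₂, p S₁ → S₂ ∈ children S₁ → p S₂) (l : List Var) : ∀ S₁ ∈ reach S l, p S₁ := by
  induction l using List.reverseRecOn with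
  | nil => simpa [reach] using h0
  | append_singleton l x ih =>
    intro S₁ h₁
    obtain h₁ | ⟨S₂, h₂, h₁⟩ := mem_reach_append.mp h₁
    · exact ih _ h₁
    · exact h _ _ (ih _ h₂) h₁

theorem nodup_reach (S : State) (l : List Var) : (reach S l).Nodup := by
  induction l using List.reverseRecOn with
  | nil => simp [reach]
  | append_singleton l x ih => rw [reach_append]; exact List.nodup_dedup _

theorem child_length {x : Var} {b : Bool} {V : List Var} {R : List Cl}
    (h : (child x b V R).1 ≠ []) : (child x b V R).1.length = V.length := by
  unfold child collapse at *
  cases h' : isMem [] (V, assign x b R).2 with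
  | true => rw [h'] at h; simp at h
  | false => rfl

theorem isClosedFrom_reach {S : State} {l : List Var} (h : S.1.length ≤ l.length) :
    IsClosedFrom S (reach S l) := by
  have h1 : ∀ l : List Var, ∀ S₁ ∈ reach S l, S₁.1.length ≤ S.1.length := fun l =>
    reach_induction (p := fun S₁ => S₁.1.length ≤ S.1.length) le_rfl
      (fun S₁ S₂ h h' => (length_lt_of_mem_children h').le.trans h) l
  -- After `i` rounds all states that have read fewer than `i` variables have been expanded.
  have h2 : ∀ l : List Var, ∀ S₁ ∈ reach S l, S.1.length < S₁.1.length + l.length →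
      ∀ S₂ ∈ children S₁, S₂ ∈ reach S l := by
    intro l
    induction l using List.reverseRecOn with
    | nil => intro S₁ hS₁ hl; simp [reach] at hS₁; simp [hS₁] at hl
    | append_singleton l x ih =>
      intro S₁ hS₁ hl S₂ hS₂
      rw [mem_reach_append] at hS₁ ⊢
      obtain hS₁ | ⟨S₃, hS₃, hS₁⟩ := hS₁
      · exact .inr ⟨S₁, hS₁, hS₂⟩
      · refine .inr ⟨S₁, ih S₃ hS₃ ?_ S₁ hS₁, hS₂⟩
        have hne : S₁.1 ≠ [] := by
          rintro h
          simp [children, h] at hS₂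
        obtain ⟨_ | ⟨y, V⟩, R⟩ := S₃
        · simp [children] at hS₁
        · simp only [children, listCase_cons, List.mem_cons, List.not_mem_nil, or_false] at hS₁
          have : S₁.1.length = V.length := by
            rcases hS₁ with rfl | rfl <;> exact child_length hne
          simp only [List.length_append, List.length_cons, List.length_nil] at *
          omega
  refine ⟨nodup_reach S l, ?_, fun S₁ hS₁ S₂ hS₂ => h2 l S₁ hS₁ ?_ S₂ hS₂, h1 l, ?_⟩
  · clear h
    induction l using List.reverseRecOn with
    | nil => simp [reach]
    | append_singleton l x ih => exact mem_reach_append.mpr (.inl ih)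
  · have := length_lt_of_mem_children hS₂
    omega
  · clear h
    induction l using List.reverseRecOn with
    | nil => intro S₁ h; left; simpa [reach] using h
    | append_singleton l x ih =>
      intro S₁ hS₁
      obtain hS₁ | ⟨S₂, hS₂, hS₁⟩ := mem_reach_append.mp hS₁
      · obtain h | ⟨S₂, hS₂, h⟩ := ih S₁ hS₁
        · exact .inl h
        · exact .inr ⟨S₂, mem_reach_append.mpr (.inl hS₂), h⟩
      · exact .inr ⟨S₂, mem_reach_append.mpr (.inl hS₂), hS₁⟩

/-- Rename the vertices to which a label refers. -/
def Node.rename {W W' : Type} (f : W → W') : Node W → Node W'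
  | .sink b => .sink b
  | .branch x l h => .branch x (f l) (f h)

theorem State.node_cases (S : State) : (S.1 = [] ∧ S.node = .sink S.2.isEmpty) ∨
    ∃ x V, S.1 = x :: V ∧ S.node = .branch x (child x false V S.2) (child x true V S.2) ∧
      children S = [child x false V S.2, child x true V S.2] := by
  obtain ⟨_ | ⟨x, V⟩, R⟩ := S
  · exact .inl ⟨rfl, rfl⟩
  · exact .inr ⟨x, V, rfl, rfl, rfl⟩

section Diagram

variable {N : List Cl} {σ : List Var} {S : State} {A : List State}

/-- The position of a state in the list `A`. States that are not in `A` get that of `S`. -/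
def IsClosedFrom.index (h : IsClosedFrom S A) (S' : State) : Fin A.length :=
  if h' : S' ∈ A then ⟨A.idxOf S', List.idxOf_lt_length_of_mem h'⟩
  else ⟨A.idxOf S, List.idxOf_lt_length_of_mem h.start_mem⟩

theorem IsClosedFrom.get_index (h : IsClosedFrom S A) {S' : State} (h' : S' ∈ A) :
    A.get (h.index S') = S' := by
  simp [index, h']

theorem IsClosedFrom.index_get (h : IsClosedFrom S A) (v : Fin A.length) :
    h.index (A.get v) = v :=
  h.nodup.injective_get (h.get_index (List.get_mem A v))

theorem IsClosedFrom.succ_iff (h : IsClosedFrom S A) {u v : Fin A.length} :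
    ((A.get v).node.rename h.index).Succ u ↔ A.get u ∈ children (A.get v) := by
  obtain ⟨h1, h2⟩ | ⟨x, V, h1, h2, h3⟩ := (A.get v).node_cases
  · rw [h2]
    rw [children, h1]
    simp [Node.rename, Node.Succ]
  · have hc := h.closed _ (List.get_mem A v)
    rw [h3] at hc
    rw [h2, h3]
    simp only [Node.rename, Node.Succ, List.mem_cons, List.not_mem_nil, or_false]
    have hi : ∀ S' ∈ A, u = h.index S' ↔ A.get u = S' := fun S' hS' =>
      ⟨fun e => by rw [e, h.get_index hS'], fun e => by rw [← e, h.index_get]⟩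
    rw [hi _ (hc _ (by simp)), hi _ (hc _ (by simp))]

/-- A state without variables is one of the two sinks. -/
theorem State.Arises.eq_of_nil (hN : ∀ c ∈ N, ∀ l ∈ c, l.1 ∈ σ) (hS : S.Arises N σ)
    (h : S.1 = []) : S = ([], [[]]) ∨ S = ([], []) := by
  obtain rfl | ⟨P, Q, a, rfl, rfl, ha⟩ := hS
  · exact .inl rfl
  · right
    obtain rfl : Q = [] := h
    refine Prod.ext rfl ?_
    rw [List.eq_nil_iff_forall_not_mem]
    intro c hc
    obtain rfl : c = [] := by
      rw [List.eq_nil_iff_forall_not_mem]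
      intro l hl
      simp only [residual, List.mem_map, List.mem_filter] at hc
      obtain ⟨c, hc, rfl⟩ := hc
      rw [mem_restrict] at hl
      exact hl.2 (by simpa using hN c hc.1 l hl.1)
    exact ha hc

/-- The diagram that consists of the states that are reachable from `S`. -/
def IsClosedFrom.bdd (h : IsClosedFrom S A) (hN : ∀ c ∈ N, ∀ l ∈ c, l.1 ∈ σ)
    (hA : ∀ S ∈ A, S.Arises N σ) : BDD where
  n := A.length
  node v := (A.get v).node.rename h.index
  acyclic := by
    intro v hv
    have : ∀ u w, Relation.TransGen
        (fun v u => ((A.get v).node.rename h.index).Succ u) u w →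
        (A.get w).1.length < (A.get u).1.length := by
      intro u w huw
      induction huw with
      | single h' => exact length_lt_of_mem_children (h.succ_iff.mp h')
      | tail _ h' ih => exact (length_lt_of_mem_children (h.succ_iff.mp h')).trans ih
    exact lt_irrefl _ (this v v hv)
  sink_unique := by
    intro u v b hu hv
    have key : ∀ w, (A.get w).node.rename h.index = .sink b →
        A.get w = ([], bif b then [] else [[]]) := by
      intro w hw
      obtain ⟨h1, h2⟩ | ⟨x, V, h1, h2, h3⟩ := (A.get w).node_cases
      · rw [h2] at hw
        simp only [Node.rename, Node.sink.injEq] at hw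
        obtain he | he := (hA _ (List.get_mem A w)).eq_of_nil hN h1
        all_goals
          rw [he] at hw ⊢
          rw [← hw]
          rfl
      · rw [h2] at hw
        cases hw
    exact h.nodup.injective_get ((key u hu).trans (key v hv).symm)
  source := h.index S
  source_unique := by
    intro v
    simp only [h.succ_iff]
    constructor
    · intro hv
      obtain h' | ⟨S', hS', h'⟩ := h.parent _ (List.get_mem A v)
      · exact h.nodup.injective_get (h'.trans (h.get_index h.start_mem).symm)
      · exact (hv (h.index S') (by rwa [h.get_index hS'])).elim
    · rintro rfl u hu
      rw [h.get_index h.start_mem] at hu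
      exact (length_lt_of_mem_children hu).not_ge (h.length_le _ (List.get_mem A u))

theorem IsClosedFrom.bdd_isRepresentedBy (h : IsClosedFrom S A)
    (hN : ∀ c ∈ N, ∀ l ∈ c, l.1 ∈ σ) (hA : ∀ S ∈ A, S.Arises N σ) :
    (h.bdd hN hA).IsRepresentedBy (enc (S, A.map fun S => (S, S.node))) := by
  refine ⟨fun v => enc (A.get v), fun u v huv => h.nodup.injective_get (Enc.enc_injective huv), ?_⟩
  have h1 : A.get (h.bdd hN hA).source = S := h.get_index h.start_mem
  have h2 : ∀ v : Fin A.length, ((A.get v).node.rename h.index).toData (fun v => enc (A.get v)) =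
      enc (A.get v).node := by
    intro v
    have hc := h.closed _ (List.get_mem A v)
    obtain ⟨h1, h2⟩ | ⟨x, V, h1, h2, h3⟩ := (A.get v).node_cases
    · rw [h2]
      rfl
    · rw [h3] at hc
      rw [h2]
      simp only [Node.rename, Node.toData]
      rw [h.get_index (hc _ (by simp)), h.get_index (hc _ (by simp))]
      rfl
  have h3 : (List.finRange (h.bdd hN hA).n).map (fun v => Data.cons (enc (A.get v))
      (((h.bdd hN hA).node v).toData fun v => enc (A.get v))) =
      A.map fun S => enc (S, S.node) := by
    have : A.map (fun S => enc (S, S.node)) =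
        (List.finRange A.length).map fun v => enc (A.get v, (A.get v).node) := by
      conv_lhs => rw [← List.map_get_finRange A]
      rw [List.map_map]
      rfl
    rw [this]
    refine List.map_congr_left fun v _ => ?_
    exact congrArg _ (h2 v)
  refine congrArg₂ Data.cons (congrArg enc h1.symm) ?_
  refine Eq.trans ?_ (congrArg Data.ofList h3.symm)
  show Data.ofList _ = _
  rw [List.map_map]
  rfl

theorem State.Arises.idxOf (hσ : σ.Nodup) (hS : S.Arises N σ) {x : Var} {V : List Var}
    (h : S.1 = x :: V) : σ.idxOf x + S.1.length = σ.length := by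
  obtain rfl | ⟨P, Q, a, rfl, rfl, ha⟩ := hS
  · cases h
  · obtain rfl : Q = x :: V := h
    have hx : x ∉ P := fun hx => (List.nodup_append.mp hσ).2.2 _ hx _ (by simp) rfl
    rw [List.idxOf_append_of_notMem hx, List.idxOf_cons_self, List.length_append]
    rfl

theorem IsClosedFrom.bdd_isOBDD (h : IsClosedFrom S A) (hσ : σ.Nodup)
    (hN : ∀ c ∈ N, ∀ l ∈ c, l.1 ∈ σ) (hA : ∀ S ∈ A, S.Arises N σ) :
    (h.bdd hN hA).IsOBDD σ.toFinset := by
  have key : ∀ v x lo hi, (h.bdd hN hA).node v = .branch x lo hi →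
      σ.idxOf x + (A.get v).1.length = σ.length ∧ (A.get v).1.length ≠ 0 := by
    intro v x lo hi hv
    obtain ⟨h1, h2⟩ | ⟨y, V, h1, h2, h3⟩ := (A.get v).node_cases
    · change (A.get v).node.rename h.index = _ at hv
      rw [h2] at hv
      cases hv
    · change (A.get v).node.rename h.index = _ at hv
      rw [h2] at hv
      simp only [Node.rename] at hv
      obtain ⟨rfl, _⟩ := hv
      exact ⟨(hA _ (List.get_mem A v)).idxOf hσ h1, by rw [h1]; simp⟩
  refine ⟨fun v x lo hi hv => ?_, σ, hσ, rfl, fun u v x lo hi y lo' hi' hu hv huv => ?_⟩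
  · obtain ⟨h1, h2⟩ := key v x lo hi hv
    rw [List.mem_toFinset, ← List.idxOf_lt_length_iff]
    omega
  · have h1 := key u x lo hi hu
    have h2 := key v y lo' hi' hv
    have h3 := length_lt_of_mem_children (h.succ_iff.mp huv)
    omega

theorem IsClosedFrom.bdd_value (h : IsClosedFrom S A)
    (hN : ∀ c ∈ N, ∀ l ∈ c, l.1 ∈ σ) (hA : ∀ S ∈ A, S.Arises N σ) (a : Var → Bool) :
    ∀ (n : ℕ) (v : Fin A.length), (A.get v).1.length ≤ n →
      ∃ b, (h.bdd hN hA).Value a v b ∧ (b = true ↔ SatList (A.get v).2 a) := by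
  intro n
  induction n with
  | zero =>
    intro v hv
    obtain ⟨h1, h2⟩ | ⟨y, V, h1, h2, h3⟩ := (A.get v).node_cases
    · refine ⟨(A.get v).2.isEmpty, .sink ?_, ?_⟩
      · change (A.get v).node.rename h.index = _
        rw [h2]
        rfl
      · obtain he | he := (hA _ (List.get_mem A v)).eq_of_nil hN h1
        · rw [he]; simp [SatList]
        · rw [he]; simp [SatList]
    · rw [h1] at hv
      simp at hv
  | succ n ih =>
    intro v hv
    obtain ⟨h1, h2⟩ | ⟨x, V, h1, h2, h3⟩ := (A.get v).node_cases
    · exact ih v (by rw [h1]; simp)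
    · have hc := h.closed _ (List.get_mem A v)
      rw [h3] at hc
      have hmem : child x (a x) V (A.get v).2 ∈ A := by
        cases a x
        · exact hc _ (by simp)
        · exact hc _ (by simp)
      have hlen : (A.get (h.index (child x (a x) V (A.get v).2))).1.length ≤ n := by
        rw [h.get_index hmem]
        have := length_child_le x (a x) V (A.get v).2
        rw [h1] at hv
        simp only [List.length_cons] at hv
        omega
      obtain ⟨b, hb, hb'⟩ := ih _ hlen
      refine ⟨b, .branch (x := x) (lo := h.index (child x false V (A.get v).2))
        (hi := h.index (child x true V (A.get v).2)) ?_ ?_, ?_⟩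
      · change (A.get v).node.rename h.index = _
        rw [h2]
        rfl
      · convert hb using 1
        cases a x <;> rfl
      · rw [hb', h.get_index hmem]
        unfold child
        rw [satList_collapse, satList_assign]

theorem IsClosedFrom.exists_bdd {F : CNF} (h : IsClosedFrom (collapse (σ, N)) A) (hσ : σ.Nodup)
    (hN : ∀ c ∈ N, ∀ l ∈ c, l.1 ∈ σ) (hA : ∀ S ∈ A, S.Arises N σ)
    (hF : ∀ a, F.Sat a ↔ SatList N a) (hv : σ.toFinset = F.vars) :
    ∃ B : BDD, B.IsRepresentedBy (enc (collapse (σ, N), A.map fun S => (S, S.node))) ∧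
      B.IsOBDD F.vars ∧ B.Computes F := by
  refine ⟨h.bdd hN hA, h.bdd_isRepresentedBy hN hA, hv ▸ h.bdd_isOBDD hσ hN hA, fun a => ?_⟩
  obtain ⟨b, hb, hb'⟩ := h.bdd_value hN hA a _ (h.index (collapse (σ, N))) le_rfl
  refine ⟨b, hb, ?_⟩
  rw [hb', h.get_index h.start_mem, satList_collapse, hF]

end Diagram

/-! ### The number of states -/

/-- The truth value of `p` is determined by the values of the functions in `q`. -/
def Determines (q : List ((Var → Bool) → Bool)) (p : (Var → Bool) → Prop) : Prop :=
  ∀ a a', (∀ f ∈ q, f a = f a') → (p a ↔ p a')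

/-- Whenever an initial segment of `σ` has been read, `m` bits determine which of the clauses that
have literals over the remaining variables are still unsatisfied. -/
def IsNarrow (N : List Cl) (σ : List Var) (m : ℕ) : Prop :=
  ∀ P Q, σ = P ++ Q → ∃ q : List ((Var → Bool) → Bool), q.length ≤ m ∧
    ∀ c ∈ N, (∃ l ∈ c, l.1 ∈ Q) → Determines q (Unsat P c)

theorem sz_restrict_le (P : List Var) (c : Cl) : sz (restrict P c) ≤ sz c :=
  sz_le_of_sublist List.filter_sublist

theorem sz_map_restrict_le (P : List Var) (N : List Cl) : sz (N.map (restrict P)) ≤ sz N := by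
  induction N with
  | nil => simp
  | cons c N ih =>
    have := sz_restrict_le P c
    simp only [List.map_cons, sz_cons]
    omega

theorem State.Arises.sz_le {N : List Cl} {σ : List Var} {S : State} (h : S.Arises N σ) :
    sz S ≤ sz σ + sz N + 5 := by
  obtain rfl | ⟨P, Q, a, rfl, rfl, -⟩ := h
  · simp
  · have h1 : sz Q ≤ sz (P ++ Q) := sz_le_of_sublist (List.sublist_append_right P Q)
    have h2 : sz (residual N P a) ≤ sz N :=
      (sz_map_restrict_le _ _).trans (sz_le_of_sublist List.filter_sublist)
    simp only [sz_prod]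
    omega

/-- If no unsatisfied clause has been read completely, the residual clauses depend only on the
clauses that have literals over the remaining variables. -/
theorem residual_eq_residual {N : List Cl} {P Q : List Var} {a a' : Var → Bool}
    (hN : ∀ c ∈ N, ∀ l ∈ c, l.1 ∈ P ++ Q)
    (h : ∀ c ∈ N, (∃ l ∈ c, l.1 ∈ Q) → (Unsat P c a ↔ Unsat P c a'))
    (ha : [] ∉ residual N P a) (ha' : [] ∉ residual N P a') :
    residual N P a = residual N P a' := by
  refine residual_congr fun c hc => ?_
  by_cases hQ : ∃ l ∈ c, l.1 ∈ Q
  · exact h c hc hQ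
  · have hP : ∀ l ∈ c, l.1 ∈ P := fun l hl =>
      (List.mem_append.mp (hN c hc l hl)).resolve_right fun h' => hQ ⟨l, hl, h'⟩
    have hr : restrict P c = [] := by
      rw [List.eq_nil_iff_forall_not_mem]
      intro l hl
      rw [mem_restrict] at hl
      exact hl.2 (hP l hl.1)
    have key : ∀ a, [] ∉ residual N P a → ¬ Unsat P c a := fun a ha hu =>
      ha (List.mem_map.mpr ⟨c, List.mem_filter.mpr ⟨hc, by simpa using hu⟩, hr⟩)
    exact iff_of_false (key a ha) (key a' ha')

/-- Apart from `([], [[]])`, a state is determined by the number of variables that remain to be read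
and by `m` bits. -/
theorem IsNarrow.length_le {N : List Cl} {σ : List Var} {m : ℕ} (h : IsNarrow N σ m)
    (hN : ∀ c ∈ N, ∀ l ∈ c, l.1 ∈ σ) {A : List State} (hA : A.Nodup)
    (hA' : ∀ S ∈ A, S.Arises N σ) : A.length ≤ 1 + (σ.length + 1) * 2 ^ m := by
  classical
  have h0 : ∀ P : List Var, ∃ q : List ((Var → Bool) → Bool), ∀ Q, σ = P ++ Q → q.length ≤ m ∧
      ∀ c ∈ N, (∃ l ∈ c, l.1 ∈ Q) → Determines q (Unsat P c) := by
    intro P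
    by_cases hP : ∃ Q, σ = P ++ Q
    · obtain ⟨Q, hQ⟩ := hP
      obtain ⟨q, hq⟩ := h P Q hQ
      refine ⟨q, fun Q' hQ' => ?_⟩
      obtain rfl := List.append_cancel_left (hQ.symm.trans hQ')
      exact hq
    · exact ⟨[], fun Q hQ => (hP ⟨Q, hQ⟩).elim⟩
  choose q hq using h0
  have h1 : ∀ S : State, ∃ (P : List Var) (a : Var → Bool), S ∈ A → S ≠ ([], [[]]) →
      σ = P ++ S.1 ∧ S.2 = residual N P a ∧ [] ∉ residual N P a := by
    intro S
    by_cases hS : S ∈ A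
    · obtain rfl | ⟨P, Q, a, h1, rfl, h2⟩ := hA' S hS
      · exact ⟨[], fun _ => false, fun _ h => (h rfl).elim⟩
      · exact ⟨P, a, fun _ _ => ⟨h1, rfl, h2⟩⟩
    · exact ⟨[], fun _ => false, fun h => (hS h).elim⟩
  choose p a hpa using h1
  have hcard : ((A.toFinset.erase ([], [[]])).card ≤
      (Finset.range (σ.length + 1) ×ˢ (Finset.univ : Finset (Fin m → Bool))).card) := by
    refine Finset.card_le_card_of_injOn (fun S => (S.1.length,
      fun i => (q (p S)).getD i (fun _ => false) (a S))) ?_ ?_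
    · intro S hS
      have hS := Finset.mem_erase.mp (Finset.mem_coe.mp hS)
      have h2 := (hpa S (by simpa using hS.2) hS.1).1
      simp only [Finset.coe_product, Finset.coe_range, Finset.coe_univ, Set.mem_prod, Set.mem_Iio,
        Set.mem_univ, and_true]
      rw [h2, List.length_append]
      omega
    · intro S hS S' hS' he
      have hS := Finset.mem_erase.mp (Finset.mem_coe.mp hS)
      have hS' := Finset.mem_erase.mp (Finset.mem_coe.mp hS')
      obtain ⟨e1, e2, e3⟩ := hpa S (by simpa using hS.2) hS.1
      obtain ⟨e1', e2', e3'⟩ := hpa S' (by simpa using hS'.2) hS'.1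
      rw [Prod.mk.injEq] at he
      obtain ⟨hp, hQ⟩ := List.append_inj' (e1.symm.trans e1') he.1
      obtain ⟨h3, h4⟩ := hq (p S) S.1 e1
      refine Prod.ext hQ ?_
      rw [e2, e2', ← hp]
      rw [← hp] at e3'
      refine residual_eq_residual (Q := S.1) (by rwa [← e1]) (fun c hc hcQ => h4 c hc hcQ _ _ ?_)
        e3 e3'
      intro f hf
      obtain ⟨i, hi, rfl⟩ := List.mem_iff_getElem.mp hf
      have := congrFun he.2 ⟨i, hi.trans_le h3⟩
      simpa [← hp, List.getD_eq_getElem?_getD, hi] using this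
  rw [Finset.card_product, Finset.card_range, Finset.card_univ, Fintype.card_fun,
    Fintype.card_bool, Fintype.card_fin] at hcard
  have h2 := Finset.pred_card_le_card_erase (s := A.toFinset) (a := (([], [[]]) : State))
  rw [List.toFinset_card_of_nodup hA] at h2
  omega

theorem IsNarrow.sz_reach_le {N : List Cl} {σ : List Var} {m : ℕ} (h : IsNarrow N σ m)
    (hσ : σ.Nodup) (hN : ∀ c ∈ N, ∀ l ∈ c, l.1 ∈ σ) (l : List Var) :
    sz (reach (collapse (σ, N)) l) ≤
      1 + (1 + (σ.length + 1) * 2 ^ m) * (sz σ + sz N + 6) := by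
  have hA : ∀ S ∈ reach (collapse (σ, N)) l, S.Arises N σ := by
    refine reach_induction ?_ (fun S S' hS hS' => hS.children hσ hS') l
    have := arises_collapse (N := N) (a := fun _ => false) (List.nil_append σ).symm
    rwa [residual_nil] at this
  have h1 := h.length_le hN (nodup_reach _ l) hA
  have h2 := sz_map_le (f := id) fun S hS => (hA S hS).sz_le
  rw [List.map_id] at h2
  exact h2.trans (Nat.add_le_add_left (Nat.mul_le_mul_right _ h1) _)

/-! ### Stripping and degrees -/

theorem adj_comm (u v : Vtx) : adj u v = adj v u := by
  rcases u with u | u <;> rcases v with v | v <;> rfl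

theorem adj_self (v : Vtx) : adj v v = false := by cases v <;> rfl

@[simp] theorem adj_inl_inr {x : Var} {c : Cl} : adj (.inl x) (.inr c) = true ↔
    ∃ l ∈ c, l.1 = x := by
  simp only [adj, Sum.elim_inl, Sum.elim_inr, isMem_eq_true, List.mem_map]

@[simp] theorem adj_inr_inl {x : Var} {c : Cl} : adj (.inr c) (.inl x) = true ↔
    ∃ l ∈ c, l.1 = x := by rw [adj_comm, adj_inl_inr]

@[simp] theorem adj_inl_inl {x y : Var} : adj (.inl x) (.inl y) = false := rfl
@[simp] theorem adj_inr_inr {c d : Cl} : adj (.inr c) (.inr d) = false := rfl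

/-- The number of neighbours of `v` in `S`. -/
def deg (S : Finset Vtx) (v : Vtx) : ℕ := (S.filter fun u => adj v u = true).card

theorem length_nbrs {R : List Vtx} (hR : R.Nodup) (v : Vtx) :
    (nbrs R v).length = deg R.toFinset v := by
  rw [deg, ← List.toFinset_filter, List.toFinset_card_of_nodup (hR.filter _)]
  rfl

theorem deg_mono {S S' : Finset Vtx} (h : S ⊆ S') (v : Vtx) : deg S v ≤ deg S' v :=
  Finset.card_le_card (Finset.filter_subset_filter _ h)

theorem deg_union_of_disjoint {S S' : Finset Vtx} (h : Disjoint S S') (v : Vtx) :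
    deg (S ∪ S') v = deg S v + deg S' v := by
  rw [deg, Finset.filter_union, Finset.card_union_of_disjoint
    (Finset.disjoint_filter_filter h)]
  rfl

theorem deg_sdiff_add {S S' : Finset Vtx} (h : S' ⊆ S) (v : Vtx) :
    deg S v = deg (S \ S') v + deg S' v := by
  conv_lhs => rw [← Finset.sdiff_union_of_subset h]
  exact deg_union_of_disjoint Finset.sdiff_disjoint v

theorem deg_pos {S : Finset Vtx} {v : Vtx} : 0 < deg S v ↔ ∃ u ∈ S, adj v u = true := by
  rw [deg, Finset.card_pos]
  simp [Finset.Nonempty]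

/-- Every non-empty set of vertices in `Y` has a vertex with at most one neighbour in the set;
that is, `Y` induces a forest. -/
def IsForest (Y : Finset Vtx) : Prop := ∀ S ⊆ Y, S.Nonempty → ∃ v ∈ S, deg S v ≤ 1

theorem IsForest.mono {Y Y' : Finset Vtx} (h : IsForest Y) (h' : Y' ⊆ Y) : IsForest Y' :=
  fun S hS => h S (hS.trans h')

theorem sum_deg_comm (S S' : Finset Vtx) : ∑ v ∈ S, deg S' v = ∑ u ∈ S', deg S u := by
  simp only [deg, Finset.card_filter]
  rw [Finset.sum_comm]
  simp only [adj_comm]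

theorem IsForest.sum_deg_le {Y : Finset Vtx} (h : IsForest Y) : ∑ v ∈ Y, deg Y v ≤ 2 * Y.card := by
  induction Y using Finset.strongInduction with
  | H Y ih =>
    rcases Y.eq_empty_or_nonempty with rfl | hY
    · simp
    · obtain ⟨v, hv, hd⟩ := h Y subset_rfl hY
      have h1 := ih (Y.erase v) (Finset.erase_ssubset hv) (h.mono (Finset.erase_subset _ _))
      have hs : ({v} : Finset Vtx) ⊆ Y := by simpa using hv
      have h2 : ∀ u, deg Y u = deg (Y.erase v) u + deg {v} u := fun u => by
        rw [deg_sdiff_add hs, Finset.sdiff_singleton_eq_erase]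
      have h3 : deg {v} v = 0 := by simp [deg, adj_self]
      have h4 : ∑ u ∈ Y.erase v, deg {v} u = deg (Y.erase v) v := by
        rw [sum_deg_comm]; simp
      have h5 := Finset.card_erase_add_one hv
      rw [← Finset.add_sum_erase Y _ hv]
      simp only [h2 _, Finset.sum_add_distrib, h4, h3] at hd ⊢
      omega

/-- The degrees outside a feedback vertex set `X` are bounded by the degrees in `X`. -/
theorem IsForest.sum_deg_sdiff_le {K X : Finset Vtx} (h : IsForest (K \ X)) :
    ∑ v ∈ K \ X, deg K v ≤ 2 * (K \ X).card + ∑ x ∈ K ∩ X, deg K x := by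
  have h1 : ∀ v, deg K v = deg (K \ X) v + deg (K ∩ X) v := fun v => by
    rw [deg_sdiff_add (Finset.inter_subset_left (s₁ := K) (s₂ := X)), Finset.sdiff_inter_self_left]
  calc ∑ v ∈ K \ X, deg K v = ∑ v ∈ K \ X, deg (K \ X) v + ∑ v ∈ K \ X, deg (K ∩ X) v := by
        rw [← Finset.sum_add_distrib]
        exact Finset.sum_congr rfl fun v _ => h1 v
    _ ≤ _ := by
        refine Nat.add_le_add h.sum_deg_le ?_
        rw [sum_deg_comm]
        exact Finset.sum_le_sum fun x _ => deg_mono Finset.sdiff_subset x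

theorem card_mul_add_le_sum_deg {Y W : Finset Vtx} {f : Vtx → ℕ} {d : ℕ} (hW : W ⊆ Y)
    (h2 : ∀ v ∈ Y, 2 ≤ f v) (hd : ∀ v ∈ W, d + 2 ≤ f v) :
    W.card * d + 2 * Y.card ≤ ∑ v ∈ Y, f v := by
  have h : ∑ v ∈ Y, ((if v ∈ W then d else 0) + 2) ≤ ∑ v ∈ Y, f v := by
    refine Finset.sum_le_sum fun v hv => ?_
    split_ifs with h'
    · exact hd v h'
    · have := h2 v hv
      omega
  rw [Finset.sum_add_distrib, Finset.sum_ite_mem, Finset.inter_eq_right.mpr hW,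
    Finset.sum_const, Finset.sum_const, smul_eq_mul, smul_eq_mul] at h
  omega

/-- Let `K` have minimum degree at least two, let `X` be a feedback vertex set of `K`, and let `T`
contain each vertex whose degree is exceeded or attained by at most `j` vertices, where
`j ≥ 4 |K ∩ X|`. If `T` misses `X`, then all vertices that are not in `T` have degree two:
otherwise, the vertices of large degree outside `X` would create more edges than a forest and the
edges at `X` allow. -/
theorem deg_eq_two_of_disjoint {K X T : Finset Vtx} {j : ℕ} (hK : ∀ v ∈ K, 2 ≤ deg K v)
    (hX : IsForest (K \ X)) (hj : 4 * (K ∩ X).card ≤ j)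
    (hT : ∀ v ∈ K, (K.filter fun u => deg K v ≤ deg K u).card ≤ j → v ∈ T)
    (hd : ∀ x ∈ K ∩ X, x ∉ T) : ∀ v ∈ K, v ∉ T → deg K v = 2 := by
  have hsum := hX.sum_deg_sdiff_le
  have hY : ∀ v ∈ K \ X, 2 ≤ deg K v := fun v hv => hK v (Finset.mem_sdiff.mp hv).1
  have hX2 : ∀ x ∈ K ∩ X, deg K x ≤ 2 := by
    by_contra! hne
    obtain ⟨y, hy, hy3⟩ := hne
    obtain ⟨x, hx, hmax⟩ := Finset.exists_max_image (K ∩ X) (deg K) ⟨y, hy⟩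
    obtain ⟨e, he⟩ := Nat.exists_eq_add_of_le (show 3 ≤ deg K x from hy3.trans_le (hmax y hy))
    have hxK := (Finset.mem_inter.mp hx).1
    have h1 : j < (K.filter fun u => deg K x ≤ deg K u).card := by
      by_contra h
      exact hd x hx (hT x hxK (not_lt.mp h))
    have h2 : K.filter (fun u => deg K x ≤ deg K u) ⊆
        (K \ X).filter (fun u => deg K x ≤ deg K u) ∪ K ∩ X := by
      intro u hu
      simp only [Finset.mem_filter, Finset.mem_union, Finset.mem_sdiff, Finset.mem_inter] at *
      tauto
    have h3 := (Finset.card_le_card h2).trans (Finset.card_union_le _ _)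
    set W := (K \ X).filter (fun u => deg K x ≤ deg K u) with hW
    have h4 := card_mul_add_le_sum_deg (f := deg K) (d := e + 1)
      (Finset.filter_subset _ _ : W ⊆ K \ X) hY fun v hv => by
        have := (Finset.mem_filter.mp hv).2
        omega
    rw [← hW] at h4
    have h5 : ∑ x ∈ K ∩ X, deg K x ≤ (K ∩ X).card * (e + 3) := by
      refine (Finset.sum_le_card_nsmul _ _ (deg K x) hmax).trans ?_
      rw [smul_eq_mul, he, add_comm 3 e]
    have h6 : (3 * (K ∩ X).card + 1) * (e + 1) ≤ W.card * (e + 1) :=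
      Nat.mul_le_mul_right _ (by omega)
    have h7 : (3 * (K ∩ X).card + 1) * (e + 1) ≤ (K ∩ X).card * (e + 3) := by omega
    nlinarith
  have h1 : ∑ x ∈ K ∩ X, deg K x ≤ (K ∩ X).card * 2 := Finset.sum_le_card_nsmul _ _ 2 hX2
  have h2 := card_mul_add_le_sum_deg (f := deg K) (d := 1)
    (Finset.filter_subset (fun u => 3 ≤ deg K u) (K \ X)) hY fun v hv => (Finset.mem_filter.mp hv).2
  intro v hv hvT
  by_contra h
  have h3 : 3 ≤ deg K v := by have := hK v hv; omega
  refine hvT (hT v hv (le_trans (Finset.card_le_card (t := (K \ X).filter fun u => 3 ≤ deg K u) ?_)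
    (by omega)))
  intro u hu
  obtain ⟨hu, hu'⟩ := Finset.mem_filter.mp hu
  refine Finset.mem_filter.mpr ⟨Finset.mem_sdiff.mpr ⟨hu, fun huX => ?_⟩, h3.trans hu'⟩
  have := hX2 u (Finset.mem_inter.mpr ⟨hu, huX⟩)
  omega

/-- Under the same assumptions, the deletion of `T` leaves fewer vertices of `X` in the core. -/
theorem card_inter_lt {K K' X T : Finset Vtx} {j : ℕ} (hK : ∀ v ∈ K, 2 ≤ deg K v)
    (hX : IsForest (K \ X)) (hj : 4 * (K ∩ X).card ≤ j)
    (hT : ∀ v ∈ K, (K.filter fun u => deg K v ≤ deg K u).card ≤ j → v ∈ T)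
    (hTK : (T ∩ K).Nonempty) (hK' : K' ⊆ K \ T) (hK'2 : ∀ v ∈ K', 2 ≤ deg K' v) :
    (K' ∩ X).card < (K ∩ X).card := by
  have hsub : K' ∩ X ⊆ K ∩ X := fun v hv => by
    have := hK' (Finset.mem_inter.mp hv).1
    simp only [Finset.mem_inter, Finset.mem_sdiff] at *
    tauto
  refine Finset.card_lt_card (hsub.ssubset_of_ne fun heq => ?_)
  have h2 := deg_eq_two_of_disjoint hK hX hj hT fun x hx hxT => by
    rw [← heq] at hx
    exact (Finset.mem_sdiff.mp (hK' (Finset.mem_inter.mp hx).1)).2 hxT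
  have hK'K : K' ⊆ K := hK'.trans Finset.sdiff_subset
  have hne : (K \ K').Nonempty := by
    obtain ⟨t, ht⟩ := hTK
    obtain ⟨h3, h4⟩ := Finset.mem_inter.mp ht
    exact ⟨t, Finset.mem_sdiff.mpr ⟨h4, fun h5 => (Finset.mem_sdiff.mp (hK' h5)).2 h3⟩⟩
  have hsub' : K \ K' ⊆ K \ X := by
    intro v hv
    obtain ⟨h3, h4⟩ := Finset.mem_sdiff.mp hv
    refine Finset.mem_sdiff.mpr ⟨h3, fun h5 => h4 ?_⟩
    have : v ∈ K' ∩ X := by rw [heq]; exact Finset.mem_inter.mpr ⟨h3, h5⟩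
    exact (Finset.mem_inter.mp this).1
  obtain ⟨z, hz, hz1⟩ := hX _ hsub' hne
  obtain ⟨hzK, hzK'⟩ := Finset.mem_sdiff.mp hz
  have h3 := hK z hzK
  rw [deg_sdiff_add hK'K] at h3
  obtain ⟨u, hu, hzu⟩ := deg_pos.mp (show 0 < deg K' z by omega)
  have h4 := hK'2 u hu
  have h5 := h2 u (hK'K hu) (Finset.mem_sdiff.mp (hK' hu)).2
  rw [deg_sdiff_add hK'K] at h5
  have h6 : 0 < deg (K \ K') u := deg_pos.mpr ⟨z, hz, by rw [adj_comm]; exact hzu⟩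
  omega

/-! ### The core and the feedback vertex set -/

theorem stripStep_cases (E : List (Vtx × List Var) × List Var) :
    (stripStep E = E ∧ ∀ v ∈ E.1.map Prod.fst, 1 < (nbrs (E.1.map Prod.fst) v).length) ∨
    ∃ e ∈ E.1, (nbrs (E.1.map Prod.fst) e.1).length ≤ 1 ∧ stripStep E =
      ((E.1.filter fun f => !decide (f.1 = e.1)).map fun f =>
          bif adj e.1 f.1 then (f.1, merge f.2 (pre e.1 ++ e.2)) else f,
        bif (nbrs (E.1.map Prod.fst) e.1).isEmpty then E.2 ++ (pre e.1 ++ e.2) else E.2) := by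
  unfold stripStep
  cases h : E.1.filter fun e => lengthLE (nbrs (E.1.map Prod.fst) e.1) [()] with
  | nil =>
    refine .inl ⟨rfl, fun v hv => ?_⟩
    obtain ⟨e, he, rfl⟩ := List.mem_map.mp hv
    rw [List.filter_eq_nil_iff] at h
    have := h e he
    rw [lengthLE_iff] at this
    simpa using this
  | cons e l =>
    have he : e ∈ E.1.filter fun e => lengthLE (nbrs (E.1.map Prod.fst) e.1) [()] := by simp [h]
    obtain ⟨heE, hle⟩ := List.mem_filter.mp he
    rw [lengthLE_iff] at hle
    exact .inr ⟨e, heE, hle, rfl⟩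

theorem map_fst_update (a : Vtx) (b : List Var) (E : List (Vtx × List Var)) :
    (E.map fun f => bif adj a f.1 then (f.1, merge f.2 b) else f).map Prod.fst =
      E.map Prod.fst := by
  rw [List.map_map]
  refine List.map_congr_left fun f _ => ?_
  simp only [Function.comp]
  cases adj a f.1 <;> rfl

theorem map_fst_filter_ne (v : Vtx) (E : List (Vtx × List Var)) :
    (E.filter fun f => !decide (f.1 = v)).map Prod.fst =
      (E.map Prod.fst).filter fun u => !decide (u = v) := by
  rw [List.filter_map]
  rfl

theorem stripStep_verts (E : List (Vtx × List Var) × List Var) :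
    (stripStep E = E ∧ ∀ v ∈ E.1.map Prod.fst, 1 < (nbrs (E.1.map Prod.fst) v).length) ∨
    ∃ v ∈ E.1.map Prod.fst, (nbrs (E.1.map Prod.fst) v).length ≤ 1 ∧
      (stripStep E).1.map Prod.fst = (E.1.map Prod.fst).filter fun u => !decide (u = v) := by
  obtain h | ⟨e, he, h1, h2⟩ := stripStep_cases E
  · exact .inl h
  · refine .inr ⟨e.1, List.mem_map_of_mem he, h1, ?_⟩
    rw [h2, map_fst_update, map_fst_filter_ne]

theorem nodup_core {R : List Vtx} (hR : R.Nodup) : (core R).Nodup := hR.sublist (core_sublist R)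

theorem two_le_deg_core {R : List Vtx} (hR : R.Nodup) :
    ∀ v ∈ (core R).toFinset, 2 ≤ deg (core R).toFinset v := by
  have h : ∀ (l : List Vtx) (E : List (Vtx × List Var) × List Var), E.1.length ≤ l.length →
      ∀ v ∈ (l.foldl (fun E _ => stripStep E) E).1.map Prod.fst,
        1 < (nbrs ((l.foldl (fun E _ => stripStep E) E).1.map Prod.fst) v).length := by
    intro l
    induction l with
    | nil =>
      intro E hE v hv
      rw [List.foldl_nil, List.eq_nil_of_length_eq_zero (Nat.le_zero.mp hE)] at hv
      simp at hv
    | cons a l ih =>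
      intro E hE
      obtain ⟨h1, h2⟩ | ⟨v, hv, _, h2⟩ := stripStep_verts E
      · have h3 : ∀ l : List Vtx, l.foldl (fun E _ => stripStep E) E = E := by
          intro l
          induction l with
          | nil => rfl
          | cons a l ih' => rw [List.foldl_cons, h1, ih']
        rw [h3]
        exact h2
      · rw [List.foldl_cons]
        refine ih _ ?_
        have h3 : ((E.1.map Prod.fst).filter fun u => !decide (u = v)).length <
            (E.1.map Prod.fst).length := by
          rw [List.length_filter_lt_length_iff_exists]
          exact ⟨v, hv, by simp⟩
        rw [← h2, List.length_map, List.length_map] at h3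
        simp only [List.length_cons] at hE
        omega
  intro v hv
  rw [← length_nbrs (nodup_core hR)]
  exact h R (R.map fun v => (v, []), []) (by simp) v (List.mem_toFinset.mp hv)

/-- The core is the largest set of vertices of minimum degree at least two. -/
theorem subset_core {R : List Vtx} (hR : R.Nodup) {S : Finset Vtx} (hS : S ⊆ R.toFinset)
    (h2 : ∀ v ∈ S, 2 ≤ deg S v) : S ⊆ (core R).toFinset := by
  have h : ∀ (l : List Vtx) (E : List (Vtx × List Var) × List Var), (E.1.map Prod.fst).Nodup →
      S ⊆ (E.1.map Prod.fst).toFinset →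
      S ⊆ ((l.foldl (fun E _ => stripStep E) E).1.map Prod.fst).toFinset := by
    intro l
    induction l with
    | nil => exact fun E _ h => h
    | cons a l ih =>
      intro E hE h
      rw [List.foldl_cons]
      refine ih _ (hE.sublist (stripStep_sublist E)) ?_
      obtain ⟨h1, -⟩ | ⟨v, hv, hv1, h1⟩ := stripStep_verts E
      · rwa [h1]
      · rw [h1]
        intro u hu
        rw [List.mem_toFinset, List.mem_filter]
        refine ⟨List.mem_toFinset.mp (h hu), ?_⟩
        have : u ≠ v := by
          rintro rfl
          have h3 := h2 u hu
          rw [length_nbrs hE] at hv1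
          have := deg_mono h u
          omega
        simpa using this
  have := h R (R.map fun v => (v, []), []) (by simpa [Function.comp_def] using hR)
    (by simpa [Function.comp_def] using hS)
  exact this

theorem core_subset (R : List Vtx) : (core R).toFinset ⊆ R.toFinset := by
  intro v hv
  rw [List.mem_toFinset] at *
  exact (core_sublist R).subset hv

theorem mem_select {j : List Unit} {K : List Vtx} (hK : K.Nodup) {v : Vtx} (hv : v ∈ K.toFinset)
    (h : (K.toFinset.filter fun u => deg K.toFinset v ≤ deg K.toFinset u).card ≤ j.length) :
    v ∈ select j K := by
  have hmem : v ∈ K.filter fun v => lengthLE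
      (K.filter fun u => lengthLE (nbrs K v) (nbrs K u)) j := by
    refine List.mem_filter.mpr ⟨List.mem_toFinset.mp hv, ?_⟩
    rw [lengthLE_iff, ← List.toFinset_card_of_nodup (hK.filter _), List.toFinset_filter]
    refine le_trans (le_of_eq ?_) h
    congr 1
    refine Finset.filter_congr fun u _ => ?_
    rw [lengthLE_iff, length_nbrs hK, length_nbrs hK]
  unfold select
  cases hs : K.filter fun v => lengthLE (K.filter fun u => lengthLE (nbrs K v) (nbrs K u)) j with
  | nil => rw [hs] at hmem; cases hmem
  | cons w l => rwa [hs] at hmem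

theorem select_ne_nil {j : List Unit} {K : List Vtx} (hK : K ≠ []) : select j K ≠ [] := by
  unfold select
  cases hs : K.filter fun v => lengthLE (K.filter fun u => lengthLE (nbrs K v) (nbrs K u)) j with
  | nil =>
    cases K with
    | nil => exact (hK rfl).elim
    | cons a K => simp
  | cons w l => simp

theorem length_select_le {j : List Unit} {K : List Vtx} (hK : K.Nodup) :
    (select j K).length ≤ j.length + 1 := by
  unfold select
  cases hs : K.filter fun v => lengthLE (K.filter fun u => lengthLE (nbrs K v) (nbrs K u)) j with
  | nil => simp
  | cons w l =>
    rw [listCase_cons, ← hs]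
    set S := K.filter fun v => lengthLE (K.filter fun u => lengthLE (nbrs K v) (nbrs K u)) j
    -- The degree of a selected vertex of least degree is exceeded or attained by all selected ones.
    have hne : S.toFinset.Nonempty := ⟨w, by rw [hs]; simp⟩
    obtain ⟨v, hv, hmin⟩ := Finset.exists_min_image S.toFinset (fun v => (nbrs K v).length) hne
    have h1 := (List.mem_filter.mp (List.mem_toFinset.mp hv)).2
    rw [lengthLE_iff] at h1
    refine le_trans ?_ (h1.trans (Nat.le_succ _))
    rw [← List.toFinset_card_of_nodup (hK.filter _), ← List.toFinset_card_of_nodup (hK.filter _)]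
    refine Finset.card_le_card fun u hu => ?_
    rw [List.mem_toFinset, List.mem_filter, lengthLE_iff]
    exact ⟨(List.mem_filter.mp (List.mem_toFinset.mp hu)).1, hmin u hu⟩

theorem core_eq_nil {R : List Vtx} (hR : R.Nodup) (h : IsForest (core R).toFinset) :
    core R = [] := by
  by_contra hne
  obtain ⟨v, hv, h1⟩ := h _ subset_rfl (List.toFinset_nonempty_iff _ |>.mpr hne)
  have := two_le_deg_core hR v hv
  omega

section Rounds

variable {G : List Vtx} {X : Finset Vtx} {k : ℕ}

/-- The deleted vertices after as many rounds as `l` is long. -/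
def rounds (G l : List Vtx) : List Vtx × List Unit := l.foldl (fun T _ => fvsStep G T) ([], [])

/-- The vertices that are left after the deletion of `T`. -/
def remaining (G T : List Vtx) : List Vtx := G.filter fun v => !isMem v T

theorem mem_remaining {G T : List Vtx} {v : Vtx} : v ∈ remaining G T ↔ v ∈ G ∧ v ∉ T := by
  simp [remaining]

theorem rounds_append (l : List Vtx) (v : Vtx) : rounds G (l ++ [v]) =
    ((rounds G l).1 ++ select (rounds G l).2 (core (remaining G (rounds G l).1)),
      () :: (rounds G l).2) := by
  simp [rounds, fvsStep, remaining]

theorem length_rounds_snd (l : List Vtx) : (rounds G l).2.length = l.length := by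
  induction l using List.reverseRecOn with
  | nil => rfl
  | append_singleton l v ih => rw [rounds_append]; simp [ih]

theorem core_remaining_append (hG : G.Nodup) (T T' : List Vtx) :
    (core (remaining G (T ++ T'))).toFinset ⊆
      (core (remaining G T)).toFinset \ T'.toFinset := by
  have hnd : (remaining G (T ++ T')).Nodup := hG.filter _
  have h1 := core_subset (remaining G (T ++ T'))
  intro v hv
  have h2 := h1 hv
  rw [List.mem_toFinset, mem_remaining, List.mem_append, not_or] at h2
  rw [Finset.mem_sdiff, List.mem_toFinset (l := T')]
  refine ⟨subset_core (hG.filter _) (fun u hu => ?_) (two_le_deg_core hnd) hv, h2.2.2⟩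
  have h3 := h1 hu
  rw [List.mem_toFinset, mem_remaining, List.mem_append, not_or] at h3
  rw [List.mem_toFinset]
  exact mem_remaining.mpr ⟨h3.1, h3.2.1⟩

theorem isForest_core_sdiff (hX : IsForest (G.toFinset \ X)) (T : List Vtx) :
    IsForest ((core (remaining G T)).toFinset \ X) := by
  refine hX.mono fun v hv => ?_
  rw [Finset.mem_sdiff] at *
  have := core_subset _ hv.1
  rw [List.mem_toFinset, mem_remaining] at this
  exact ⟨List.mem_toFinset.mpr this.1, hv.2⟩

/-- From round `4 * k` on, each round removes a vertex of `X` from the core, as long as the core is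
not empty. -/
theorem card_core_inter_le (hG : G.Nodup) (hX : IsForest (G.toFinset \ X)) (hk : X.card ≤ k)
    (l : List Vtx) : ((core (remaining G (rounds G l).1)).toFinset ∩ X).card ≤ k ∧
      (4 * k ≤ l.length →
        ((core (remaining G (rounds G l).1)).toFinset ∩ X).card ≤ 5 * k - l.length) := by
  have h0 : ∀ K : Finset Vtx, (K ∩ X).card ≤ k := fun K =>
    (Finset.card_le_card Finset.inter_subset_right).trans hk
  refine ⟨h0 _, ?_⟩
  induction l using List.reverseRecOn with
  | nil =>
    intro h
    exact (h0 _).trans (by simp at h; simp [h])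
  | append_singleton l v ih =>
    intro h
    simp only [List.length_append, List.length_singleton] at h ⊢
    rcases Nat.lt_or_ge l.length (4 * k) with hl | hl
    · exact (h0 _).trans (by omega)
    · have h1 := ih hl
      rw [rounds_append]
      set T := (rounds G l).1
      have hnd : (remaining G T).Nodup := hG.filter _
      have hsub := core_remaining_append hG T (select (rounds G l).2 (core (remaining G T)))
      by_cases hK : core (remaining G T) = []
      · rw [hK] at hsub
        have : (core (remaining G (T ++ select (rounds G l).2 (core (remaining G T))))).toFinset =
            ∅ := by
          rw [hK]
          exact Finset.subset_empty.mp (hsub.trans (by simp))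
        dsimp only
        rw [this]
        simp
      · have h2 := card_inter_lt (T := (select (rounds G l).2 (core (remaining G T))).toFinset)
          (j := l.length) (two_le_deg_core hnd) (isForest_core_sdiff hX T)
          ((Nat.mul_le_mul_left 4 (h0 _)).trans hl)
          (fun v hv hle => List.mem_toFinset.mpr (mem_select (nodup_core hnd) hv
            (by rwa [length_rounds_snd])))
          (by
            obtain ⟨w, hw⟩ := List.exists_mem_of_ne_nil _ (select_ne_nil (j := (rounds G l).2) hK)
            exact ⟨w, Finset.mem_inter.mpr ⟨List.mem_toFinset.mpr hw,
              List.mem_toFinset.mpr ((select_sublist _ _).subset hw)⟩⟩)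
          hsub (two_le_deg_core (hG.filter _))
        dsimp only
        omega

/-- In each of the first `5 * k` rounds at most `5 * k` vertices are deleted; then the core contains
no vertex of `X`, and so it is empty. -/
theorem length_rounds_fst_le (hG : G.Nodup) (hX : IsForest (G.toFinset \ X)) (hk : X.card ≤ k)
    (l : List Vtx) : (rounds G l).1.length ≤ 5 * k * (5 * k) := by
  have h : (rounds G l).1.length ≤ min l.length (5 * k) * (5 * k) := by
    induction l using List.reverseRecOn with
    | nil => simp [rounds]
    | append_singleton l v ih =>
      rw [rounds_append, List.length_append, List.length_append, List.length_singleton]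
      have hnd : (remaining G (rounds G l).1).Nodup := hG.filter _
      rcases Nat.lt_or_ge l.length (5 * k) with hl | hl
      · have h1 := length_select_le (j := (rounds G l).2) (nodup_core hnd)
        rw [length_rounds_snd] at h1
        rw [min_eq_left hl.le] at ih
        rw [min_eq_left (by omega), add_mul, one_mul]
        omega
      · have h1 := (card_core_inter_le hG hX hk l).2 (by omega)
        rw [Nat.sub_eq_zero_of_le hl, Nat.le_zero, Finset.card_eq_zero,
          ← Finset.disjoint_iff_inter_eq_empty] at h1
        have h2 : core (remaining G (rounds G l).1) = [] := by
          refine core_eq_nil hnd ?_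
          rw [← Finset.sdiff_eq_self_of_disjoint h1]
          exact isForest_core_sdiff hX _
        rw [h2, min_eq_right (by omega)]
        rw [min_eq_right hl] at ih
        simpa [select] using ih
  exact h.trans (Nat.mul_le_mul_right _ (min_le_right _ _))

/-- The vertices of the feedback vertex set are few if the graph has a small feedback vertex
set. -/
theorem length_fvs_le (hG : G.Nodup) (hX : IsForest (G.toFinset \ X)) (hk : X.card ≤ k) :
    (fvs G).length ≤ 5 * k * (5 * k) := length_rounds_fst_le hG hX hk G

/-- Each round deletes another vertex as long as the core is not empty, so the core is empty after
as many rounds as there are vertices. -/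
theorem core_remaining_fvs (hG : G.Nodup) : core (remaining G (fvs G)) = [] := by
  have h : ∀ l : List Vtx, (rounds G l).1 ⊆ G ∧ (rounds G l).1.Nodup ∧
      (core (remaining G (rounds G l).1) ≠ [] → l.length ≤ (rounds G l).1.length) := by
    intro l
    induction l using List.reverseRecOn with
    | nil => simp [rounds]
    | append_singleton l v ih =>
      rw [rounds_append]
      set T := (rounds G l).1
      have h1 : ∀ u ∈ select (rounds G l).2 (core (remaining G T)), u ∈ G ∧ u ∉ T := fun u hu =>
        mem_remaining.mp ((core_sublist _).subset ((select_sublist _ _).subset hu))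
      refine ⟨List.append_subset.mpr ⟨ih.1, fun u hu => (h1 u hu).1⟩, ?_, fun hne => ?_⟩
      · refine List.nodup_append.mpr ⟨ih.2.1, (nodup_core (hG.filter _)).sublist
          (select_sublist _ _), fun a ha b hb hab => (h1 b hb).2 (hab ▸ ha)⟩
      · have h2 : core (remaining G T) ≠ [] := by
          intro h2
          have h3 := core_remaining_append hG T (select (rounds G l).2 (core (remaining G T)))
          rw [show (core (remaining G T)).toFinset = ∅ by rw [h2]; rfl] at h3
          have h4 := Finset.subset_empty.mp (h3.trans (by simp))
          rw [List.toFinset_eq_empty_iff] at h4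
          exact hne h4
        have h3 := ih.2.2 h2
        have h4 := List.length_pos_of_ne_nil (select_ne_nil (j := (rounds G l).2) h2)
        simp only [List.length_append, List.length_singleton]
        omega
  obtain ⟨h1, h2, h3⟩ := h G
  by_contra hne
  have h4 := h3 hne
  have h5 : (rounds G G).1.toFinset = G.toFinset := by
    refine Finset.eq_of_subset_of_card_le (fun v hv => ?_) ?_
    · rw [List.mem_toFinset] at *
      exact h1 hv
    · rw [List.toFinset_card_of_nodup h2, List.toFinset_card_of_nodup hG]
      exact h4
  obtain ⟨v, hv⟩ := List.exists_mem_of_ne_nil _ hne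
  have h6 := mem_remaining.mp ((core_sublist _).subset hv)
  refine h6.2 (List.mem_toFinset.mp ?_)
  change v ∈ (rounds G G).1.toFinset
  rw [h5]
  exact List.mem_toFinset.mpr h6.1

end Rounds

/-! ### The width of the forest order -/

theorem Unsat.iff_of_append_left {p P : List Var} {c : Cl} {a : Var → Bool}
    (h : ∀ l ∈ c, l.1 ∉ p) : Unsat (p ++ P) c a ↔ Unsat P c a :=
  forall₂_congr fun l hl => by rw [List.mem_append, or_iff_right (h l hl)]

theorem Determines.congr {q : List ((Var → Bool) → Bool)} {p p' : (Var → Bool) → Prop}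
    (h : Determines q p) (h' : ∀ a, p' a ↔ p a) : Determines q p' :=
  fun a a' ha => by rw [h', h', h a a' ha]

theorem Determines.mono {q q' : List ((Var → Bool) → Bool)} {p : (Var → Bool) → Prop}
    (h : Determines q p) (h' : q ⊆ q') : Determines q' p :=
  fun a a' ha => h a a' fun f hf => ha f (h' hf)

theorem determines_of_forall {q : List ((Var → Bool) → Bool)} {p : (Var → Bool) → Prop}
    (h : ∀ a, p a) : Determines q p := fun _ _ _ => iff_of_true (h _) (h _)

theorem determines_unsat (P : List Var) (c : Cl) :
    Determines (P.map fun x a => a x) (Unsat P c) := fun _ _ ha =>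
  Unsat.congr fun x hx => ha _ (List.mem_map.mpr ⟨x, hx, rfl⟩)

/-- `L` is the list of the variables that hang on a vertex of a forest, and `D` is the set of the
clauses that hang on it. The variables in `p` have been read before; `o Q` is the number of bits
that are reserved for the vertex itself when the variables in `Q` remain to be read. The number of
bits needed in addition, for the clauses in `D`, is at most logarithmic in the length of `L`. -/
def Width (p : List Var) (o : List Var → ℕ) (L : List Var) (D : Set Cl) : Prop :=
  ∀ P Q, L = P ++ Q → Q ≠ [] → ∃ q : List ((Var → Bool) → Bool),
    2 ^ (q.length + o Q) ≤ 2 * L.length ∧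
      ∀ c ∈ D, (∃ l ∈ c, l.1 ∈ Q) → Determines q (Unsat (p ++ P) c)

/-- When two lists are concatenated, one more bit may be needed while the first list is being read.
The bound is maintained if the first list is the shorter one. -/
theorem Width.append {p S B : List Var} {o : List Var → ℕ} {D D' : Set Cl} {n : ℕ}
    (hS : Width p o S D) (hB : Width p o B D') (hn : ∀ Q, p.length + o Q ≤ n)
    (hlen : 2 ^ n * S.length ≤ S.length + B.length) (hD : ∀ c ∈ D, ∀ l ∈ c, l.1 ∉ B)
    (hD' : ∀ c ∈ D', ∀ l ∈ c, l.1 ∉ S) : Width p o (S ++ B) (D ∪ D') := by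
  intro P Q hPQ hQ
  have second : ∀ P', P = S ++ P' → B = P' ++ Q → ∃ q : List ((Var → Bool) → Bool),
      2 ^ (q.length + o Q) ≤ 2 * (S ++ B).length ∧
      ∀ c ∈ D ∪ D', (∃ l ∈ c, l.1 ∈ Q) → Determines q (Unsat (p ++ P) c) := by
    rintro P' rfl rfl
    obtain ⟨q, hq, hq'⟩ := hB P' Q rfl hQ
    refine ⟨q, hq.trans (by simp), ?_⟩
    rintro c (hc | hc) ⟨l, hl, hlQ⟩
    · exact (hD c hc l hl (by simp [hlQ])).elim
    · refine (hq' c hc ⟨l, hl, hlQ⟩).congr fun a => forall₂_congr fun l hl => ?_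
      have := hD' c hc l hl
      simp [this]
  rcases List.append_eq_append_iff.mp hPQ with ⟨P', h1, h2⟩ | ⟨Q', h1, h2⟩
  · exact second P' h1 h2
  · rcases eq_or_ne Q' [] with rfl | hQ'
    · exact second [] (by simpa using h1.symm) (by simpa using h2.symm)
    · subst h1 h2
      obtain ⟨q, hq, hq'⟩ := hS P Q' rfl hQ'
      refine ⟨q ++ p.map fun x (a : Var → Bool) => a x, ?_, ?_⟩
      · have h3 : 2 ^ q.length ≤ 2 * (P ++ Q').length :=
          (Nat.pow_le_pow_right (by omega) (Nat.le_add_right _ _)).trans hq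
        calc 2 ^ ((q ++ p.map fun x (a : Var → Bool) => a x).length + o (Q' ++ B))
            ≤ 2 ^ (q.length + n) := Nat.pow_le_pow_right (by omega) (by
              have := hn (Q' ++ B)
              simp only [List.length_append, List.length_map]
              omega)
          _ = 2 ^ q.length * 2 ^ n := pow_add _ _ _
          _ ≤ 2 * (P ++ Q').length * 2 ^ n := Nat.mul_le_mul_right _ h3
          _ = 2 * (2 ^ n * (P ++ Q').length) := by ring
          _ ≤ 2 * (P ++ Q' ++ B).length := by
              rw [List.length_append (bs := B)]
              exact Nat.mul_le_mul_left 2 hlen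
      · rintro c (hc | hc) ⟨l, hl, hlQ⟩
        · refine (hq' c hc ⟨l, hl, ?_⟩).mono (by simp)
          exact (List.mem_append.mp hlQ).resolve_right (hD c hc l hl)
        · refine ((determines_unsat p c).mono (q' := q ++ p.map fun x a => a x) (by simp)).congr
            fun a => forall₂_congr fun l hl => ?_
          have := hD' c hc l hl
          rw [List.mem_append, not_or] at this
          simp [this.1]

open Classical in
/-- One bit is reserved for a clause that has a literal over a variable in `Q`. -/
noncomputable def openBit (v : Vtx) (Q : List Var) : ℕ :=
  Sum.elim (fun _ => 0) (fun c => if ∃ l ∈ c, l.1 ∈ Q then 1 else 0) v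

theorem length_pre_add_openBit_le (v : Vtx) (Q : List Var) : (pre v).length + openBit v Q ≤ 1 := by
  rcases v with x | c
  · simp [pre, openBit]
  · simp only [pre, openBit, Sum.elim_inr, List.length_nil, zero_add]
    split_ifs <;> omega

/-- The variable list and the clauses of a vertex, together with the vertex itself, are attached to
another vertex. -/
theorem Width.close {v : Vtx} {L p : List Var} {o : List Var → ℕ} {D : Set Cl}
    (h : Width (pre v) (openBit v) L D) (hp : ∀ c ∈ D, ∀ l ∈ c, l.1 ∉ p)
    (ho : ∀ Q ⊆ L, o Q = 0) (ho' : ∀ Q, o Q ≤ 1) :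
    Width p o (pre v ++ L) (D ∪ {c | v = .inr c}) := by
  rcases v with x | d
  · rw [show D ∪ {c | (Sum.inl x : Vtx) = .inr c} = D by simp]
    intro P Q hPQ hQ
    cases P with
    | nil =>
      refine ⟨[], ?_, fun c hc _ => determines_of_forall fun a l hl hlp => ?_⟩
      · have := Nat.pow_le_pow_right (n := 2) (by omega) (ho' Q)
        simp only [pre, Sum.elim_inl, List.length_append, List.length_cons, List.length_nil,
          zero_add]
        omega
      · rw [List.append_nil] at hlp
        exact (hp c hc l hl hlp).elim
    | cons y P =>
      simp only [pre, Sum.elim_inl, List.cons_append, List.nil_append,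
        List.cons.injEq] at hPQ
      obtain ⟨rfl, rfl⟩ := hPQ
      obtain ⟨q, hq, hq'⟩ := h P Q rfl hQ
      refine ⟨q, ?_, fun c hc hcQ => (hq' c hc hcQ).congr fun a =>
        Unsat.iff_of_append_left (hp c hc)⟩
      rw [ho Q (by simp)]
      refine ((Nat.pow_le_pow_right (by omega) (by omega)).trans hq).trans ?_
      simp [pre]
  · intro P Q hPQ hQ
    have hPQ : L = P ++ Q := hPQ
    obtain ⟨q, hq, hq'⟩ := h P Q hPQ hQ
    have hq' : ∀ c ∈ D, (∃ l ∈ c, l.1 ∈ Q) → Determines q (Unsat (p ++ P) c) :=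
      fun c hc hcQ => (hq' c hc hcQ).congr fun a => Unsat.iff_of_append_left (hp c hc)
    have h0 : o Q = 0 := ho Q (by simp [hPQ])
    rw [h0]
    by_cases hd : ∃ l ∈ d, l.1 ∈ Q
    · classical
      refine ⟨(fun a => decide (Unsat (p ++ P) d a)) :: q, ?_, ?_⟩
      · simp only [openBit, Sum.elim_inr, if_pos hd] at hq
        exact hq
      · rintro c (hc | hc) hcQ
        · exact (hq' c hc hcQ).mono (by simp)
        · obtain rfl : d = c := Sum.inr_injective hc
          intro a a' ha
          simpa using ha _ (List.mem_cons_self ..)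
    · refine ⟨q, ?_, ?_⟩
      · simp only [openBit, Sum.elim_inr, if_neg hd] at hq
        exact hq
      · rintro c (hc | hc) hcQ
        · exact hq' c hc hcQ
        · obtain rfl : d = c := Sum.inr_injective hc
          exact (hd hcQ).elim

theorem mem_merge {l l' : List Var} {x : Var} : x ∈ merge l l' ↔ x ∈ l ∨ x ∈ l' := by
  unfold merge
  cases lengthLE l l' <;> simp [or_comm]

theorem Width.merge {v : Vtx} {L L' : List Var} {D D' : Set Cl}
    (h : Width (pre v) (openBit v) L D) (h' : Width (pre v) (openBit v) L' D')
    (hD : ∀ c ∈ D, ∀ l ∈ c, l.1 ∉ L') (hD' : ∀ c ∈ D', ∀ l ∈ c, l.1 ∉ L) :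
    Width (pre v) (openBit v) (merge L L') (D ∪ D') := by
  unfold CNFtoOBDD.merge
  cases hl : lengthLE L L' with
  | true =>
    rw [lengthLE_iff] at hl
    exact h.append h' (length_pre_add_openBit_le v) (by omega) hD hD'
  | false =>
    rw [← Bool.not_eq_true, lengthLE_iff] at hl
    rw [Set.union_comm]
    exact h'.append h (length_pre_add_openBit_le v) (by omega) hD' hD

/-- The variables in the order in which they are read when the vertex `e.1` is attached. -/
def block (e : Vtx × List Var) : List Var := pre e.1 ++ e.2

theorem mem_block {e : Vtx × List Var} {x : Var} : x ∈ block e ↔ e.1 = .inl x ∨ x ∈ e.2 := by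
  obtain ⟨y | c, L⟩ := e <;> simp [block, pre, eq_comm]

/-- The invariant of the stripping of `R`. The clauses that hang on a vertex `v` are those in `D v`,
and those whose variables have been output are in `D₀`. -/
structure StripInv (R : List Vtx) (E : List (Vtx × List Var) × List Var) (D : Vtx → Set Cl)
    (D₀ : Set Cl) : Prop where
  nodup : (E.1.map Prod.fst).Nodup
  cover : ∀ c, .inr c ∈ R → .inr c ∈ E.1.map Prod.fst ∨ (∃ e ∈ E.1, c ∈ D e.1) ∨ c ∈ D₀
  vars : ∀ x, .inl x ∈ R ↔ x ∈ E.2 ∨ ∃ e ∈ E.1, x ∈ block e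
  disj : ∀ e ∈ E.1, ∀ e' ∈ E.1, ∀ x ∈ block e, x ∈ block e' → e.1 = e'.1
  disj_out : ∀ e ∈ E.1, ∀ x ∈ block e, x ∉ E.2
  nodup_block : ∀ e ∈ E.1, (block e).Nodup
  nodup_out : E.2.Nodup
  mem_block : ∀ e ∈ E.1, ∀ c ∈ D e.1, ∀ l ∈ c, .inl l.1 ∈ R → l.1 ∈ block e
  mem_out : ∀ c ∈ D₀, ∀ l ∈ c, .inl l.1 ∈ R → l.1 ∈ E.2
  mem_of_inr : ∀ e ∈ E.1, ∀ c, e.1 = .inr c → ∀ l ∈ c, .inl l.1 ∈ R →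
    .inl l.1 ∈ E.1.map Prod.fst ∨ l.1 ∈ e.2
  width : ∀ e ∈ E.1, Width (pre e.1) (openBit e.1) e.2 (D e.1)
  width_out : Width [] (fun _ => 0) E.2 D₀

theorem stripInv_init {R : List Vtx} (hR : R.Nodup) :
    StripInv R (R.map fun v => (v, []), []) (fun _ => ∅) ∅ where
  nodup := by simpa [Function.comp_def] using hR
  cover := by simp
  vars := by simp [CNFtoOBDD.mem_block]
  disj := by simp +contextual [CNFtoOBDD.mem_block]
  disj_out := by simp
  nodup_block := by
    intro e he
    obtain ⟨v, _, rfl⟩ := List.mem_map.mp he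
    cases v <;> simp [block, pre]
  nodup_out := List.nodup_nil
  mem_block := by simp
  mem_out := by simp
  mem_of_inr := by
    intro e _ c _ l _ h
    left
    simpa using h
  width := by
    intro e he
    obtain ⟨v, _, rfl⟩ := List.mem_map.mp he
    intro P Q h hQ
    exact (hQ (List.append_eq_nil_iff.mp h.symm).2).elim
  width_out := by
    intro P Q h hQ
    exact (hQ (List.append_eq_nil_iff.mp h.symm).2).elim

section Step

variable {R : List Vtx} {E : List (Vtx × List Var) × List Var} {D : Vtx → Set Cl} {D₀ : Set Cl}

/-- A variable of a list `e.2` is not a vertex that is left. -/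
theorem StripInv.not_mem_verts (h : StripInv R E D D₀) {e : Vtx × List Var} (he : e ∈ E.1)
    {x : Var} (hx : x ∈ e.2) : .inl x ∉ E.1.map Prod.fst := by
  intro hx'
  obtain ⟨e', he', h'⟩ := List.mem_map.mp hx'
  have h1 := h.disj e he e' he' x (CNFtoOBDD.mem_block.mpr (.inr hx))
    (CNFtoOBDD.mem_block.mpr (.inl h'))
  have h2 := h.nodup_block e he
  rw [block, h1, h'] at h2
  exact (List.nodup_cons.mp h2).1 hx

/-- The variables of the clauses that hang on a vertex, or are that vertex. -/
theorem StripInv.mem_of_union (h : StripInv R E D D₀) {e : Vtx × List Var} (he : e ∈ E.1)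
    {c : Cl} (hc : c ∈ D e.1 ∪ {c | e.1 = .inr c}) {l : Literal} (hl : l ∈ c)
    (hlR : .inl l.1 ∈ R) :
    l.1 ∈ block e ∨ (.inl l.1 ∈ E.1.map Prod.fst ∧ adj e.1 (.inl l.1) = true) := by
  rcases hc with hc | hc
  · exact .inl (h.mem_block e he c hc l hl hlR)
  · rcases h.mem_of_inr e he c hc l hl hlR with h' | h'
    · have hc : e.1 = .inr c := hc
      exact .inr ⟨h', by rw [hc, adj_inr_inl]; exact ⟨l, hl, rfl⟩⟩
    · exact .inl (CNFtoOBDD.mem_block.mpr (.inr h'))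

theorem StripInv.width_merge (h : StripInv R E D D₀) {e f : Vtx × List Var} (he : e ∈ E.1)
    (hf : f ∈ E.1) (hne : f.1 ≠ e.1) :
    Width (pre f.1) (openBit f.1) (merge f.2 (block e)) (D f.1 ∪ (D e.1 ∪ {c | e.1 = .inr c})) := by
  refine (h.width f hf).merge ((h.width e he).close ?_ ?_ fun Q =>
    (Nat.le_add_left _ _).trans (length_pre_add_openBit_le f.1 Q)) ?_ ?_
  · intro c hc l hl hlf
    have hlf' : l.1 ∈ block f := List.mem_append_left _ hlf
    have hlR := (h.vars l.1).mpr (.inr ⟨f, hf, hlf'⟩)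
    exact hne (h.disj f hf e he l.1 hlf' (h.mem_block e he c hc l hl hlR))
  · intro Q hQ
    rcases hf1 : f.1 with x | c
    · rfl
    · simp only [openBit, Sum.elim_inr]
      rw [if_neg]
      rintro ⟨l, hl, hlQ⟩
      have hle : l.1 ∈ block e := CNFtoOBDD.mem_block.mpr (.inr (hQ hlQ))
      have hlR := (h.vars l.1).mpr (.inr ⟨e, he, hle⟩)
      rcases h.mem_of_inr f hf c hf1 l hl hlR with h' | h'
      · exact h.not_mem_verts he (hQ hlQ) h'
      · exact hne (h.disj f hf e he l.1 (CNFtoOBDD.mem_block.mpr (.inr h')) hle)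
  · intro c hc l hl hle
    have hlR := (h.vars l.1).mpr (.inr ⟨e, he, hle⟩)
    exact hne (h.disj f hf e he l.1 (h.mem_block f hf c hc l hl hlR) hle)
  · intro c hc l hl hlf
    have hlf' : l.1 ∈ block f := CNFtoOBDD.mem_block.mpr (.inr hlf)
    have hlR := (h.vars l.1).mpr (.inr ⟨f, hf, hlf'⟩)
    rcases h.mem_of_union he hc hl hlR with h' | h'
    · exact hne (h.disj f hf e he l.1 hlf' h')
    · exact h.not_mem_verts hf hlf h'.1

/-- Stripping a vertex maintains the invariant. -/
theorem StripInv.step (h : StripInv R E D D₀) {e : Vtx × List Var} (he : e ∈ E.1)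
    (h1 : (nbrs (E.1.map Prod.fst) e.1).length ≤ 1) :
    ∃ D' D₀', StripInv R ((E.1.filter fun f => !decide (f.1 = e.1)).map fun f =>
          bif adj e.1 f.1 then (f.1, merge f.2 (block e)) else f,
        bif (nbrs (E.1.map Prod.fst) e.1).isEmpty then E.2 ++ block e else E.2) D' D₀' := by
  set E₁ := (E.1.filter fun f => !decide (f.1 = e.1)).map fun f =>
    bif adj e.1 f.1 then (f.1, merge f.2 (block e)) else f with hE₁
  -- There is at most one neighbour of `e.1`, to which its variables and clauses are passed on.
  have huniq : ∀ f ∈ E.1, ∀ g ∈ E.1, adj e.1 f.1 = true → adj e.1 g.1 = true → f.1 = g.1 := by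
    intro f hf g hg hef heg
    have hmem : ∀ f ∈ E.1, adj e.1 f.1 = true → f.1 ∈ nbrs (E.1.map Prod.fst) e.1 :=
      fun f hf hef => List.mem_filter.mpr ⟨List.mem_map_of_mem hf, hef⟩
    have hf' := hmem f hf hef
    have hg' := hmem g hg heg
    rcases hn : nbrs (E.1.map Prod.fst) e.1 with _ | ⟨a, _ | ⟨b, l⟩⟩
    · rw [hn] at hf'; cases hf'
    · rw [hn, List.mem_singleton] at hf' hg'
      rw [hf', hg']
    · rw [hn] at h1; simp at h1
  have hnone : nbrs (E.1.map Prod.fst) e.1 = [] ↔ ∀ f ∈ E.1, adj e.1 f.1 = false := by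
    simp [nbrs, List.filter_eq_nil_iff]
  have hmem : ∀ f', f' ∈ E₁ ↔ ∃ f ∈ E.1, f.1 ≠ e.1 ∧
      (bif adj e.1 f.1 then (f.1, merge f.2 (block e)) else f) = f' := by
    intro f'
    simp [hE₁, and_assoc]
  have hverts : E₁.map Prod.fst = (E.1.map Prod.fst).filter fun u => !decide (u = e.1) := by
    rw [hE₁, map_fst_update, map_fst_filter_ne]
  have hfst : ∀ f : Vtx × List Var,
      (bif adj e.1 f.1 then (f.1, merge f.2 (block e)) else f).1 = f.1 := fun f => by
    cases adj e.1 f.1 <;> rfl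
  have hblock : ∀ (f : Vtx × List Var) (x : Var),
      x ∈ block (bif adj e.1 f.1 then (f.1, merge f.2 (block e)) else f) ↔
        x ∈ block f ∨ (adj e.1 f.1 = true ∧ x ∈ block e) := by
    intro f x
    cases hef : adj e.1 f.1 with
    | true =>
      rw [cond_true, CNFtoOBDD.mem_block (e := f), CNFtoOBDD.mem_block, mem_merge]
      tauto
    | false => simp
  have hout : ∀ x, x ∈ (bif (nbrs (E.1.map Prod.fst) e.1).isEmpty then E.2 ++ block e else E.2) ↔
      x ∈ E.2 ∨ ((∀ f ∈ E.1, adj e.1 f.1 = false) ∧ x ∈ block e) := by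
    intro x
    rw [← hnone]
    rcases hn : nbrs (E.1.map Prod.fst) e.1 with _ | ⟨a, l⟩ <;> simp
  have hdisj : ∀ f ∈ E.1, f.1 ≠ e.1 → ∀ x ∈ block f, x ∉ block e := fun f hf hfe x hx hx' =>
    hfe (h.disj f hf e he x hx hx')
  -- A vertex to which `e` is passed on, if any, is left.
  have hnext : (∀ f ∈ E.1, adj e.1 f.1 = false) ∨
      ∃ f ∈ E.1, f.1 ≠ e.1 ∧ adj e.1 f.1 = true := by
    by_contra! hne
    obtain ⟨⟨f, hf, hef⟩, h3⟩ := hne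
    rw [Bool.ne_false_iff] at hef
    refine h3 f hf (fun h4 => ?_) hef
    rw [h4, adj_self] at hef
    cases hef
  refine ⟨fun u => D u ∪ {c | adj e.1 u = true ∧ c ∈ D e.1 ∪ {c | e.1 = .inr c}},
    D₀ ∪ {c | (∀ f ∈ E.1, adj e.1 f.1 = false) ∧ c ∈ D e.1 ∪ {c | e.1 = .inr c}}, ?_⟩
  constructor
  · rw [hverts]
    exact h.nodup.filter _
  · intro c hc
    have key : c ∈ D e.1 ∪ {c | e.1 = .inr c} → (∃ f ∈ E₁,
        c ∈ D f.1 ∪ {c | adj e.1 f.1 = true ∧ c ∈ D e.1 ∪ {c | e.1 = .inr c}}) ∨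
        c ∈ D₀ ∪ {c | (∀ f ∈ E.1, adj e.1 f.1 = false) ∧ c ∈ D e.1 ∪ {c | e.1 = .inr c}} := by
      intro hc
      rcases hnext with hn | ⟨f, hf, hfe, hef⟩
      · exact .inr (.inr ⟨hn, hc⟩)
      · refine .inl ⟨_, (hmem _).mpr ⟨f, hf, hfe, rfl⟩, ?_⟩
        rw [hfst]
        exact .inr ⟨hef, hc⟩
    rcases h.cover c hc with h2 | ⟨f, hf, h2⟩ | h2
    · by_cases hce : e.1 = .inr c
      · exact .inr (key (.inr hce))
      · left
        rw [hverts]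
        exact List.mem_filter.mpr ⟨h2, by simpa using fun h => hce h.symm⟩
    · by_cases hfe : f.1 = e.1
      · exact .inr (key (.inl (hfe ▸ h2)))
      · exact .inr (.inl ⟨_, (hmem _).mpr ⟨f, hf, hfe, rfl⟩, by rw [hfst]; exact .inl h2⟩)
    · exact .inr (.inr (.inl h2))
  · intro x
    rw [h.vars, hout]
    constructor
    · rintro (h2 | ⟨f, hf, h2⟩)
      · exact .inl (.inl h2)
      · by_cases hfe : f.1 = e.1
        · obtain rfl : f = e := List.inj_on_of_nodup_map h.nodup hf he hfe
          rcases hnext with hn | ⟨g, hg, hge, heg⟩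
          · exact .inl (.inr ⟨hn, h2⟩)
          · exact .inr ⟨_, (hmem _).mpr ⟨g, hg, hge, rfl⟩, (hblock g x).mpr (.inr ⟨heg, h2⟩)⟩
        · exact .inr ⟨_, (hmem _).mpr ⟨f, hf, hfe, rfl⟩, (hblock f x).mpr (.inl h2)⟩
    · rintro ((h2 | ⟨_, h2⟩) | ⟨f', hf', h2⟩)
      · exact .inl h2
      · exact .inr ⟨e, he, h2⟩
      · obtain ⟨f, hf, hfe, rfl⟩ := (hmem _).mp hf'
        rcases (hblock f x).mp h2 with h2 | ⟨_, h2⟩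
        · exact .inr ⟨f, hf, h2⟩
        · exact .inr ⟨e, he, h2⟩
  · intro f' hf' g' hg' x hx hx'
    obtain ⟨f, hf, hfe, rfl⟩ := (hmem _).mp hf'
    obtain ⟨g, hg, hge, rfl⟩ := (hmem _).mp hg'
    rw [hfst, hfst]
    rcases (hblock f x).mp hx with hx | ⟨hef, hx⟩ <;>
      rcases (hblock g x).mp hx' with hx' | ⟨heg, hx'⟩
    · exact h.disj f hf g hg x hx hx'
    · exact (hdisj f hf hfe x hx hx').elim
    · exact (hdisj g hg hge x hx' hx).elim
    · exact huniq f hf g hg hef heg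
  · intro f' hf' x hx hx'
    obtain ⟨f, hf, hfe, rfl⟩ := (hmem _).mp hf'
    rcases (hblock f x).mp hx with hx | ⟨hef, hx⟩ <;> rcases (hout x).mp hx' with hx' | ⟨hn, hx'⟩
    · exact h.disj_out f hf x hx hx'
    · exact hdisj f hf hfe x hx hx'
    · exact h.disj_out e he x hx hx'
    · rw [hn f hf] at hef; cases hef
  · intro f' hf'
    obtain ⟨f, hf, hfe, rfl⟩ := (hmem _).mp hf'
    have hnf := h.nodup_block f hf
    cases hef : adj e.1 f.1 with
    | false => simpa [hef] using hnf
    | true =>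
      have hne := h.nodup_block e he
      have hd : ∀ x ∈ block f, x ∉ block e := hdisj f hf hfe
      rw [cond_true]
      show (pre f.1 ++ merge f.2 (block e)).Nodup
      have hperm : (pre f.1 ++ merge f.2 (block e)).Perm (block f ++ block e) := by
        rw [show block f ++ block e = pre f.1 ++ (f.2 ++ block e) by simp [block]]
        refine List.Perm.append_left _ ?_
        unfold CNFtoOBDD.merge
        cases lengthLE f.2 (block e)
        · exact List.perm_append_comm
        · exact List.Perm.refl _
      rw [hperm.nodup_iff]
      exact List.nodup_append.mpr ⟨hnf, hne, fun a ha b hb hab => hd a ha (hab ▸ hb)⟩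
  · rcases hn : nbrs (E.1.map Prod.fst) e.1 with _ | ⟨a, l⟩
    · exact List.nodup_append.mpr ⟨h.nodup_out, h.nodup_block e he,
        fun a ha b hb hab => h.disj_out e he b hb (hab ▸ ha)⟩
    · exact h.nodup_out
  · intro f' hf' c hc l hl hlR
    obtain ⟨f, hf, hfe, rfl⟩ := (hmem _).mp hf'
    rw [hfst] at hc
    rw [hblock]
    rcases hc with hc | ⟨hef, hc⟩
    · exact .inl (h.mem_block f hf c hc l hl hlR)
    · rcases h.mem_of_union he hc hl hlR with h2 | ⟨h2, h3⟩
      · exact .inr ⟨hef, h2⟩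
      · obtain ⟨g, hg, hg'⟩ := List.mem_map.mp h2
        left
        rw [CNFtoOBDD.mem_block]
        left
        rw [← hg']
        exact huniq f hf g hg hef (by rwa [hg'])
  · intro c hc l hl hlR
    rw [hout]
    rcases hc with hc | ⟨hn, hc⟩
    · exact .inl (h.mem_out c hc l hl hlR)
    · rcases h.mem_of_union he hc hl hlR with h2 | ⟨h2, h3⟩
      · exact .inr ⟨hn, h2⟩
      · obtain ⟨g, hg, hg'⟩ := List.mem_map.mp h2
        rw [← hg', hn g hg] at h3
        cases h3
  · intro f' hf' c hc l hl hlR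
    obtain ⟨f, hf, hfe, rfl⟩ := (hmem _).mp hf'
    rw [hfst] at hc
    rcases h.mem_of_inr f hf c hc l hl hlR with h2 | h2
    · by_cases hle : (.inl l.1 : Vtx) = e.1
      · right
        have hef : adj e.1 f.1 = true := by rw [← hle, hc, adj_inl_inr]; exact ⟨l, hl, rfl⟩
        rw [hef, cond_true]
        exact mem_merge.mpr (.inr (CNFtoOBDD.mem_block.mpr (.inl hle.symm)))
      · left
        rw [hverts]
        exact List.mem_filter.mpr ⟨h2, by simpa using hle⟩
    · right
      cases adj e.1 f.1
      · exact h2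
      · exact mem_merge.mpr (.inl h2)
  · intro f' hf'
    obtain ⟨f, hf, hfe, rfl⟩ := (hmem _).mp hf'
    rw [hfst]
    cases hef : adj e.1 f.1 with
    | false => simpa [hef] using h.width f hf
    | true =>
      have := h.width_merge he hf hfe
      simp only [true_and, cond_true]
      exact this
  · rcases hn : nbrs (E.1.map Prod.fst) e.1 with _ | ⟨a, l⟩
    · have hn' := hnone.mp hn
      simp only [List.isEmpty_nil, cond_true]
      rw [show {c | (∀ f ∈ E.1, adj e.1 f.1 = false) ∧ c ∈ D e.1 ∪ {c | e.1 = .inr c}} =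
        D e.1 ∪ {c | e.1 = .inr c} from Set.ext fun c => and_iff_right hn']
      refine h.width_out.append (n := 0) ((h.width e he).close (by simp) (fun _ _ => rfl)
        fun _ => Nat.zero_le _) (fun _ => by simp) (by simp) ?_ ?_
      · intro c hc l hl hle
        have hle : l.1 ∈ block e := hle
        exact h.disj_out e he l.1 hle (h.mem_out c hc l hl
          ((h.vars l.1).mpr (.inr ⟨e, he, hle⟩)))
      · intro c hc l hl hlo
        rcases h.mem_of_union he hc hl ((h.vars l.1).mpr (.inl hlo)) with h2 | ⟨h2, h3⟩
        · exact h.disj_out e he l.1 h2 hlo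
        · obtain ⟨g, hg, hg'⟩ := List.mem_map.mp h2
          rw [← hg', hn' g hg] at h3
          cases h3
    · have hn' : ¬ ∀ f ∈ E.1, adj e.1 f.1 = false := by
        rw [← hnone, hn]
        simp
      simp only [List.isEmpty_cons, cond_false]
      rw [show {c | (∀ f ∈ E.1, adj e.1 f.1 = false) ∧ c ∈ D e.1 ∪ {c | e.1 = .inr c}} =
        ∅ from Set.eq_empty_iff_forall_notMem.mpr fun c hc => hn' hc.1, Set.union_empty]
      exact h.width_out

end Step

theorem exists_stripInv {R : List Vtx} (hR : R.Nodup) : ∃ D D₀, StripInv R (strip R) D D₀ := by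
  have h : ∀ (l : List Vtx) (E : List (Vtx × List Var) × List Var),
      (∃ D D₀, StripInv R E D D₀) →
        ∃ D D₀, StripInv R (l.foldl (fun E _ => stripStep E) E) D D₀ := by
    intro l
    induction l with
    | nil => exact fun E h => h
    | cons a l ih =>
      intro E hE
      rw [List.foldl_cons]
      refine ih _ ?_
      obtain ⟨D, D₀, h⟩ := hE
      obtain ⟨h1, -⟩ | ⟨e, he, h1, h2⟩ := stripStep_cases E
      · rw [h1]
        exact ⟨D, D₀, h⟩
      · rw [h2]
        exact h.step he h1
  exact h R _ ⟨_, _, stripInv_init hR⟩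

/-- If stripping removes all vertices, its output is a list of the variables for which a
logarithmic number of bits determine the unsatisfied clauses. -/
theorem strip_spec {R : List Vtx} (hR : R.Nodup) (hc : core R = []) :
    (strip R).2.Nodup ∧ (∀ x, x ∈ (strip R).2 ↔ .inl x ∈ R) ∧
      Width [] (fun _ => 0) (strip R).2 {c | .inr c ∈ R} := by
  obtain ⟨D, D₀, h⟩ := exists_stripInv hR
  have h0 : (strip R).1 = [] := by simpa [core] using hc
  refine ⟨h.nodup_out, fun x => ?_, fun P Q hPQ hQ => ?_⟩
  · rw [h.vars, h0]
    simp
  · obtain ⟨q, hq, hq'⟩ := h.width_out P Q hPQ hQ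
    refine ⟨q, hq, fun c hc => hq' c ?_⟩
    have := h.cover c hc
    simpa [h0] using this

/-! ### Deletion sets and the variable order -/

/-- In a forest, every finite set of vertices has a vertex with at most one neighbour in the set. -/
theorem _root_.SimpleGraph.IsAcyclic.false_of_forall_exists_adj {V : Type*} {G : SimpleGraph V}
    (hG : G.IsAcyclic) [Finite V] {W : Set V} (hW : W.Nonempty)
    (h : ∀ v ∈ W, ∃ a ∈ W, ∃ b ∈ W, a ≠ b ∧ G.Adj v a ∧ G.Adj v b) : False := by
  have hH : (G.induce W).IsAcyclic := hG.induce W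
  have : Nonempty W := hW.to_subtype
  have : Finite (G.induce W).edgeSet := inferInstance
  -- Both neighbours of the first vertex of a longest path lie on the path.
  obtain ⟨u, v, p, hp, hmax⟩ :=
    SimpleGraph.Walk.exists_isPath_forall_isPath_length_le_length (G.induce W)
  have key : ∀ w, (G.induce W).Adj u w → w = p.snd := by
    intro w hw
    refine hH.eq_snd_of_adj_start hp hw ?_
    by_contra hws
    have h2 := hmax _ _ (p.cons hw.symm) (hp.cons hws)
    simp at h2
  obtain ⟨a, ha, b, hb, hab, hua, hub⟩ := h u.1 u.2
  have h1 := key ⟨a, ha⟩ hua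
  have h2 := key ⟨b, hb⟩ hub
  exact hab (congrArg Subtype.val (h1.trans h2.symm))

/-- The list `N` consists of the clauses of `F`, and their literals are listed in a common order. -/
structure IsNormalList (N : List Cl) (F : CNF) : Prop where
  clauses : ∀ c, c ∈ F.clauses ↔ ∃ d ∈ N, d.toFinset = c
  common : ∃ A : List Literal, ∀ c ∈ N, c = A.filter fun l => isMem l c

theorem IsNormalList.restrict_eq {N : List Cl} {F : CNF} (hN : IsNormalList N F) {V : List Var}
    {c d : Cl} (hc : c ∈ N) (hd : d ∈ N) (h : ∀ l : Literal, l.1 ∉ V → (l ∈ c ↔ l ∈ d)) :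
    restrict V c = restrict V d := by
  obtain ⟨A, hA⟩ := hN.common
  have hr : ∀ c ∈ N, restrict V c = A.filter fun l => !isMem l.1 V && isMem l c := fun c hc => by
    conv_lhs => rw [hA c hc, restrict, List.filter_filter]
  rw [hr c hc, hr d hd]
  refine List.filter_congr fun l _ => ?_
  by_cases hl : l.1 ∈ V
  · rw [isMem_eq_true.mpr hl]
    rfl
  · have : isMem l c = isMem l d := by
      rw [Bool.eq_iff_iff, isMem_eq_true, isMem_eq_true, h l hl]
    rw [this]

theorem IsNormalList.toFinset_injOn {N : List Cl} {F : CNF} (hN : IsNormalList N F) {c d : Cl}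
    (hc : c ∈ N) (hd : d ∈ N) (h : c.toFinset = d.toFinset) : c = d := by
  have := hN.restrict_eq (V := []) hc hd fun l _ => by
    rw [← List.mem_toFinset, h, List.mem_toFinset]
  have hr : ∀ c : Cl, restrict [] c = c := fun c => by simp [restrict, isMem]
  rwa [hr, hr] at this

/-- The clauses in `N` that belong to a set of clauses. -/
def listed (N : List Cl) (C : Finset Clause) : Finset Cl :=
  N.toFinset.filter fun c => c.toFinset ∈ C

theorem mem_listed {N : List Cl} {C : Finset Clause} {c : Cl} :
    c ∈ listed N C ↔ c ∈ N ∧ c.toFinset ∈ C := by simp [listed]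

section Deletion

variable {F : CNF} {N : List Cl} {V : Finset Var} {C : Finset Clause} {k : ℕ}

theorem IsNormalList.card_listed_le (hN : IsNormalList N F) (C : Finset Clause) :
    (listed N C).card ≤ C.card :=
  Finset.card_le_card_of_injOn List.toFinset (fun _ hc => (mem_listed.mp hc).2)
    fun _ hc _ hd h => hN.toFinset_injOn (mem_listed.mp hc).1 (mem_listed.mp hd).1 h

/-- Outside a deletion set, no variables and clauses that remain distinct when the variables in the
deletion set are deleted have at least two neighbours each. -/
theorem IsNormalList.eq_empty_of_forall_exists (hN : IsNormalList N F)
    (hD : F.delete V C ∈ CNF.forests) {A : Set Var} {B : Set Cl} (hB : ∀ c ∈ B, c ∈ N)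
    (hBC : ∀ c ∈ B, c ∉ listed N C) (hAV : ∀ x ∈ A, x ∉ V)
    (hinj : ∀ c ∈ B, ∀ d ∈ B, (∀ l : Literal, l.1 ∉ V → (l ∈ c ↔ l ∈ d)) → c = d)
    (hA2 : ∀ x ∈ A, ∃ c ∈ B, ∃ d ∈ B, c ≠ d ∧ (∃ l ∈ c, l.1 = x) ∧ ∃ l ∈ d, l.1 = x)
    (hB2 : ∀ c ∈ B, ∃ x ∈ A, ∃ y ∈ A, x ≠ y ∧ (∃ l ∈ c, l.1 = x) ∧ ∃ l ∈ c, l.1 = y) :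
    A = ∅ ∧ B = ∅ := by
  classical
  by_contra hne
  let r : Cl → Clause := fun c => c.toFinset.filter fun l => l.1 ∉ V
  have hr : ∀ c ∈ B, r c ∈ (F.delete V C).clauses := fun c hc => by
    refine Finset.mem_image.mpr ⟨c.toFinset, Finset.mem_sdiff.mpr
      ⟨(hN.clauses _).mpr ⟨c, hB c hc, rfl⟩, fun h => hBC c hc ?_⟩, rfl⟩
    exact mem_listed.mpr ⟨hB c hc, h⟩
  have hrx : ∀ c, ∀ x ∈ A, (∃ l ∈ c, l.1 = x) → x ∈ Clause.vars (r c) := by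
    rintro c x hx ⟨l, hl, rfl⟩
    exact Finset.mem_image.mpr ⟨l, Finset.mem_filter.mpr ⟨List.mem_toFinset.mpr hl, hAV _ hx⟩, rfl⟩
  have hv : ∀ x ∈ A, x ∈ (F.delete V C).vars := fun x hx => by
    obtain ⟨c, hc, _, _, _, h, _⟩ := hA2 x hx
    exact Finset.mem_biUnion.mpr ⟨r c, hr c hc, hrx c x hx h⟩
  let W : Set ({x // x ∈ (F.delete V C).vars} ⊕ {c // c ∈ (F.delete V C).clauses}) :=
    {v | Sum.elim (fun x => x.1 ∈ A) (fun c => ∃ d ∈ B, r d = c.1) v}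
  refine SimpleGraph.IsAcyclic.false_of_forall_exists_adj (W := W) hD ?_ ?_
  · by_contra hW
    rw [Set.not_nonempty_iff_eq_empty, Set.eq_empty_iff_forall_notMem] at hW
    refine hne ⟨Set.eq_empty_iff_forall_notMem.mpr fun x hx => ?_,
      Set.eq_empty_iff_forall_notMem.mpr fun c hc => ?_⟩
    · exact hW (.inl ⟨x, hv x hx⟩) hx
    · exact hW (.inr ⟨r c, hr c hc⟩) ⟨c, hc, rfl⟩
  · rintro (⟨x, hx⟩ | ⟨c, hc⟩) hW
    · obtain ⟨c, hc, d, hd, hcd, h1, h2⟩ := hA2 x hW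
      refine ⟨.inr ⟨r c, hr c hc⟩, ⟨c, hc, rfl⟩, .inr ⟨r d, hr d hd⟩, ⟨d, hd, rfl⟩, ?_,
        hrx c x hW h1, hrx d x hW h2⟩
      intro h
      simp only [Sum.inr.injEq, Subtype.mk.injEq] at h
      refine hcd (hinj c hc d hd fun l hl => ?_)
      have h3 := Finset.ext_iff.mp h l
      simpa [r, hl] using h3
    · obtain ⟨d, hd, rfl⟩ : ∃ d ∈ B, r d = c := hW
      obtain ⟨x, hx, y, hy, hxy, h1, h2⟩ := hB2 d hd
      refine ⟨.inl ⟨x, hv x hx⟩, hx, .inl ⟨y, hv y hy⟩, hy, ?_, hrx d x hx h1, hrx d y hy h2⟩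
      intro h
      simp only [Sum.inl.injEq, Subtype.mk.injEq] at h
      exact hxy h

theorem isConflict_iff {V : List Var} {C : List Cl} {c d : Cl} {x y z : Literal} :
    IsConflict V C (c, d, x, y, z) = true ↔ (c ∉ C ∧ d ∉ C) ∧ (x ∈ c ∧ y ∈ c ∧ z ∈ c ∧ z ∉ d) ∧
      ((∃ l ∈ d, l.1 = x.1) ∧ (∃ l ∈ d, l.1 = y.1) ∧ x.1 ≠ y.1) ∧
      x.1 ∉ V ∧ y.1 ∉ V ∧ z.1 ∉ V := by
  simp only [IsConflict, Bool.and_eq_true, Bool.not_eq_true', isMem_eq_false, isMem_eq_true,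
    decide_eq_false_iff_not, List.mem_map]
  tauto

theorem mem_tuples {c d : Cl} {x y z : Literal} :
    (c, d, x, y, z) ∈ tuples N ↔ c ∈ N ∧ d ∈ N ∧ (∃ e ∈ N, x ∈ e) ∧ (∃ e ∈ N, y ∈ e) ∧
      ∃ e ∈ N, z ∈ e := by
  simp only [tuples, List.mem_flatMap, List.mem_map, Prod.mk.injEq, List.mem_flatten]
  constructor
  · rintro ⟨_, h1, _, h2, _, h3, _, h4, _, h5, rfl, rfl, rfl, rfl, rfl⟩
    exact ⟨h1, h2, h3, h4, h5⟩
  · rintro ⟨h1, h2, h3, h4, h5⟩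
    exact ⟨_, h1, _, h2, _, h3, _, h4, _, h5, rfl, rfl, rfl, rfl, rfl⟩

/-- A deletion set contains one of the vertices that witness a conflict: if it does not, the two
clauses remain distinct and form a cycle with the two variables. -/
theorem IsNormalList.mem_of_isConflict (hN : IsNormalList N F) (hD : F.delete V C ∈ CNF.forests)
    {V' : List Var} {C' : List Cl} {c d : Cl} {x y z : Literal} (hc : c ∈ N) (hd : d ∈ N)
    (h : IsConflict V' C' (c, d, x, y, z) = true) :
    (x.1 ∈ V ∨ y.1 ∈ V ∨ z.1 ∈ V) ∨ (c ∈ listed N C ∨ d ∈ listed N C) := by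
  obtain ⟨-, ⟨hxc, hyc, hzc, hzd⟩, ⟨hxd, hyd, hxy⟩, -⟩ := isConflict_iff.mp h
  by_contra! hne
  obtain ⟨⟨hxV, hyV, hzV⟩, hcC, hdC⟩ := hne
  have hcd : c ≠ d := by
    rintro rfl
    exact hzd hzc
  have h1 := hN.eq_empty_of_forall_exists hD (A := {x.1, y.1}) (B := {c, d})
    (by simp [hc, hd]) (by simp [hcC, hdC]) (by simp [hxV, hyV]) ?_ ?_ ?_
  · exact (Set.insert_nonempty _ _).ne_empty h1.1
  · have h2 : ¬ ∀ l : Literal, l.1 ∉ V → (l ∈ c ↔ l ∈ d) := fun h => hzd ((h z hzV).mp hzc)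
    rintro a (rfl | rfl) b (rfl | rfl) hab
    · rfl
    · exact (h2 hab).elim
    · exact (h2 fun l hl => (hab l hl).symm).elim
    · rfl
  · rintro a (rfl | rfl)
    · exact ⟨c, by simp, d, by simp, hcd, ⟨x, hxc, rfl⟩, hxd⟩
    · exact ⟨c, by simp, d, by simp, hcd, ⟨y, hyc, rfl⟩, hyd⟩
  · rintro a (rfl | rfl)
    · exact ⟨x.1, by simp, y.1, by simp, hxy, ⟨x, hxc, rfl⟩, ⟨y, hyc, rfl⟩⟩
    · exact ⟨x.1, by simp, y.1, by simp, hxy, hxd, hyd⟩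

theorem separateStep_cases (N : List Cl) (D : List Var × List Cl) :
    (separateStep N D = D ∧ ∀ p ∈ tuples N, IsConflict D.1 D.2 p = false) ∨
    ∃ c d x y z, (c, d, x, y, z) ∈ tuples N ∧ IsConflict D.1 D.2 (c, d, x, y, z) = true ∧
      separateStep N D = (x.1 :: y.1 :: z.1 :: D.1, c :: d :: D.2) := by
  unfold separateStep
  cases h : (tuples N).filter (IsConflict D.1 D.2) with
  | nil =>
    refine .inl ⟨rfl, fun p hp => ?_⟩
    rw [List.filter_eq_nil_iff] at h
    simpa using h p hp
  | cons p l =>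
    have hp : p ∈ (tuples N).filter (IsConflict D.1 D.2) := by simp [h]
    obtain ⟨h1, h2⟩ := List.mem_filter.mp hp
    exact .inr ⟨p.1, p.2.1, p.2.2.1, p.2.2.2.1, p.2.2.2.2, h1, h2, rfl⟩

theorem mem_varList {x : Var} : x ∈ varList N ↔ ∃ c ∈ N, ∃ l ∈ c, l.1 = x := by
  simp only [varList, List.mem_dedup, List.mem_map, List.mem_flatten]
  constructor
  · rintro ⟨l, ⟨c, hc, hl⟩, rfl⟩
    exact ⟨c, hc, l, hl, rfl⟩
  · rintro ⟨c, hc, l, hl, rfl⟩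
    exact ⟨l, ⟨c, hc, hl⟩, rfl⟩

/-- There is no conflict after the deletion of the separating set. -/
theorem isConflict_separate (N : List Cl) :
    ∀ p ∈ tuples N, IsConflict (separate N).1 (separate N).2 p = false := by
  have h : ∀ (l : List Var) (D : List Var × List Cl),
      ((varList N).toFinset.filter fun x => x ∉ D.1).card ≤ l.length →
      ∀ p ∈ tuples N, IsConflict (l.foldl (fun D _ => separateStep N D) D).1
        (l.foldl (fun D _ => separateStep N D) D).2 p = false := by
    intro l
    induction l with
    | nil =>
      rintro D hD ⟨c, d, x, y, z⟩ hp
      rw [← Bool.not_eq_true]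
      intro h
      obtain ⟨-, ⟨hxc, -⟩, -, hx, -⟩ := isConflict_iff.mp h
      rw [List.length_nil, Nat.le_zero, Finset.card_eq_zero, Finset.filter_eq_empty_iff] at hD
      exact hD (List.mem_toFinset.mpr
        (mem_varList.mpr ⟨c, (mem_tuples.mp hp).1, x, hxc, rfl⟩)) hx
    | cons a l ih =>
      intro D hD
      rw [List.foldl_cons]
      obtain ⟨h1, h2⟩ | ⟨c, d, x, y, z, hp, hconf, h1⟩ := separateStep_cases N D
      · have h3 : ∀ l : List Var, l.foldl (fun D _ => separateStep N D) D = D := by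
          intro l
          induction l with
          | nil => rfl
          | cons a l ih' => rw [List.foldl_cons, h1, ih']
        rw [h1, h3]
        exact h2
      · refine ih _ ?_
        rw [h1]
        obtain ⟨-, ⟨hxc, -⟩, -, hx, -⟩ := isConflict_iff.mp hconf
        refine Nat.le_of_lt_succ (lt_of_lt_of_le (Finset.card_lt_card ?_) hD)
        rw [Finset.ssubset_iff_of_subset fun u hu => by
          simp only [Finset.mem_filter, List.mem_cons, not_or] at hu ⊢
          exact ⟨hu.1, hu.2.2.2.2⟩]
        exact ⟨x.1, Finset.mem_filter.mpr ⟨List.mem_toFinset.mpr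
          (mem_varList.mpr ⟨c, (mem_tuples.mp hp).1, x, hxc, rfl⟩), hx⟩, by simp⟩
  exact h (varList N) ([], []) ((Finset.card_filter_le _ _).trans (List.toFinset_card_le _))

/-- Each round of the separation finds another element of a deletion set. -/
theorem IsNormalList.length_separate_le (hN : IsNormalList N F) (hD : F.delete V C ∈ CNF.forests)
    (hk : V.card + C.card ≤ k) : (separate N).1.length ≤ 3 * k ∧ (separate N).2.length ≤ 2 * k := by
  have h : ∀ l : List Var, ∀ D, D = l.foldl (fun D _ => separateStep N D) ([], []) →
      D.1.length ≤ 3 * ((V.filter (· ∈ D.1)).card + ((listed N C).filter (· ∈ D.2)).card) ∧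
      D.2.length ≤ 2 * ((V.filter (· ∈ D.1)).card + ((listed N C).filter (· ∈ D.2)).card) := by
    intro l
    induction l using List.reverseRecOn with
    | nil => rintro D rfl; simp
    | append_singleton l a ih =>
      rintro D rfl
      rw [List.foldl_append, List.foldl_cons, List.foldl_nil]
      have ih := ih _ rfl
      set D := l.foldl (fun D _ => separateStep N D) ([], [])
      obtain ⟨h1, -⟩ | ⟨c, d, x, y, z, hp, hconf, h1⟩ := separateStep_cases N D
      · rwa [h1]
      · rw [h1]
        have hp := mem_tuples.mp hp
        have hmem := hN.mem_of_isConflict hD hp.1 hp.2.1 hconf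
        obtain ⟨⟨hc, hd⟩, -, -, hx, hy, hz⟩ := isConflict_iff.mp hconf
        have s1 : V.filter (· ∈ D.1) ⊆ V.filter (· ∈ x.1 :: y.1 :: z.1 :: D.1) := fun u hu => by
          simp only [Finset.mem_filter, List.mem_cons] at *
          tauto
        have s2 : (listed N C).filter (· ∈ D.2) ⊆ (listed N C).filter (· ∈ c :: d :: D.2) :=
          fun u hu => by
            simp only [Finset.mem_filter, List.mem_cons] at *
            tauto
        have c1 := Finset.card_le_card s1
        have c2 := Finset.card_le_card s2
        have key : (V.filter (· ∈ D.1)).card + ((listed N C).filter (· ∈ D.2)).card <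
            (V.filter (· ∈ x.1 :: y.1 :: z.1 :: D.1)).card +
              ((listed N C).filter (· ∈ c :: d :: D.2)).card := by
          rcases hmem with hmem | hmem
          · refine Nat.add_lt_add_of_lt_of_le (Finset.card_lt_card
              ((Finset.ssubset_iff_of_subset s1).mpr ?_)) c2
            rcases hmem with h | h | h
            · exact ⟨x.1, by simp [h], by simp [hx]⟩
            · exact ⟨y.1, by simp [h], by simp [hy]⟩
            · exact ⟨z.1, by simp [h], by simp [hz]⟩
          · refine Nat.add_lt_add_of_le_of_lt c1 (Finset.card_lt_card
              ((Finset.ssubset_iff_of_subset s2).mpr ?_))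
            rcases hmem with h | h
            · exact ⟨c, by simp [h], by simp [hc]⟩
            · exact ⟨d, by simp [h], by simp [hd]⟩
        simp only [List.length_cons]
        omega
  have h1 := h (varList N) (separate N) rfl
  have h2 := Finset.card_filter_le V (· ∈ (separate N).1)
  have h3 := (Finset.card_filter_le (listed N C) (· ∈ (separate N).2)).trans (hN.card_listed_le C)
  omega

theorem nodup_vertices (N : List Cl) (D : List Var × List Cl) : (vertices N D).Nodup := by
  refine List.nodup_append.mpr ⟨((List.nodup_dedup _).filter _).map Sum.inl_injective,
    (List.nodup_dedup _).map Sum.inr_injective, ?_⟩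
  intro a ha b hb hab
  obtain ⟨x, _, rfl⟩ := List.mem_map.mp ha
  obtain ⟨c, _, rfl⟩ := List.mem_map.mp hb
  cases hab

theorem inl_mem_vertices {D : List Var × List Cl} {x : Var} :
    .inl x ∈ vertices N D ↔ x ∈ varList N ∧ x ∉ D.1 := by simp [vertices]

theorem inr_mem_vertices {D : List Var × List Cl} {c : Cl} :
    .inr c ∈ vertices N D ↔ ∃ d ∈ N, d ∉ D.2 ∧ restrict D.1 d = c := by
  simp [vertices, and_assoc]

/-- If there are no conflicts, a deletion set of the formula gives a feedback vertex set of the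
incidence graph: the clauses that lie on cycles remain distinct when the variables in the deletion
set are deleted. -/
theorem IsNormalList.isForest (hN : IsNormalList N F) (hD : F.delete V C ∈ CNF.forests)
    {D : List Var × List Cl} (hconf : ∀ p ∈ tuples N, IsConflict D.1 D.2 p = false) :
    IsForest ((vertices N D).toFinset \
      (V.image .inl ∪ ((listed N C).image (restrict D.1)).image .inr)) := by
  intro S hS hne
  by_contra! h2
  have hS' : ∀ v ∈ S, v ∈ vertices N D ∧
      v ∉ V.image .inl ∪ ((listed N C).image (restrict D.1)).image .inr := fun v hv => by
    have := Finset.mem_sdiff.mp (hS hv)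
    rwa [List.mem_toFinset] at this
  have hex : ∀ b : Cl, ∃ c : Cl, .inr b ∈ S → c ∈ N ∧ c ∉ D.2 ∧ restrict D.1 c = b := by
    intro b
    by_cases hb : .inr b ∈ S
    · obtain ⟨d, h⟩ := inr_mem_vertices.mp (hS' _ hb).1
      exact ⟨d, fun _ => h⟩
    · exact ⟨[], fun h => (hb h).elim⟩
  choose f hf using hex
  have hvar : ∀ x, .inl x ∈ S → x ∉ D.1 := fun x hx => (inl_mem_vertices.mp (hS' _ hx).1).2
  have hdeg : ∀ v ∈ S, ∃ a ∈ S, ∃ b ∈ S, a ≠ b ∧ adj v a = true ∧ adj v b = true := by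
    intro v hv
    obtain ⟨a, ha, b, hb, hab⟩ := Finset.one_lt_card.mp (h2 v hv)
    rw [Finset.mem_filter] at ha hb
    exact ⟨a, ha.1, b, hb.1, hab, ha.2, hb.2⟩
  have hdegx : ∀ x, .inl x ∈ S → ∃ c d, .inr c ∈ S ∧ .inr d ∈ S ∧ c ≠ d ∧
      (∃ l ∈ c, l.1 = x) ∧ ∃ l ∈ d, l.1 = x := by
    intro x hx
    obtain ⟨a | a, ha, b | b, hb, hab, hxa, hxb⟩ := hdeg _ hx
    · simp at hxa
    · simp at hxa
    · simp at hxb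
    · exact ⟨a, b, ha, hb, fun h => hab (congrArg _ h), adj_inl_inr.mp hxa, adj_inl_inr.mp hxb⟩
  have hdegc : ∀ c, .inr c ∈ S → ∃ x y, .inl x ∈ S ∧ .inl y ∈ S ∧ x ≠ y ∧
      (∃ l ∈ c, l.1 = x) ∧ ∃ l ∈ c, l.1 = y := by
    intro c hc
    obtain ⟨a | a, ha, b | b, hb, hab, hxa, hxb⟩ := hdeg _ hc
    · exact ⟨a, b, ha, hb, fun h => hab (congrArg _ h), adj_inr_inl.mp hxa, adj_inr_inl.mp hxb⟩
    · simp at hxb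
    · simp at hxa
    · simp at hxa
  have hfl : ∀ b, .inr b ∈ S → ∀ l : Literal, l ∈ b → l ∈ f b := fun b hb l hl => by
    rw [← (hf b hb).2.2, mem_restrict] at hl
    exact hl.1
  have hAV : ∀ x, .inl x ∈ S → x ∉ V := fun x hx h =>
    (hS' _ hx).2 (Finset.mem_union_left _ (Finset.mem_image_of_mem _ h))
  -- Two clauses in `S` that become equal would be in conflict.
  have hdiff : ∀ b, .inr b ∈ S → ∀ b', .inr b' ∈ S →
      (∀ l : Literal, l.1 ∉ V → (l ∈ f b ↔ l ∈ f b')) →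
      ∀ z : Literal, z.1 ∉ D.1 → z ∈ f b → z ∈ f b' := by
    intro b hb b' hb' hl z hzD hz
    by_contra hz'
    obtain ⟨x, y, hx, hy, hxy, ⟨lx, hlx, rfl⟩, ⟨ly, hly, rfl⟩⟩ := hdegc b hb
    have hlx := hfl b hb _ hlx
    have hly := hfl b hb _ hly
    obtain ⟨h1, h2, -⟩ := hf b hb
    obtain ⟨h1', h2', -⟩ := hf b' hb'
    have := hconf (f b, f b', lx, ly, z)
      (mem_tuples.mpr ⟨h1, h1', ⟨_, h1, hlx⟩, ⟨_, h1, hly⟩, ⟨_, h1, hz⟩⟩)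
    rw [← Bool.not_eq_true, isConflict_iff] at this
    exact this ⟨⟨h2, h2'⟩, ⟨hlx, hly, hz, hz'⟩, ⟨⟨lx, (hl lx (hAV _ hx)).mp hlx, rfl⟩,
      ⟨ly, (hl ly (hAV _ hy)).mp hly, rfl⟩, hxy⟩, hvar _ hx, hvar _ hy, hzD⟩
  have hinj : ∀ b, .inr b ∈ S → ∀ b', .inr b' ∈ S →
      (∀ l : Literal, l.1 ∉ V → (l ∈ f b ↔ l ∈ f b')) → b = b' := by
    intro b hb b' hb' hl
    rw [← (hf b hb).2.2, ← (hf b' hb').2.2]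
    exact hN.restrict_eq (hf b hb).1 (hf b' hb').1 fun z hz =>
      ⟨hdiff b hb b' hb' hl z hz, hdiff b' hb' b hb (fun l h => (hl l h).symm) z hz⟩
  have h := hN.eq_empty_of_forall_exists hD (A := {x : Var | (.inl x : Vtx) ∈ S})
    (B := {c | ∃ b : Cl, (.inr b : Vtx) ∈ S ∧ f b = c}) ?_ ?_ hAV ?_ ?_ ?_
  · obtain ⟨x | b, hv⟩ := hne
    · exact Set.eq_empty_iff_forall_notMem.mp h.1 x hv
    · exact Set.eq_empty_iff_forall_notMem.mp h.2 (f b) ⟨b, hv, rfl⟩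
  · rintro c ⟨b, hb, rfl⟩
    exact (hf b hb).1
  · rintro c ⟨b, hb, rfl⟩ hc
    refine (hS' _ hb).2 (Finset.mem_union_right _ (Finset.mem_image_of_mem _ ?_))
    rw [← (hf b hb).2.2]
    exact Finset.mem_image_of_mem _ hc
  · rintro c ⟨b, hb, rfl⟩ d ⟨b', hb', rfl⟩ hl
    rw [hinj b hb b' hb' hl]
  · intro x hx
    obtain ⟨c, d, hc, hd, hcd, ⟨l, hl, h1⟩, ⟨l', hl', h2⟩⟩ := hdegx x hx
    refine ⟨f c, ⟨c, hc, rfl⟩, f d, ⟨d, hd, rfl⟩, fun h => hcd ?_, ⟨l, hfl c hc l hl, h1⟩,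
      ⟨l', hfl d hd l' hl', h2⟩⟩
    rw [← (hf c hc).2.2, ← (hf d hd).2.2, h]
  · rintro c ⟨b, hb, rfl⟩
    obtain ⟨x, y, hx, hy, hxy, ⟨l, hl, h1⟩, ⟨l', hl', h2⟩⟩ := hdegc b hb
    exact ⟨x, hx, y, hy, hxy, ⟨l, hfl b hb l hl, h1⟩, ⟨l', hfl b hb l' hl', h2⟩⟩

/-- The feedback vertex set of the separated incidence graph. -/
def cutset (N : List Cl) : List Vtx := fvs (vertices N (separate N))

theorem IsNormalList.length_cutset_le (hN : IsNormalList N F) (hD : F.delete V C ∈ CNF.forests)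
    (hk : V.card + C.card ≤ k) : (cutset N).length ≤ 5 * k * (5 * k) := by
  refine length_fvs_le (nodup_vertices _ _) (hN.isForest hD (isConflict_separate N)) ?_
  have h1 := Finset.card_union_le (V.image (Sum.inl : Var → Vtx))
    (((listed N C).image (restrict (separate N).1)).image .inr)
  have h2 := Finset.card_image_le (s := V) (f := (Sum.inl : Var → Vtx))
  have h3 := (Finset.card_image_le (s := (listed N C).image (restrict (separate N).1))
    (f := (Sum.inr : Cl → Vtx))).trans (Finset.card_image_le.trans (hN.card_listed_le C))
  omega

end Deletion

section Order

variable {N : List Cl}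

theorem forestOrder_spec (N : List Cl) : (forestOrder N).Nodup ∧
    (∀ x, x ∈ forestOrder N ↔ (x ∈ varList N ∧ x ∉ (separate N).1) ∧ .inl x ∉ cutset N) ∧
    Width [] (fun _ => 0) (forestOrder N)
      {c | .inr c ∈ vertices N (separate N) ∧ .inr c ∉ cutset N} := by
  have hG := nodup_vertices N (separate N)
  obtain ⟨h1, h2, h3⟩ := strip_spec (R := remaining (vertices N (separate N)) (cutset N))
    (hG.filter _) (core_remaining_fvs hG)
  refine ⟨h1, fun x => ?_, ?_⟩
  · rw [← inl_mem_vertices, ← mem_remaining, ← h2]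
    rfl
  · simp only [mem_remaining] at h3
    exact h3

theorem nodup_order (N : List Cl) : (order N).Nodup :=
  List.nodup_append.mpr ⟨(List.nodup_dedup _).filter _, (forestOrder_spec N).1,
    fun a ha b hb hab => by
      have := (List.mem_filter.mp ha).2
      simp [hab, hb] at this⟩

theorem mem_order {x : Var} : x ∈ order N ↔ x ∈ varList N := by
  have h := (forestOrder_spec N).2.1 x
  simp only [order, List.mem_append, List.mem_filter, Bool.not_eq_true', isMem_eq_false]
  tauto

/-- Apart from a number of bits that is logarithmic in the number of variables, the variables and
clauses that have been deleted determine the states of the diagram. -/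
theorem isNarrow_order (N : List Cl) : IsNarrow N (order N) ((separate N).1.length +
    (separate N).2.length + 2 * (cutset N).length + Nat.log 2 (2 * (order N).length)) := by
  classical
  obtain ⟨h1, h2, h3⟩ := forestOrder_spec N
  set V := (separate N).1
  set C := (separate N).2
  set T := cutset N
  set W := (varList N).filter fun x => !isMem x (forestOrder N) with hW
  have hWlen : W.length ≤ V.length + T.length := by
    have hnd : W.Nodup := (List.nodup_dedup _).filter _
    rw [List.length_eq_length_filter_add fun x => isMem x V]
    refine Nat.add_le_add ?_ ?_
    · refine ((hnd.filter _).subperm fun x hx => ?_).length_le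
      simpa using (List.mem_filter.mp hx).2
    · rw [← List.length_map (f := (Sum.inl : Var → Vtx))]
      refine (((hnd.filter _).map Sum.inl_injective).subperm fun v hv => ?_).length_le
      obtain ⟨x, hx, rfl⟩ := List.mem_map.mp hv
      simp only [hW, List.mem_filter, Bool.not_eq_true', isMem_eq_false, h2] at hx
      tauto
  have hVf : ∀ x ∈ forestOrder N, x ∉ V := fun x hx => ((h2 x).mp hx).1.2
  intro P Q hPQ
  have hPQ : W ++ forestOrder N = P ++ Q := hPQ
  rcases List.append_eq_append_iff.mp hPQ with ⟨P', rfl, hf⟩ | ⟨Q', hf, rfl⟩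
  · rcases eq_or_ne Q [] with rfl | hQ
    · exact ⟨[], by simp, by simp⟩
    obtain ⟨q, hq, hq'⟩ := h3 P' Q hf hQ
    refine ⟨W.map (fun x a => a x) ++ C.map (fun c a => decide (Unsat (W ++ P') c a)) ++
      T.map (fun v a => decide (∃ c, v = .inr c ∧ Unsat P' c a)) ++ q, ?_, ?_⟩
    · have h4 : q.length ≤ Nat.log 2 (2 * (order N).length) := by
        refine (Nat.le_log_of_pow_le (by omega) hq).trans (Nat.log_mono_right ?_)
        have : (forestOrder N).length ≤ (order N).length := by simp [order]
        omega
      simp only [List.length_append, List.length_map]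
      omega
    · rintro c hc ⟨l, hl, hlQ⟩
      have hlf : l.1 ∈ forestOrder N := by rw [hf]; simp [hlQ]
      by_cases hcC : c ∈ C
      · intro a a' ha
        have := ha (fun a => decide (Unsat (W ++ P') c a)) (List.mem_append_left _
          (List.mem_append_left _ (List.mem_append_right _ (List.mem_map.mpr ⟨c, hcC, rfl⟩))))
        simpa using this
      · -- The clause is unsatisfied if its deleted part and the rest are.
        have hsplit : ∀ a, Unsat (W ++ P') c a ↔ Unsat W c a ∧ Unsat P' (restrict V c) a := by
          intro a
          constructor
          · intro h
            exact ⟨fun l hl hlW => h l hl (by simp [hlW]),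
              fun l hl hlP => h l (mem_restrict.mp hl).1 (by simp [hlP])⟩
          · rintro ⟨h, h'⟩ l hl hlP
            rcases List.mem_append.mp hlP with hlP | hlP
            · exact h l hl hlP
            · exact h' l (mem_restrict.mpr ⟨hl, hVf _ (by rw [hf]; simp [hlP])⟩) hlP
        have hv : .inr (restrict V c) ∈ vertices N (separate N) :=
          inr_mem_vertices.mpr ⟨c, hc, hcC, rfl⟩
        have key : Determines (W.map (fun x a => a x) ++
            C.map (fun c a => decide (Unsat (W ++ P') c a)) ++
            T.map (fun v a => decide (∃ c, v = .inr c ∧ Unsat P' c a)) ++ q)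
            (Unsat P' (restrict V c)) := by
          by_cases hcT : .inr (restrict V c) ∈ T
          · intro a a' ha
            have := ha (fun a => decide (∃ d, (Sum.inr (restrict V c) : Vtx) = .inr d ∧
              Unsat P' d a)) (List.mem_append_left _ (List.mem_append_right _
                (List.mem_map.mpr ⟨_, hcT, rfl⟩)))
            simpa using this
          · exact (hq' _ ⟨hv, hcT⟩ ⟨l, mem_restrict.mpr ⟨hl, hVf _ hlf⟩, hlQ⟩).mono
              fun f hf => List.mem_append_right _ hf
        have key' := (determines_unsat W c).mono (q' := W.map (fun x a => a x) ++
            C.map (fun c a => decide (Unsat (W ++ P') c a)) ++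
            T.map (fun v a => decide (∃ c, v = .inr c ∧ Unsat P' c a)) ++ q) (by simp)
        intro a a' ha
        rw [hsplit, hsplit, key a a' ha, key' a a' ha]
  · refine ⟨P.map fun x a => a x, ?_, fun c _ _ => determines_unsat P c⟩
    have : P.length ≤ W.length := by rw [hf]; simp
    simp only [List.length_map]
    omega

end Order

/-! ### Lists of clauses that represent a formula -/

/-- `L` lists the clauses of `F`, each as a list of its literals, without repetitions. -/
structure IsListing (L : List Cl) (F : CNF) : Prop where
  nodup_clause : ∀ c ∈ L, c.Nodup
  nodup : (L.map List.toFinset).Nodup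
  clauses : (L.map List.toFinset).toFinset = F.clauses

section Listing

variable {L N : List Cl} {F F' : CNF}

theorem isRepresentedBy_iff {d : Data} : F.IsRepresentedBy d ↔ ∃ L, IsListing L F ∧ d = enc L :=
  ⟨fun ⟨L, h1, h2, h3, h4⟩ => ⟨L, ⟨h1, h2, h3⟩, h4⟩, fun ⟨L, ⟨h1, h2, h3⟩, h4⟩ =>
    ⟨L, h1, h2, h3, h4⟩⟩

theorem IsListing.unique (h : IsListing L F) (h' : IsListing L F') : F = F' :=
  CNF.ext (h.clauses.symm.trans h'.clauses)

theorem mem_normalize {c : Cl} : c ∈ normalize L ↔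
    ∃ d ∈ L, L.flatten.dedup.filter (fun l => isMem l d) = c := by simp [normalize]

theorem mem_filter_flatten {d : Cl} (hd : d ∈ L) {l : Literal} :
    l ∈ L.flatten.dedup.filter (fun l => isMem l d) ↔ l ∈ d := by
  simp only [List.mem_filter, List.mem_dedup, isMem_eq_true, List.mem_flatten]
  exact ⟨fun h => h.2, fun h => ⟨⟨d, hd, h⟩, h⟩⟩

theorem IsListing.isNormalList (h : IsListing L F) : IsNormalList (normalize L) F where
  clauses c := by
    have h1 : ∀ d ∈ L, (L.flatten.dedup.filter fun l => isMem l d).toFinset = d.toFinset :=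
      fun d hd => by
        ext l
        rw [List.mem_toFinset, List.mem_toFinset, mem_filter_flatten hd]
    rw [← h.clauses, List.mem_toFinset, List.mem_map]
    constructor
    · rintro ⟨d, hd, rfl⟩
      exact ⟨_, mem_normalize.mpr ⟨d, hd, rfl⟩, h1 d hd⟩
    · rintro ⟨_, hc, rfl⟩
      obtain ⟨d, hd, rfl⟩ := mem_normalize.mp hc
      exact ⟨d, hd, (h1 d hd).symm⟩
  common := by
    refine ⟨L.flatten.dedup, fun c hc => ?_⟩
    obtain ⟨d, hd, rfl⟩ := mem_normalize.mp hc
    refine List.filter_congr fun l _ => ?_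
    rw [Bool.eq_iff_iff, isMem_eq_true, isMem_eq_true, mem_filter_flatten hd]

theorem IsNormalList.sat_iff (h : IsNormalList N F) (a : Var → Bool) : F.Sat a ↔ SatList N a := by
  constructor
  · intro hF c hc
    obtain ⟨l, hl, hla⟩ := hF c.toFinset ((h.clauses _).mpr ⟨c, hc, rfl⟩)
    exact ⟨l, List.mem_toFinset.mp hl, hla⟩
  · intro hN c hc
    obtain ⟨d, hd, rfl⟩ := (h.clauses c).mp hc
    obtain ⟨l, hl, hla⟩ := hN d hd
    exact ⟨l, List.mem_toFinset.mpr hl, hla⟩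

theorem IsNormalList.toFinset_order (h : IsNormalList N F) : (order N).toFinset = F.vars := by
  ext x
  simp only [List.mem_toFinset, mem_order, mem_varList, CNF.vars, Finset.mem_biUnion, h.clauses,
    Clause.vars, Finset.mem_image]
  constructor
  · rintro ⟨c, hc, l, hl, rfl⟩
    exact ⟨_, ⟨c, hc, rfl⟩, l, List.mem_toFinset.mpr hl, rfl⟩
  · rintro ⟨_, ⟨c, hc, rfl⟩, l, hl, rfl⟩
    exact ⟨c, hc, l, List.mem_toFinset.mp hl, rfl⟩

theorem mem_order_of_mem {c : Cl} (hc : c ∈ N) {l : Literal} (hl : l ∈ c) : l.1 ∈ order N :=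
  mem_order.mpr (mem_varList.mpr ⟨c, hc, l, hl, rfl⟩)

theorem sz_clause_le (c : Cl) : sz c ≤ 1 + 6 * c.length := by
  induction c with
  | nil => simp
  | cons l c ih =>
    have hb : sz l.2 ≤ 3 := by cases l.2 <;> decide
    have hx : sz l.1 = 1 := rfl
    simp only [sz_cons, sz_prod, List.length_cons]
    omega

theorem sz_clauseList_le (L : List Cl) : sz L ≤ 1 + 2 * L.length + 6 * (L.map List.length).sum := by
  induction L with
  | nil => simp
  | cons c L ih =>
    have := sz_clause_le c
    simp only [sz_cons, List.length_cons, List.map_cons, List.sum_cons]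
    omega

theorem CNF.card_clauses_le (F : CNF) : F.clauses.card ≤ F.size + 1 := by
  -- Only the empty clause does not contribute to the size.
  have h1 : (F.clauses.erase ∅).card ≤ ∑ c ∈ F.clauses.erase ∅, c.card := by
    rw [Finset.card_eq_sum_ones]
    exact Finset.sum_le_sum fun c hc =>
      Finset.one_le_card.mpr (Finset.nonempty_iff_ne_empty.mpr (Finset.ne_of_mem_erase hc))
  have h2 : ∑ c ∈ F.clauses.erase ∅, c.card ≤ F.size :=
    Finset.sum_le_sum_of_subset (Finset.erase_subset _ _)
  have h3 := Finset.pred_card_le_card_erase (s := F.clauses) (a := ∅)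
  omega

theorem IsListing.sz_le (h : IsListing L F) : sz L ≤ 8 * (F.size + 1) := by
  have h1 : L.length = F.clauses.card := by
    rw [← h.clauses, List.toFinset_card_of_nodup h.nodup, List.length_map]
  have h2 : (L.map List.length).sum = F.size := by
    rw [CNF.size, ← h.clauses, List.sum_toFinset _ h.nodup, List.map_map]
    exact congrArg List.sum (List.map_congr_left fun c hc =>
      (List.toFinset_card_of_nodup (h.nodup_clause c hc)).symm)
  have h3 := sz_clauseList_le L
  have h4 := F.card_clauses_le
  omega

theorem exists_bdd_diagram (h : IsListing L F) : ∃ B : BDD,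
    B.IsRepresentedBy (enc (diagram L)) ∧ B.IsOBDD F.vars ∧ B.Computes F := by
  have hN := h.isNormalList
  have hσ := nodup_order (normalize L)
  have hl : (start L).1.length ≤ (order (normalize L)).length := by
    unfold start collapse
    cases isMem [] (order (normalize L), normalize L).2 <;> simp
  refine (isClosedFrom_reach hl).exists_bdd hσ (fun c hc l hl => mem_order_of_mem hc hl) ?_
    hN.sat_iff hN.toFinset_order
  refine reach_induction ?_ (fun S S' hS hS' => hS.children hσ hS') _
  have := arises_collapse (N := normalize L) (P := []) (a := fun _ => false)
    (List.nil_append (order (normalize L))).symm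
  rwa [residual_nil] at this

end Listing

/-! ### Fixed-parameter tractability -/

/-- A bound for the number of bits that distinguish the states of the diagram, apart from
logarithmically many, if there is a deletion set of size `k`. -/
def bits (k : ℕ) : ℕ := 5 * k + 2 * (5 * k * (5 * k))

theorem sz_reach_start_le {L : List Cl} {F : CNF} (h : IsListing L F) {V : Finset Var}
    {C : Finset Clause} {k : ℕ} (hD : F.delete V C ∈ CNF.forests) (hk : V.card + C.card ≤ k)
    (l : List Var) : sz (reach (start L) l) ≤
      1 + (1 + (sz (order (normalize L)) + 1) * (2 ^ bits k * (2 * sz (order (normalize L)) + 1))) *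
        (sz (order (normalize L)) + sz (normalize L) + 6) := by
  refine ((isNarrow_order (normalize L)).sz_reach_le (nodup_order _)
    (fun c hc l hl => mem_order_of_mem hc hl) l).trans ?_
  have hlen : (order (normalize L)).length ≤ sz (order (normalize L)) := (length_lt_sz _).le
  have hsep := h.isNormalList.length_separate_le hD hk
  have hcut := h.isNormalList.length_cutset_le hD hk
  gcongr
  rw [pow_add]
  gcongr
  · norm_num
  · unfold bits
    omega
  · obtain h0 | h0 := Nat.eq_zero_or_pos (order (normalize L)).length
    · simp [h0]
    · have := Nat.pow_log_le_self 2 (x := 2 * (order (normalize L)).length) (by omega)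
      omega

theorem CNF.exists_delete_mem_forests (F : CNF) : ∃ V C, F.delete V C ∈ forests ∧
    V.card + C.card = deletionDistance forests F := by
  obtain ⟨V, C, h⟩ := F.exists_isDeletionSet_forests
  obtain ⟨V, C, h1, h2⟩ := Nat.sInf_mem
    (s := {k | ∃ V C, IsDeletionSet forests F V C ∧ V.card + C.card = k}) ⟨_, V, C, h, rfl⟩
  exact ⟨V, C, h1.2.2, h2⟩

theorem computable_two_pow (K : ℕ) : Computable fun k => 2 ^ (bits k * K) := by
  have hpow : Primrec₂ fun m n : ℕ => m ^ n := Primrec₂.unpaired'.mp Nat.Primrec.pow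
  have h5 : Primrec fun k : ℕ => 5 * k := Primrec.nat_mul.comp (.const 5) .id
  have hb : Primrec bits :=
    Primrec.nat_add.comp h5 (Primrec.nat_mul.comp (.const 2) (Primrec.nat_mul.comp h5 h5))
  exact (hpow.comp (.const 2) (Primrec.nat_mul.comp hb (.const K))).to_comp

/-- The diagram is computed in fixed-parameter tractable time for every parameter that bounds the
deletion distance from above. -/
theorem fptTimeComputableOBDDs_of_le {κ : CNF → ℕ}
    (hκ : ∀ F, CNF.deletionDistance CNF.forests F ≤ κ F) : FPTTimeComputableOBDDs κ := by
  -- A list of clauses represents only one formula, so the parameter is a function of the list.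
  let B : {L : List Cl // ∃ F, IsListing L F} → ℕ := fun x => sz x + 2 ^ bits (κ x.2.choose)
  have hB : PolyBdd B sz := PolyBdd.self.mono fun x => Nat.le_add_right _ _
  have h2 : PolyBdd B fun x => 2 ^ bits (κ x.2.choose) :=
    PolyBdd.self.mono fun x => Nat.le_add_left _ _
  have hL : Poly fun x : {L : List Cl // ∃ F, IsListing L F} => x.1 := .subtypeVal
  have hσ : PolyBdd B fun x => sz (order (normalize x.1)) :=
    (Poly.timeBdd (hL.normalize.order) hB).polyBdd_sz
  have hN : PolyBdd B fun x => sz (normalize x.1) :=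
    (Poly.timeBdd hL.normalize hB).polyBdd_sz
  have hc := fun n => PolyBdd.const (B := B) n
  have hM := (hc 1).add (((hc 1).add ((hσ.add (hc 1)).mul
    (h2.mul (((hc 2).mul hσ).add (hc 1))))).mul ((hσ.add hN).add (hc 6)))
  obtain ⟨P, T, ⟨K, hK⟩, hP⟩ := TimeBdd.diagram hL hB hM fun x l _ => by
    obtain ⟨V, C, hD, hk⟩ := x.2.choose.exists_delete_mem_forests
    exact sz_reach_start_le x.2.choose_spec hD (hk.le.trans (hκ _)) l
  refine ⟨P 0, fun k => 2 ^ (bits k * K), (8 * Polynomial.X + 11) ^ K, computable_two_pow K, ?_⟩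
  intro F d hd
  obtain ⟨L, hL, rfl⟩ := isRepresentedBy_iff.mp hd
  let x : {L : List Cl // ∃ F, IsListing L F} := ⟨L, F, hL⟩
  have hF : x.2.choose = F := x.2.choose_spec.unique hL
  obtain ⟨s, t, hrun, ht, hs, -⟩ := (hP x).2 0 (Store.init (enc L)) rfl
  refine ⟨s, t, hrun, ?_, hs ▸ exists_bdd_diagram hL⟩
  refine (ht.trans (hK x)).trans ?_
  have hsz : sz x ≤ 8 * (F.size + 1) := hL.sz_le
  have hpos : 0 < 2 ^ bits (κ F) := by positivity
  beta_reduce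
  rw [pow_mul, Polynomial.eval_pow, ← mul_pow]
  refine Nat.pow_le_pow_left ?_ K
  simp only [B, hF, Polynomial.eval_add, Polynomial.eval_mul, Polynomial.eval_ofNat,
    Polynomial.eval_X]
  nlinarith

/-- A feedback vertex set of the incidence graph is a deletion set: the incidence graph of the
resulting formula embeds into the forest that is left, as it has one vertex for each class of
clauses that become equal. -/
theorem CNF.deletionDistance_le_fvsNumber (F : CNF) :
    deletionDistance forests F ≤ fvsNumber F.inc := by
  have hne : {k | ∃ D : Finset ({x // x ∈ F.vars} ⊕ {c // c ∈ F.clauses}),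
      (F.inc.induce ((D : Set ({x // x ∈ F.vars} ⊕ {c // c ∈ F.clauses}))ᶜ)).IsAcyclic ∧
        D.card = k}.Nonempty :=
    ⟨Finset.univ.card, Finset.univ,
      fun v => (v.2 (Finset.mem_coe.mpr (Finset.mem_univ _))).elim, rfl⟩
  obtain ⟨D, hD, hcard⟩ := Nat.sInf_mem hne
  let V : Finset Var := D.toLeft.image Subtype.val
  let C : Finset Clause := D.toRight.image Subtype.val
  have hVC : V.card + C.card ≤ fvsNumber F.inc := by
    have h1 := D.card_toLeft_add_card_toRight
    have h2 : V.card ≤ D.toLeft.card := Finset.card_image_le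
    have h3 : C.card ≤ D.toRight.card := Finset.card_image_le
    have h4 : D.card = fvsNumber F.inc := hcard
    omega
  refine le_trans (Nat.sInf_le ⟨V, C, ⟨?_, ?_, ?_⟩, rfl⟩) hVC
  · intro x hx
    obtain ⟨y, -, rfl⟩ := Finset.mem_image.mp hx
    exact y.2
  · intro c hc
    obtain ⟨d, -, rfl⟩ := Finset.mem_image.mp hc
    exact d.2
  have hf : ∀ c : {c // c ∈ (F.delete V C).clauses}, ∃ d : {c // c ∈ F.clauses},
      d.1 ∉ C ∧ (d.1.filter fun l => l.1 ∉ V) = c.1 := fun c => by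
    obtain ⟨d, hd, hdc⟩ := Finset.mem_image.mp c.2
    exact ⟨⟨d, (Finset.mem_sdiff.mp hd).1⟩, (Finset.mem_sdiff.mp hd).2, hdc⟩
  choose f hfC hf using hf
  have hfv : ∀ c, ∀ x ∈ Clause.vars c.1, x ∈ Clause.vars (f c).1 ∧ x ∉ V := fun c x hx => by
    rw [← hf c] at hx
    obtain ⟨l, hl, rfl⟩ := Finset.mem_image.mp hx
    exact ⟨Finset.mem_image_of_mem _ (Finset.mem_filter.mp hl).1, (Finset.mem_filter.mp hl).2⟩
  have hv : ∀ x : {x // x ∈ (F.delete V C).vars}, x.1 ∈ F.vars ∧ x.1 ∉ V := fun x => by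
    obtain ⟨c, hc, hx⟩ := Finset.mem_biUnion.mp x.2
    have := hfv ⟨c, hc⟩ _ hx
    exact ⟨Finset.mem_biUnion.mpr ⟨_, (f ⟨c, hc⟩).2, this.1⟩, this.2⟩
  let φ : (F.delete V C).inc →g F.inc.induce ((D : Set _)ᶜ) :=
    { toFun := Sum.elim
        (fun x => ⟨.inl ⟨x.1, (hv x).1⟩, fun h => (hv x).2
          (Finset.mem_image.mpr ⟨⟨x.1, (hv x).1⟩, Finset.mem_toLeft.mpr h, rfl⟩)⟩)
        (fun c => ⟨.inr (f c), fun h => hfC c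
          (Finset.mem_image.mpr ⟨f c, Finset.mem_toRight.mpr h, rfl⟩)⟩)
      map_rel' := by
        rintro (x | c) (y | d) h
        · exact h.elim
        · exact (hfv d _ h).1
        · exact (hfv c _ h).1
        · exact h.elim }
  refine SimpleGraph.IsAcyclic.comap φ ?_ hD
  rintro (x | c) (y | d) h
  · have h := congrArg Subtype.val h
    simp only [φ, RelHom.coeFn_mk, Sum.elim_inl, Sum.inl.injEq, Subtype.mk.injEq] at h
    rw [Subtype.ext h]
  · simpa [φ] using congrArg Subtype.val h
  · simpa [φ] using congrArg Subtype.val h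
  · have h : f c = f d := by simpa [φ] using congrArg Subtype.val h
    rw [Subtype.ext ((hf c).symm.trans ((congrArg _ (congrArg _ h)).trans (hf d)))]

end CNFtoOBDD

theorem mainTheorem10 :
    CNFtoOBDD.FPTTimeComputableOBDDs (CNFtoOBDD.CNF.deletionDistance CNFtoOBDD.CNF.forests) ∧
    (∀ F : CNFtoOBDD.CNF,
      CNFtoOBDD.CNF.deletionDistance CNFtoOBDD.CNF.forests F ≤ CNFtoOBDD.CNF.fvsNumber F.inc) ∧
    CNFtoOBDD.FPTTimeComputableOBDDs (fun F => CNFtoOBDD.CNF.fvsNumber F.inc) :=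
  ⟨CNFtoOBDD.fptTimeComputableOBDDs_of_le fun _ => le_rfl,
    CNFtoOBDD.CNF.deletionDistance_le_fvsNumber,
    CNFtoOBDD.fptTimeComputableOBDDs_of_le CNFtoOBDD.CNF.deletionDistance_le_fvsNumber⟩
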